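/- Let $\mathbb{N}=\{1,2,\dots\}$ and $\mathbb{N}_0=\mathbb{N}\cup\{0\}$. For $A\subseteq\mathbb{N}_0$ let $W^A=\{W^A_m\}_{m\in\mathbb{N}}$ be the Boolean constraint language with $W^A_m=\{T\subseteq\{1,\dots,m\} : |T|\in A\}$, where a tuple in $\{0,1\}^m$ is identified with the set of its $1$-positions. A constraint $W^A_m\langle v_1,\dots,v_m\rangle$ (with variables $v_i$, repetitions allowed) is satisfied by a set $D$ of variables if $\{i : v_i\in D\}\in W^A_m$. An instance $I=(V,C)$ of $\mathrm{CSP}(W^E)$ with weight parameter consists of a finite set $V\neq\emptyset$ of variables and a finite sequence $C$ of constraints over $V$, the first of which is $W^{\{k_0\}}_{|V|}\langle v_1,\dots,v_{|V|}\rangle$ with $k_0\in\mathbb{N}_0$ and $V=\{v_1,\dots,v_{|V|}\}$, and the others of which are constraints for $W^E$. The question is whether some $D\subseteq V$ satisfies all the constraints. Its parameters are $k(I)=k_0$; $t(I)$, the maximum over $v\in V$ of the total number of occurrences of $v$ in the constraints in $C$; and $e(I)$, the maximum over $v\in V$ and over the constraints in $C$ of the number of occurrences of $v$ in that constraint. Let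 $\mathrm{CSP}(W^E)_{k,t}$ and $\mathrm{CSP}(W^E)_{k,t,e}$ be the problems parameterized by $k+t$ and by $k+t+e$, respectively. Instances are encoded as strings, with integers in binary. A parameterized problem $(Q,\kappa)$, where $Q\subseteq\Sigma^*$ and $\kappa:\Sigma^*\to\mathbb{N}_0$ is polynomial time computable, is fixed-parameter tractable if some Turing machine decides $x\in Q$ in at most $f(\kappa(x))\cdot p(|x|)$ steps for all $x\in\Sigma^*$, where $f$ is a computable function and $p$ is a polynomial. Let $E\subseteq\mathbb{N}$ (so $0\notin E$). 1. If $E$ is decidable, then $\mathrm{CSP}(W^E)_{k,t,e}$ is fixed-parameter tractable. 2. If $E$ or $\mathbb{N}\setminus E$ is finite, then $\mathrm{CSP}(W^E)_{k,t}$ is fixed-parameter tractable. In particular, $\mathrm{CSP}(W^{\mathbb{N}})_{k,t}$, $\mathrm{CSP}(W^{\{1\}})_{k,t}$ and $\mathrm{CSP}(W^{\mathrm{odd}})_{k,t}$ are fixed-parameter tractable, where $\mathrm{odd}$ is the set of odd positive integers. -/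

import Mathlib

open Computability Turing

namespace ParamCSP

/-! ### Parameterized problems and fixed-parameter tractability -/

/-- A set `yes` of strings over the alphabet `A`, together with a parameter `κ x` for every string
`x` over `A`. -/
structure ParameterizedProblem (A : Type) where
  yes : Set (List A)
  κ : List A → ℕ

/-- The Turing machine `M` halts on the input word `x` with output word `y` (and all other storage
emptied) after at most `n` steps. Machines are Mathlib's multi-stack Turing machines, with finitely
many states, labels and stacks, so that a program can only ever write finitely many symbols. -/
def HaltsWithin {A B : Type} (M : TM2ComputableAux A B) (x : List A) (y : List B) (n : ℕ) : Prop :=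
  Nonempty (TM2OutputsInTime M.tm (x.map M.inputAlphabet.invFun)
    (some (y.map M.outputAlphabet.invFun)) n)

/-- `κ` is a parameterization: it is computable in polynomial time (with values in binary). -/
def IsParameterization {A : Type} (κ : List A → ℕ) : Prop :=
  Nonempty (TM2ComputableInPolyTime (id : List A → List A) encodeNat κ)

open Classical in
/-- Fixed-parameter tractability: `κ` is a parameterization, and there is a Turing machine which
decides for every string `x` whether `x` is a yes-instance, in at most `f (κ x) * p (|x|)` steps, for
a computable function `f` and a polynomial `p`. -/
def ParameterizedProblem.IsFPT {A : Type} (P : ParameterizedProblem A) : Prop :=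
  IsParameterization P.κ ∧
    ∃ f : ℕ → ℕ, Computable f ∧ ∃ (p : Polynomial ℕ) (M : TM2ComputableAux A Bool),
      ∀ x : List A,
        HaltsWithin M x (encodeBool (decide (x ∈ P.yes))) (f (P.κ x) * p.eval x.length)

/-! ### Boolean constraint languages -/

/-- A Boolean relation of arity at least one. A tuple is identified with the set of those positions
at which it has a `1`. -/
structure BoolRel where
  arity : ℕ
  arity_pos : 0 < arity
  tuples : Set (Finset (Fin arity))

/-- A Boolean constraint language: a family of Boolean relations indexed by positive integers. -/
abbrev ConstraintLanguage : Type := ℕ+ → BoolRel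

/-- The language `W^A`: its `m`-th relation has arity `m` and consists of the tuples whose weight
lies in `A`. -/
def W (A : Set ℕ) : ConstraintLanguage := fun m =>
  { arity := m
    arity_pos := m.pos
    tuples := {T | T.card ∈ A} }

/-- A constraint `R_index⟨scope 0, scope 1, …⟩` for `Γ`. Variable symbols are natural numbers. -/
structure Constraint (Γ : ConstraintLanguage) where
  index : ℕ+
  scope : Fin (Γ index).arity → ℕ

namespace Constraint

variable {Γ : ConstraintLanguage}

/-- The assignment `D` (the set of variables that are set to `1`) satisfies the constraint. -/
def SatisfiedBy (c : Constraint Γ) (D : Finset ℕ) : Prop :=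
  (Finset.univ.filter fun i => c.scope i ∈ D) ∈ (Γ c.index).tuples

/-- The number of occurrences of the variable `v` in the constraint. -/
def occ (c : Constraint Γ) (v : ℕ) : ℕ :=
  (Finset.univ.filter fun i => c.scope i = v).card

/-- The index of the relation, followed by the variables of the scope. -/
def code (c : Constraint Γ) : List ℕ :=
  (c.index : ℕ) :: List.ofFn c.scope

theorem code_injective : Function.Injective (code (Γ := Γ)) := by
  rintro ⟨i, s⟩ ⟨j, s'⟩ h
  simp only [code, List.cons.injEq, PNat.coe_inj] at h
  obtain ⟨rfl, h⟩ := h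
  have h' := List.ofFn_injective h
  simp_all

end Constraint

/-- An instance `(V, C)` of `CSP(Γ)` with a weight parameter. The sequence `C` of constraints starts
with the weight constraint `W^{{k₀}}_{|V|}⟨v₁, …, v_m⟩`, where `V = {v₁, …, v_m}`, and goes on with
the constraints in `rest`, which are constraints for `Γ`. -/
structure Instance (Γ : ConstraintLanguage) where
  V : Finset ℕ
  k₀ : ℕ
  first : Constraint (W {k₀})
  first_index : (first.index : ℕ) = V.card
  first_range : Set.range first.scope = V
  rest : List (Constraint Γ)
  rest_mem : ∀ c ∈ rest, ∀ i, c.scope i ∈ V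

namespace Instance

variable {Γ : ConstraintLanguage}

/-- Some assignment `D ⊆ V` satisfies all the constraints. -/
def Satisfiable (I : Instance Γ) : Prop :=
  ∃ D ⊆ I.V, I.first.SatisfiedBy D ∧ ∀ c ∈ I.rest, c.SatisfiedBy D

/-- The parameter `k`: the weight. -/
def k (I : Instance Γ) : ℕ := I.k₀

/-- For each constraint in `C`, in order, the number of occurrences of the variable `v`. -/
def occs (I : Instance Γ) (v : ℕ) : List ℕ :=
  I.first.occ v :: I.rest.map fun c => c.occ v

/-- The parameter `t`: the maximum number of occurrences of a variable in the whole instance. -/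
def t (I : Instance Γ) : ℕ := I.V.sup fun v => (I.occs v).sum

/-- The parameter `e`: the maximum number of occurrences of a variable in a single constraint. -/
def e (I : Instance Γ) : ℕ := I.V.sup fun v => (I.occs v).foldr max 0

end Instance

/-! ### Encoding of instances as strings -/

/-- Writes `f a` followed by the terminator `s`, for each entry `a` of the list in turn. -/
def encodeSeq {α B : Type} (f : α → List B) (s : B) (l : List α) : List B :=
  l.flatMap fun a => f a ++ [s]

theorem encodeSeq_injective {α B : Type} {f : α → List B} {s : B}
    (hf : Function.Injective f) (hs : ∀ a, s ∉ f a) : Function.Injective (encodeSeq f s) := by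
  intro l
  induction l with
  | nil =>
    intro l' h
    cases l' with
    | nil => rfl
    | cons b l' => simp [encodeSeq] at h
  | cons a l ih =>
    intro l' h
    cases l' with
    | nil => simp [encodeSeq] at h
    | cons b l' =>
      simp only [encodeSeq, List.flatMap_cons, List.append_assoc, List.singleton_append] at h
      have key : ∀ (x y u w : List B), s ∉ x → s ∉ y → x ++ s :: u = y ++ s :: w →
          x = y ∧ u = w := by
        intro x
        induction x with
        | nil =>
          intro y u w _ hy h
          cases y with
          | nil => simpa using h
          | cons c y => simp_all
        | cons c x ihx =>
          intro y u w hx hy h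
          cases y with
          | nil => simp_all
          | cons d y =>
            simp only [List.cons_append, List.cons.injEq] at h
            simp only [List.mem_cons, not_or] at hx hy
            obtain ⟨h1, h2⟩ := ihx y u w hx.2 hy.2 h.2
            exact ⟨by rw [h.1, h1], h2⟩
      obtain ⟨h1, h2⟩ := key _ _ _ _ (hs a) (hs b) h
      rw [hf h1, ih h2]

/-- The binary digits of a natural number. -/
def encodeNumber (n : ℕ) : List Γ' := (encodeNat n).map Γ'.bit

theorem encodeNumber_injective : Function.Injective encodeNumber := by
  intro m n h
  have h' : encodeNat m = encodeNat n :=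
    List.map_injective_iff.2 (fun a b hab => by simpa using hab) h
  rw [← decode_encodeNat m, h', decode_encodeNat]

/-- A list of lists of numbers, with numbers in binary. Every number is followed by `comma`, and
every list of numbers is followed by `ket`. -/
def encodeLists : List (List ℕ) → List Γ' :=
  encodeSeq (encodeSeq encodeNumber Γ'.comma) Γ'.ket

theorem encodeLists_injective : Function.Injective encodeLists := by
  refine encodeSeq_injective (encodeSeq_injective encodeNumber_injective ?_) ?_ <;> intro a
  · simp [encodeNumber]
  · simp [encodeSeq, encodeNumber]

namespace Instance

variable {Γ : ConstraintLanguage}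

/-- The string for an instance. It lists the constraints, each one by the index of its relation and
its variables; for the first relation `W^{{k₀}}_m` the index consists of `k₀` and `m`. The set `V` is
the set of the variables of the first constraint. -/
def encode (I : Instance Γ) : List Γ' :=
  encodeLists ((I.k₀ :: I.first.code) :: I.rest.map Constraint.code)

theorem encode_injective : Function.Injective (encode (Γ := Γ)) := by
  rintro ⟨V, k, c, h1, h2, r, h3⟩ ⟨V', k', c', h1', h2', r', h3'⟩ h
  have h := encodeLists_injective h
  simp only [List.cons.injEq] at h
  obtain ⟨⟨rfl, hc⟩, hr⟩ := h
  obtain rfl := Constraint.code_injective hc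
  obtain rfl := List.map_injective_iff.2 Constraint.code_injective hr
  obtain rfl : V = V' := by
    rw [h2] at h2'
    exact_mod_cast h2'
  rfl

end Instance

/-- `CSP(Γ)` with a weight constraint, parameterized by `param`: the yes-instances are the strings
that encode satisfiable instances. Strings that encode no instance are no-instances, with
parameter `1`. -/
noncomputable def CSP (Γ : ConstraintLanguage) (param : Instance Γ → ℕ) :
    ParameterizedProblem Γ' where
  yes := {x | ∃ I : Instance Γ, I.encode = x ∧ I.Satisfiable}
  κ := Function.extend Instance.encode param fun _ => 1

theorem CSP_κ_encode {Γ : ConstraintLanguage} (param : Instance Γ → ℕ) (I : Instance Γ) :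
    (CSP Γ param).κ I.encode = param I :=
  Instance.encode_injective.extend_apply param (fun _ => 1) I

/-- `CSP(Γ)_{k,t}`. As usual, several parameters are combined into one by adding them. -/
noncomputable def CSP_kt (Γ : ConstraintLanguage) : ParameterizedProblem Γ' :=
  CSP Γ fun I => I.k + I.t

/-- `CSP(Γ)_{k,t,e}`. -/
noncomputable def CSP_kte (Γ : ConstraintLanguage) : ParameterizedProblem Γ' :=
  CSP Γ fun I => I.k + I.t + I.e

end ParamCSP

/-! The combinatorial core is a counting argument. Let `k` be the weight and `t` the maximum number
of occurrences of a variable. An assignment `D` of weight `k` occupies at most `k * t` positions,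
counted over all constraints. Since `0 ∉ E`, every constraint other than the weight constraint needs
at least one occupied position; hence an instance with more than `k * t` of them is unsatisfiable
(`listSat_iff`). Otherwise, call the vector of the numbers of positions of `D` in the constraints,
the weight constraint included, the profile of `D`. For `|D| ≤ k` it has at most `k * t + 1`
entries, each at most `k * t`, so there are at most `(k * t + 1) ^ (k * t + 1)` profiles
(`Good.card_le`). Whether `D` is a solution depends on its profile only, and adding a new variable
to `D` adds a fixed vector to the profile (`hits_cons`). So a dynamic program that runs through the
variables and keeps one assignment of weight at most `k` per profile meets all profiles
(`reps_spec`). Membership in `E` is only asked for numbers up to `k * t`, so its cost is a function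
of the parameter as soon as `E` is decidable. Thus one algorithm handles both parameterizations, and
finite and cofinite sets are decidable.

Most of the work is to run this algorithm on a Turing machine with a time bound. Structured stack
programs are compiled to multi-stack machines step by step (`steps_of_exec`). All data are binary
trees, written on one stack in prefix code. `PTime s B f` says that, on the set `s`, the values and
running times of a program for `f` are polynomial in `B`; it is closed under composition, cases,
loops and folds, and these rules reduce the complexity analysis to bounds on intermediate data.
Taking `B` to be the input size gives polynomial time, and adding a computable function of the
parameter gives fixed-parameter time.

Two points need care. A computable predicate comes without a running time: primitive recursive
functions get primitive recursive bounds (`PTime.of_primrec`), and a search for a sufficient number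
of evaluation steps then yields a computable bound (`PTime.of_computablePred`). Moreover, integers
in the input are binary while internal counters are unary. Variables therefore stay bit lists, the
parameter is computed by incrementing a binary numeral, and the weight is cut off just above the
number of variables before it becomes a counter. -/

/-! ### Structured stack programs and their compilation to Turing machines -/

namespace StackProgram

/-- Structured programs over finitely many stacks. Tests look at the top of a stack only. -/
inductive Cmd {K : Type} (Γ : K → Type) : Type
  | skip : Cmd Γ
  | push (k : K) (a : Γ k) : Cmd Γ
  | pop (k : K) : Cmd Γ
  | seq (p q : Cmd Γ) : Cmd Γ
  | cond (k : K) (t : Option (Γ k) → Bool) (p q : Cmd Γ) : Cmd Γ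
  | loop (k : K) (t : Option (Γ k) → Bool) (p : Cmd Γ) : Cmd Γ

variable {K : Type} {Γ : K → Type}

/-- `Exec p S S' n`: the program `p` leads from the store `S` to the store `S'` in `n` steps. -/
inductive Exec [DecidableEq K] :
    Cmd Γ → (∀ k, List (Γ k)) → (∀ k, List (Γ k)) → ℕ → Prop
  | skip (S) : Exec .skip S S 1
  | push (k a S) : Exec (.push k a) S (Function.update S k (a :: S k)) 1
  | pop (k S) : Exec (.pop k) S (Function.update S k (S k).tail) 1
  | seq {p q S S' S'' m n} : Exec p S S' m → Exec q S' S'' n → Exec (.seq p q) S S'' (m + n)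
  | cond_true {k t p q S S' n} : t (S k).head? = true → Exec p S S' n →
      Exec (.cond k t p q) S S' (n + 1)
  | cond_false {k t p q S S' n} : t (S k).head? = false → Exec q S S' n →
      Exec (.cond k t p q) S S' (n + 1)
  | loop_true {k t p S S' S'' m n} : t (S k).head? = true → Exec p S S' m →
      Exec (.loop k t p) S' S'' n → Exec (.loop k t p) S S'' (m + n + 1)
  | loop_false {k t p S} : t (S k).head? = false → Exec (.loop k t p) S S 1

/-- The labels of the Turing machine for a program. -/
def Cmd.Lab : Cmd Γ → Type
  | .skip => Unit
  | .push _ _ => Unit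
  | .pop _ => Unit
  | .seq p q => p.Lab ⊕ q.Lab
  | .cond _ _ p q => Option (p.Lab ⊕ q.Lab)
  | .loop _ _ p => Option p.Lab

/-- A program has finitely many labels. -/
@[reducible]
def Cmd.labFintype : (p : Cmd Γ) → Fintype p.Lab
  | .skip => inferInstanceAs (Fintype Unit)
  | .push _ _ => inferInstanceAs (Fintype Unit)
  | .pop _ => inferInstanceAs (Fintype Unit)
  | .seq p q =>
    letI := p.labFintype; letI := q.labFintype; inferInstanceAs (Fintype (p.Lab ⊕ q.Lab))
  | .cond _ _ p q =>
    letI := p.labFintype; letI := q.labFintype; inferInstanceAs (Fintype (Option (p.Lab ⊕ q.Lab)))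
  | .loop _ _ p => letI := p.labFintype; inferInstanceAs (Fintype (Option p.Lab))

/-- The label at which the execution of a program starts. -/
def Cmd.entry : (p : Cmd Γ) → p.Lab
  | .skip => ()
  | .push _ _ => ()
  | .pop _ => ()
  | .seq p _ => Sum.inl p.entry
  | .cond _ _ _ _ => none
  | .loop _ _ _ => none

/-- The statements of the Turing machine for a program whose labels are embedded into `Λ` by `emb`,
and which continues at the label `exit`. -/
def Cmd.stmt {Λ : Type} : (p : Cmd Γ) → (p.Lab → Λ) → Λ → p.Lab → TM2.Stmt Γ Λ Bool
  | .skip, _, exit, _ => .goto fun _ => exit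
  | .push k a, _, exit, _ => .push k (fun _ => a) (.goto fun _ => exit)
  | .pop k, _, exit, _ => .pop k (fun v _ => v) (.goto fun _ => exit)
  | .seq p q, emb, _, .inl l => p.stmt (emb ∘ Sum.inl) (emb (.inr q.entry)) l
  | .seq _ q, emb, exit, .inr l => q.stmt (emb ∘ Sum.inr) exit l
  | .cond k t p q, emb, _, none => .peek k (fun _ a => t a) (.branch id
      (.goto fun _ => emb (some (.inl p.entry))) (.goto fun _ => emb (some (.inr q.entry))))
  | .cond _ _ p _, emb, exit, some (.inl l) => p.stmt (fun l => emb (some (.inl l))) exit l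
  | .cond _ _ _ q, emb, exit, some (.inr l) => q.stmt (fun l => emb (some (.inr l))) exit l
  | .loop k t p, emb, exit, none => .peek k (fun _ a => t a) (.branch id
      (.goto fun _ => emb (some p.entry)) (.goto fun _ => exit))
  | .loop _ _ p, emb, _, some l => p.stmt (fun l => emb (some l)) (emb none) l

/-! ### Correctness of the compilation -/

section Steps

variable [DecidableEq K] {Λ σ : Type}

/-- The machine `M` leads from the configuration `c` to the configuration `c'` in `n` steps. -/
def Steps (M : Λ → TM2.Stmt Γ Λ σ) (n : ℕ) (c c' : TM2.Cfg Γ Λ σ) : Prop :=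
  (flip bind (TM2.step M))^[n] (some c) = some c'

theorem Steps.trans {M : Λ → TM2.Stmt Γ Λ σ} {m n : ℕ} {c c' c'' : TM2.Cfg Γ Λ σ}
    (h : Steps M m c c') (h' : Steps M n c' c'') : Steps M (m + n) c c'' := by
  unfold Steps at *
  rw [Nat.add_comm, Function.iterate_add_apply, h, h']

theorem Steps.one {M : Λ → TM2.Stmt Γ Λ σ} {c c' : TM2.Cfg Γ Λ σ}
    (h : TM2.step M c = some c') : Steps M 1 c c' := h

theorem Steps.test {M : Λ → TM2.Stmt Γ Λ Bool} {l l₁ l₂ : Λ} {k : K} {t : Option (Γ k) → Bool}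
    (hl : M l = .peek k (fun _ a => t a) (.branch id (.goto fun _ => l₁) (.goto fun _ => l₂)))
    (v : Bool) (S : ∀ k, List (Γ k)) :
    Steps M 1 ⟨some l, v, S⟩ ⟨some (bif t (S k).head? then l₁ else l₂), t (S k).head?, S⟩ :=
  .one (by rw [TM2.step, hl]; simp only [TM2.stepAux, id]; cases t (S k).head? <;> rfl)

/-- The machine makes exactly one step per unit of cost, by induction on the execution, for all
embeddings of the labels and all exits at once. The body of a loop exits to the test label `emb
none`, where the hypothesis for the remaining rounds starts. The final `v'` is not specified because
the internal bit stores the outcome of the last test. -/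
theorem steps_of_exec {M : Λ → TM2.Stmt Γ Λ Bool} {p : Cmd Γ} {S S' : ∀ k, List (Γ k)} {n : ℕ}
    (h : Exec p S S' n) : ∀ (emb : p.Lab → Λ) (exit : Λ),
      (∀ l, M (emb l) = p.stmt emb exit l) → ∀ v, ∃ v',
        Steps M n ⟨some (emb p.entry), v, S⟩ ⟨some exit, v', S'⟩ := by
  induction h with
  | skip S => exact fun emb exit hM v => ⟨v, .one (by simp [hM, Cmd.stmt])⟩
  | push k a S => exact fun emb exit hM v => ⟨v, .one (by simp [hM, Cmd.stmt])⟩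
  | pop k S => exact fun emb exit hM v => ⟨v, .one (by simp [hM, Cmd.stmt])⟩
  | @seq p q S S' S'' m n _ _ ihp ihq =>
    intro emb exit hM v
    obtain ⟨v', h'⟩ := ihp (emb ∘ Sum.inl) (emb (.inr q.entry))
      (fun l => hM (Sum.inl l)) v
    obtain ⟨v'', h''⟩ := ihq (emb ∘ Sum.inr) exit (fun l => hM (Sum.inr l)) v'
    exact ⟨v'', h'.trans h''⟩
  | @cond_true k t p q S S' n ht _ ih =>
    intro emb exit hM v
    obtain ⟨v', h'⟩ := ih (fun l => emb (some (.inl l))) exit (fun l => hM (some (.inl l))) true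
    have h := Steps.test (hM none) v S
    rw [ht] at h
    exact ⟨v', Nat.add_comm 1 n ▸ h.trans h'⟩
  | @cond_false k t p q S S' n ht _ ih =>
    intro emb exit hM v
    obtain ⟨v', h'⟩ := ih (fun l => emb (some (.inr l))) exit (fun l => hM (some (.inr l))) false
    have h := Steps.test (hM none) v S
    rw [ht] at h
    exact ⟨v', Nat.add_comm 1 n ▸ h.trans h'⟩
  | @loop_true k t p S S' S'' m n ht _ _ ihp ihq =>
    intro emb exit hM v
    obtain ⟨v', h'⟩ := ihp (fun l => emb (some l)) (emb none) (fun l => hM (some l)) true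
    obtain ⟨v'', h''⟩ := ihq emb exit hM v'
    have h := Steps.test (hM none) v S
    rw [ht] at h
    exact ⟨v'', Nat.add_comm 1 (m + n) ▸ h.trans (h'.trans h'')⟩
  | @loop_false k t p S ht =>
    intro emb exit hM v
    have h := Steps.test (hM none) v S
    rw [ht] at h
    exact ⟨false, h⟩

end Steps

/-- The Turing machine for a program, with input stack `k₀` and output stack `k₁`. -/
def Cmd.machine [DecidableEq K] [Fintype K] (p : Cmd Γ) (k₀ k₁ : K) [Fintype (Γ k₀)] : FinTM2 where
  K := K
  k₀ := k₀
  k₁ := k₁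
  Γ := Γ
  Λ := Option p.Lab
  main := some p.entry
  ΛFin := letI := p.labFintype; inferInstance
  σ := Bool
  initialState := false
  m
    -- A halting configuration must carry the initial internal state, so the outcome of the last
    -- test is erased first. This costs the one additional step.
    | none => .load (fun _ => false) .halt
    | some l => p.stmt some none l

theorem Cmd.machine_outputs [DecidableEq K] [Fintype K] (p : Cmd Γ) (k₀ k₁ : K) [Fintype (Γ k₀)]
    {x : List (Γ k₀)} {y : List (Γ k₁)} {n m : ℕ}
    (h : Exec p (initList (p.machine k₀ k₁) x).stk (haltList (p.machine k₀ k₁) y).stk n)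
    (hn : n < m) : Nonempty (TM2OutputsInTime (p.machine k₀ k₁) x (some y) m) := by
  obtain ⟨v, hv⟩ := steps_of_exec (M := (p.machine k₀ k₁).m) h some none (fun l => rfl) false
  refine ⟨⟨⟨n + 1, ?_⟩, hn⟩⟩
  exact hv.trans (Steps.one (M := (p.machine k₀ k₁).m) (c' := haltList _ y) rfl)

end StackProgram

/-! ### Binary trees on a stack -/

namespace TreeProgram

open StackProgram StackProgram.Cmd

/-- Binary trees, the data of all programs below. -/
inductive Tree₀
  | nil : Tree₀
  | cons (a b : Tree₀) : Tree₀

namespace Tree₀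

/-- The self-delimiting prefix code of a tree. -/
def code : Tree₀ → List Bool
  | nil => [false]
  | cons a b => true :: (a.code ++ b.code)

/-- The number of nodes and leaves of a tree. -/
def size : Tree₀ → ℕ
  | nil => 1
  | cons a b => a.size + b.size + 1

theorem length_code (x : Tree₀) : x.code.length = x.size := by
  induction x with
  | nil => rfl
  | cons a b iha ihb => simp [code, size, iha, ihb]

theorem size_pos (x : Tree₀) : 0 < x.size := by
  cases x <;> simp [size]

/-- The left subtree. -/
def fst : Tree₀ → Tree₀
  | nil => nil
  | cons a _ => a

/-- The right subtree. -/
def snd : Tree₀ → Tree₀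
  | nil => nil
  | cons _ b => b

theorem size_fst_le (x : Tree₀) : x.fst.size ≤ x.size := by
  cases x <;> simp only [fst, size] <;> omega

theorem size_snd_le (x : Tree₀) : x.snd.size ≤ x.size := by
  cases x <;> simp only [snd, size] <;> omega

end Tree₀

/-- The stacks: the input, the output, the stack for the data, and three auxiliary stacks. -/
inductive Stk
  | inp | out | main | left | right | count
  deriving DecidableEq

instance : Fintype Stk :=
  ⟨{.inp, .out, .main, .left, .right, .count}, fun k => by cases k <;> simp⟩

/-- The alphabets of the stacks. -/
abbrev Alph : Stk → Type
  | .inp => Γ'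
  | .out => Bool
  | .main => Bool
  | .left => Bool
  | .right => Bool
  | .count => Bool

/-- The store with given contents of the stacks. -/
def store (i : List Γ') (o a b c n : List Bool) : ∀ k, List (Alph k)
  | .inp => i
  | .out => o
  | .main => a
  | .left => b
  | .right => c
  | .count => n

section Store

variable (i i' : List Γ') (o a b c n w : List Bool)

@[simp] theorem store_inp : store i o a b c n .inp = i := rfl
@[simp] theorem store_out : store i o a b c n .out = o := rfl
@[simp] theorem store_main : store i o a b c n .main = a := rfl
@[simp] theorem store_left : store i o a b c n .left = b := rfl
@[simp] theorem store_right : store i o a b c n .right = c := rfl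
@[simp] theorem store_count : store i o a b c n .count = n := rfl

@[simp] theorem update_inp :
    Function.update (store i o a b c n) .inp i' = store i' o a b c n := by
  funext k; cases k <;> rfl
@[simp] theorem update_out :
    Function.update (store i o a b c n) .out w = store i w a b c n := by
  funext k; cases k <;> rfl
@[simp] theorem update_main :
    Function.update (store i o a b c n) .main w = store i o w b c n := by
  funext k; cases k <;> rfl
@[simp] theorem update_left :
    Function.update (store i o a b c n) .left w = store i o a w c n := by
  funext k; cases k <;> rfl
@[simp] theorem update_right :
    Function.update (store i o a b c n) .right w = store i o a b w n := by
  funext k; cases k <;> rfl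
@[simp] theorem update_count :
    Function.update (store i o a b c n) .count w = store i o a b c w := by
  funext k; cases k <;> rfl

end Store

section Exec

variable {K : Type} {Γ : K → Type} [DecidableEq K]

theorem exec_push {k : K} {a : Γ k} {S S' : ∀ k, List (Γ k)}
    (h : Function.update S k (a :: S k) = S') : Exec (push k a) S S' 1 := h ▸ Exec.push k a S

theorem exec_pop {k : K} {S S' : ∀ k, List (Γ k)}
    (h : Function.update S k (S k).tail = S') : Exec (pop k) S S' 1 := h ▸ Exec.pop k S

theorem exec_cast {p : Cmd Γ} {S S' T T' : ∀ k, List (Γ k)} {m n : ℕ} (h : Exec p S S' m)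
    (hS : S = T) (hS' : S' = T') (hm : m = n) : Exec p T T' n := by
  subst hS hS' hm; exact h

end Exec

/-- The test for the symbol `true`. -/
def isTrue (a : Option Bool) : Bool := a == some true

/-- Pushes the symbol if `b`. -/
def pushIf (b : Bool) (k : Stk) (a : Alph k) : Cmd Alph := bif b then push k a else skip

/-- Puts the list in front of the other if `b`. -/
def appendIf (b : Bool) (w l : List Bool) : List Bool := bif b then w ++ l else l

theorem exec_pushIf_left (b s : Bool) (i : List Γ') (o a l r n : List Bool) :
    Exec (pushIf b .left s) (store i o a l r n) (store i o a (appendIf b [s] l) r n) 1 := by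
  cases b
  · exact Exec.skip _
  · exact exec_push (by simp [appendIf])

theorem exec_pushIf_right (b s : Bool) (i : List Γ') (o a l r n : List Bool) :
    Exec (pushIf b .right s) (store i o a l r n) (store i o a l (appendIf b [s] r) n) 1 := by
  cases b
  · exact Exec.skip _
  · exact exec_push (by simp [appendIf])

theorem appendIf_appendIf (b : Bool) (w w' l : List Bool) :
    appendIf b w (appendIf b w' l) = appendIf b (w ++ w') l := by
  cases b <;> simp [appendIf]

/-- The loop of `take`: as many trees as there are symbols on `count` are removed from `main`. -/
def takeLoop (b c : Bool) : Cmd Alph :=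
  loop .count Option.isSome (cond .main isTrue
    (seq (pop .main) (seq (pushIf b .left true) (seq (pushIf c .right true) (push .count true))))
    (seq (pop .main) (seq (pushIf b .left false) (seq (pushIf c .right false) (pop .count)))))

/-- Removes one tree from `main`, and puts its reversed code on `left` if `b` and on `right`
if `c`. -/
def take (b c : Bool) : Cmd Alph := seq (push .count true) (takeLoop b c)

/-- The premise is a run of the same loop after the tree has been read; in this form the run over
the left subtree can simply be continued by the one over the right subtree. The stack `count` holds
the number of pending trees in unary: a node turns one pending tree into two, a leaf finishes one.
Each symbol costs six steps. -/
theorem exec_takeLoop (b c : Bool) (i : List Γ') (o : List Bool) (x : Tree₀) :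
    ∀ (a l r n : List Bool) (S : ∀ k, List (Alph k)) (m : ℕ),
      Exec (takeLoop b c)
        (store i o a (appendIf b x.code.reverse l) (appendIf c x.code.reverse r) n) S m →
      Exec (takeLoop b c) (store i o (x.code ++ a) l r (true :: n)) S (6 * x.size + m) := by
  induction x with
  | nil =>
    intro a l r n S m h
    refine exec_cast (Exec.loop_true (by simp) (Exec.cond_false (by simp [isTrue, Tree₀.code])
      (Exec.seq (exec_pop rfl) (Exec.seq (S' := store i o a (appendIf b [false] l) r (true :: n))
        ?_ (Exec.seq (exec_pushIf_right ..) (exec_pop rfl))))) ?_) rfl rfl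
        (m := 1 + (1 + (1 + 1)) + 1 + m + 1) (by simp [Tree₀.size]; omega)
    · simpa [Tree₀.code] using exec_pushIf_left b false i o a l r (true :: n)
    · change Exec (takeLoop b c) _ _ _
      simpa [Tree₀.code] using h
  | cons x y ihx ihy =>
    intro a l r n S m h
    refine exec_cast (Exec.loop_true (by simp) (Exec.cond_true (by simp [isTrue, Tree₀.code])
      (Exec.seq (exec_pop rfl) (Exec.seq
        (S' := store i o (x.code ++ (y.code ++ a)) (appendIf b [true] l) r (true :: n))
        ?_ (Exec.seq (exec_pushIf_right ..) (exec_push rfl))))) ?_) rfl rfl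
        (m := 1 + (1 + (1 + 1)) + 1 + (6 * x.size + (6 * y.size + m)) + 1)
        (by simp [Tree₀.size]; omega)
    · simpa [Tree₀.code] using
        exec_pushIf_left b true i o (x.code ++ (y.code ++ a)) l r (true :: n)
    · change Exec (takeLoop b c) _ _ _
      simp only [update_count, store_count]
      refine ihx _ _ _ _ _ _ (ihy _ _ _ _ _ _ ?_)
      simpa [appendIf_appendIf, Tree₀.code] using h

theorem exec_take (b c : Bool) (i : List Γ') (o : List Bool) (x : Tree₀) (a l r : List Bool) :
    Exec (take b c) (store i o (x.code ++ a) l r [])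
      (store i o a (appendIf b x.code.reverse l) (appendIf c x.code.reverse r) [])
      (6 * x.size + 2) := by
  refine exec_cast (Exec.seq (exec_push (S' := store i o (x.code ++ a) l r [true]) (by simp))
    (exec_takeLoop b c i o x _ _ _ _ _ 1 (Exec.loop_false (by simp)))) rfl rfl (by omega)

/-- Moves `left` symbol by symbol to `main`. -/
def dumpLeft : Cmd Alph := loop .left Option.isSome (cond .left isTrue
  (seq (pop .left) (push .main true)) (seq (pop .left) (push .main false)))

/-- Moves `right` symbol by symbol to `main`. -/
def dumpRight : Cmd Alph := loop .right Option.isSome (cond .right isTrue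
  (seq (pop .right) (push .main true)) (seq (pop .right) (push .main false)))

theorem exec_dumpLeft (i : List Γ') (o r n l : List Bool) : ∀ a,
    Exec dumpLeft (store i o a l r n) (store i o (l.reverse ++ a) [] r n) (4 * l.length + 1) := by
  induction l with
  | nil => exact fun a => Exec.loop_false (by simp)
  | cons s l ih =>
    intro a
    refine exec_cast (Exec.loop_true (m := 3) (by simp) ?_ (ih (s :: a))) rfl (by simp)
      (by simp; omega)
    cases s
    · exact Exec.cond_false (by simp [isTrue]) (Exec.seq (exec_pop rfl) (exec_push (by simp)))
    · exact Exec.cond_true (by simp [isTrue]) (Exec.seq (exec_pop rfl) (exec_push (by simp)))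

theorem exec_dumpRight (i : List Γ') (o l n r : List Bool) : ∀ a,
    Exec dumpRight (store i o a l r n) (store i o (r.reverse ++ a) l [] n) (4 * r.length + 1) := by
  induction r with
  | nil => exact fun a => Exec.loop_false (by simp)
  | cons s l ih =>
    intro a
    refine exec_cast (Exec.loop_true (m := 3) (by simp) ?_ (ih (s :: a))) rfl (by simp)
      (by simp; omega)
    cases s
    · exact Exec.cond_false (by simp [isTrue]) (Exec.seq (exec_pop rfl) (exec_push (by simp)))
    · exact Exec.cond_true (by simp [isTrue]) (Exec.seq (exec_pop rfl) (exec_push (by simp)))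

/-- `P` transforms the contents `u` of `main` into `v` in at most `n` steps. -/
def Op (P : Cmd Alph) (u v : List Bool) (n : ℕ) : Prop :=
  ∀ i o, ∃ m ≤ n, Exec P (store i o u [] [] []) (store i o v [] [] []) m

namespace Op

variable {P Q : Cmd Alph} {u v w : List Bool} {m n : ℕ}

theorem mono (h : Op P u v m) (hmn : m ≤ n) : Op P u v n := fun i o =>
  let ⟨k, hk, h⟩ := h i o; ⟨k, hk.trans hmn, h⟩

theorem seq (h : Op P u v m) (h' : Op Q v w n) : Op (seq P Q) u w (m + n) := fun i o =>
  let ⟨_, hk, h⟩ := h i o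
  let ⟨_, hk', h'⟩ := h' i o
  ⟨_, Nat.add_le_add hk hk', h.seq h'⟩

theorem skip : Op skip u u 1 := fun _ _ => ⟨1, le_rfl, Exec.skip _⟩

theorem push (a : Bool) : Op (push .main a) u (a :: u) 1 := fun _ _ =>
  ⟨1, le_rfl, exec_push (by simp)⟩

theorem pop : Op (pop .main) u u.tail 1 := fun _ _ => ⟨1, le_rfl, exec_pop (by simp)⟩

theorem cond_true (h : Op P (true :: u) v n) : Op (cond .main isTrue P Q) (true :: u) v (n + 1) :=
  fun i o => let ⟨k, hk, h⟩ := h i o; ⟨k + 1, by omega, Exec.cond_true rfl h⟩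

theorem cond_false (h : Op Q (false :: u) v n) :
    Op (cond .main isTrue P Q) (false :: u) v (n + 1) :=
  fun i o => let ⟨k, hk, h⟩ := h i o; ⟨k + 1, by omega, Exec.cond_false rfl h⟩

theorem loop_true (h : Op P (true :: u) v m) (h' : Op (loop .main isTrue P) v w n) :
    Op (loop .main isTrue P) (true :: u) w (m + n + 1) := fun i o =>
  let ⟨_, hk, h⟩ := h i o
  let ⟨_, hk', h'⟩ := h' i o
  ⟨_, by omega, Exec.loop_true rfl h h'⟩

theorem loop_false : Op (loop .main isTrue P) (false :: u) (false :: u) 1 :=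
  fun _ _ => ⟨1, le_rfl, Exec.loop_false rfl⟩

/-- Removes a tree. -/
theorem drop (x : Tree₀) : Op (take false false) (x.code ++ u) u (6 * x.size + 2) := fun i o =>
  ⟨_, le_rfl, exec_take false false i o x u [] []⟩

/-- Duplicates a tree. -/
theorem dup (x : Tree₀) :
    Op (.seq (take true true) (.seq dumpLeft dumpRight)) (x.code ++ u) (x.code ++ (x.code ++ u))
      (14 * x.size + 4) := fun i o => by
  refine ⟨_, le_rfl, exec_cast (Exec.seq (exec_take true true i o x u [] [])
    (Exec.seq (exec_dumpLeft ..) (exec_dumpRight ..))) rfl ?_ ?_⟩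
  · simp [appendIf]
  · simp [appendIf, x.length_code]; omega

/-- Exchanges two trees. -/
theorem swap (x y : Tree₀) :
    Op (.seq (take true false) (.seq (take false true) (.seq dumpLeft dumpRight)))
      (x.code ++ (y.code ++ u)) (y.code ++ (x.code ++ u))
      (10 * x.size + 10 * y.size + 6) := fun i o => by
  refine ⟨_, le_rfl, exec_cast (Exec.seq (exec_take true false i o x (y.code ++ u) [] [])
    (Exec.seq (exec_take false true i o y u _ _)
    (Exec.seq (exec_dumpLeft ..) (exec_dumpRight ..)))) rfl ?_ ?_⟩
  · simp [appendIf]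
  · simp [appendIf, x.length_code, y.length_code]; omega

end Op

/-- `P` replaces the tree `x` on the top of `main` by `y` in at most `n` steps. -/
def Run (P : Cmd Alph) (x y : Tree₀) (n : ℕ) : Prop :=
  ∀ u, Op P (x.code ++ u) (y.code ++ u) n

/-- The program duplicating a tree. -/
def dupCmd : Cmd Alph := seq (take true true) (seq dumpLeft dumpRight)

/-- The program exchanging two trees. -/
def swapCmd : Cmd Alph :=
  seq (take true false) (seq (take false true) (seq dumpLeft dumpRight))

/-- The program removing a tree. -/
def dropCmd : Cmd Alph := take false false

/-- The program for a pair of functions. -/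
def pairCmd (P Q : Cmd Alph) : Cmd Alph :=
  seq dupCmd (seq Q (seq swapCmd (seq P (push .main true))))

/-- The program for the constant function `nil`. -/
def nilCmd : Cmd Alph := seq dropCmd (push .main false)

/-- The program for the left subtree. -/
def fstCmd : Cmd Alph := cond .main isTrue (seq (pop .main) (seq swapCmd dropCmd)) skip

/-- The program for the right subtree. -/
def sndCmd : Cmd Alph := cond .main isTrue (seq (pop .main) dropCmd) skip

/-- The program for a function defined by cases. -/
def iteCmd (P Q R : Cmd Alph) : Cmd Alph :=
  seq dupCmd (seq P (cond .main isTrue (seq dropCmd Q) (seq dropCmd R)))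

/-- The program iterating `Q` as long as `P` yields a nonempty tree. -/
def whileCmd (P Q : Cmd Alph) : Cmd Alph :=
  seq (seq dupCmd P) (seq (loop .main isTrue (seq dropCmd (seq Q (seq dupCmd P)))) (pop .main))

namespace Run

variable {P Q R : Cmd Alph} {x y z d : Tree₀} {m n k : ℕ}

theorem mono (h : Run P x y m) (hmn : m ≤ n) : Run P x y n := fun u => (h u).mono hmn

theorem id : Run skip x x 1 := fun _ => Op.skip

theorem comp (h : Run P x y m) (h' : Run Q y z n) : Run (seq P Q) x z (m + n) :=
  fun u => (h u).seq (h' u)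

/-- Prefix code puts `y` above `z`, so `z` is computed first, on a copy of `x`. A swap brings `x`
back to the top, where it becomes `y`, and a final `true` joins the two codes to that of a node. -/
theorem pair (h : Run P x y m) (h' : Run Q x z n) :
    Run (pairCmd P Q) x (.cons y z) (m + n + 24 * x.size + 10 * z.size + 11) := fun u => by
  have := (Op.dup (u := u) x).seq ((h' _).seq ((Op.swap z x).seq ((h _).seq (Op.push true))))
  simp only [Tree₀.code, List.cons_append, List.append_assoc]
  exact this.mono (by omega)

theorem nil : Run nilCmd x .nil (6 * x.size + 3) := fun _ => (Op.drop x).seq (Op.push false)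

/-- Popping the leading `true` of a node leaves the codes of its two subtrees on the stack, as
separate trees. -/
theorem fst : Run fstCmd x x.fst (16 * x.size + 10) := fun u => by
  cases x with
  | nil => exact (Op.cond_false Op.skip).mono (by omega)
  | cons a b =>
    have := Op.cond_true (Q := skip) ((Op.pop (u := true :: (a.code ++ (b.code ++ u)))).seq
      ((Op.swap a b).seq (Op.drop b)))
    simp only [Tree₀.code, List.cons_append, List.append_assoc]
    exact this.mono (by simp only [Tree₀.size]; omega)

theorem snd : Run sndCmd x x.snd (16 * x.size + 10) := fun u => by
  cases x with
  | nil => exact (Op.cond_false Op.skip).mono (by omega)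
  | cons a b =>
    have := Op.cond_true (Q := skip) ((Op.pop (u := true :: (a.code ++ (b.code ++ u)))).seq
      (Op.drop a))
    simp only [Tree₀.code, List.cons_append, List.append_assoc]
    exact this.mono (by simp only [Tree₀.size]; omega)

theorem ite_true (h : Run P x d m) (hd : d ≠ .nil) (h' : Run Q x y n) :
    Run (iteCmd P Q R) x y (14 * x.size + m + 6 * d.size + n + 7) := fun u => by
  cases d with
  | nil => exact absurd rfl hd
  | cons a b =>
    refine ((Op.dup x).seq ((h _).seq (Op.cond_true (v := y.code ++ u) (n := 6 *
      (Tree₀.cons a b).size + 2 + n) ?_))).mono (by omega)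
    exact (Op.drop (Tree₀.cons a b)).seq (h' u)

theorem ite_false (h : Run P x .nil m) (h' : Run R x y n) :
    Run (iteCmd P Q R) x y (14 * x.size + m + n + 13) := fun u => by
  refine ((Op.dup x).seq ((h _).seq (Op.cond_false (v := y.code ++ u) (n := 6 *
    Tree₀.nil.size + 2 + n) ?_))).mono (by simp only [Tree₀.size]; omega)
  exact (Op.drop Tree₀.nil).seq (h' u)

/-- The sequences `x` and `d` list the data and the test values, and the current test value lies
above the current data. A round removes the test value (`6 * s + 2`), runs the body (`t`), copies
the data (`14 * s + 4`), tests again (`t`) and inspects the top symbol (`1`), which gives `20 * s +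
2 * t + 7`. -/
theorem loop_aux (s t N : ℕ) : ∀ (x d : ℕ → Tree₀), (∀ i ≤ N, Run P (x i) (d i) t) →
    (∀ i < N, d i ≠ .nil) → d N = .nil → (∀ i < N, Run Q (x i) (x (i + 1)) t) →
    (∀ i ≤ N, (x i).size ≤ s) → (∀ i ≤ N, (d i).size ≤ s) → ∀ u,
    Op (loop .main isTrue (seq dropCmd (seq Q (seq dupCmd P))))
      ((d 0).code ++ ((x 0).code ++ u)) (false :: ((x N).code ++ u))
      (N * (20 * s + 2 * t + 7) + 1) := by
  induction N with
  | zero =>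
    intro x d _ _ hd _ _ _ u
    rw [hd]
    exact Op.loop_false.mono (by omega)
  | succ N ih =>
    intro x d hP hne hd hQ hx hds u
    have h := ih (fun i => x (i + 1)) (fun i => d (i + 1)) (fun i hi => hP _ (by omega))
      (fun i hi => hne _ (by omega)) hd (fun i hi => hQ _ (by omega))
      (fun i hi => hx _ (by omega)) (fun i hi => hds _ (by omega)) u
    have h0 := hne 0 (by omega)
    have s0 := hds 0 (by omega)
    have s1 := hx 1 (by omega)
    have hdrop := Op.drop (u := (x 0).code ++ u) (d 0)
    have hseq := hdrop.seq ((hQ 0 (by omega) u).seq ((Op.dup (x 1)).seq (hP 1 (by omega) _)))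
    generalize hd0 : d 0 = d₀ at *
    cases d₀ with
    | nil => exact absurd rfl h0
    | cons a b =>
      have := Op.loop_true hseq h
      exact this.mono (by rw [Nat.add_mul N 1]; omega)

theorem loopWhile (s t N : ℕ) (x d : ℕ → Tree₀) (hP : ∀ i ≤ N, Run P (x i) (d i) t)
    (hne : ∀ i < N, d i ≠ .nil) (hd : d N = .nil) (hQ : ∀ i < N, Run Q (x i) (x (i + 1)) t)
    (hx : ∀ i ≤ N, (x i).size ≤ s) (hds : ∀ i ≤ N, (d i).size ≤ s) :
    Run (whileCmd P Q) (x 0) (x N) ((N + 1) * (20 * s + 2 * t + 7)) := fun u => by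
  have := ((Op.dup (u := u) (x 0)).seq (hP 0 (Nat.zero_le _) _)).seq
    ((Run.loop_aux s t N x d hP hne hd hQ hx hds u).seq Op.pop)
  have h0 := hx 0 (Nat.zero_le _)
  exact this.mono (by rw [Nat.add_mul N 1]; omega)

end Run

end TreeProgram

/-! ### Functions computed within a given bound -/

namespace TreeProgram

open StackProgram

/-- Types whose elements are encoded by trees. -/
class Enc (α : Type) where
  enc : α → Tree₀

open Enc

/-- The size of the encoding. -/
def sz {α : Type} [Enc α] (a : α) : ℕ := (enc a).size

instance : Enc Tree₀ := ⟨id⟩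
instance : Enc Unit := ⟨fun _ => .nil⟩
instance : Enc Bool := ⟨fun b => bif b then .cons .nil .nil else .nil⟩
instance {α β : Type} [Enc α] [Enc β] : Enc (α × β) := ⟨fun p => .cons (enc p.1) (enc p.2)⟩
instance {α : Type} [Enc α] : Enc (List α) := ⟨fun l => l.foldr (fun a x => .cons (enc a) x) .nil⟩
-- Unary, so the size is linear in the value. Numbers that may be exponentially large in the input
-- length are kept as lists of bits instead.
instance : Enc ℕ := ⟨fun n => enc (List.replicate n ())⟩

/-- The kind of a symbol, and its value if it is a bit. -/
def symbolData : Γ' → ℕ × Bool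
  | .bit b => (0, b)
  | .comma => (1, false)
  | .ket => (2, false)
  | _ => (3, false)

instance : Enc Γ' := ⟨fun a => enc (symbolData a)⟩

/-! ### Sizes of encodings -/

section Size

variable {α β : Type} [Enc α] [Enc β]

theorem sz_pos (a : α) : 0 < sz a := Tree₀.size_pos _

theorem sz_pair (a : α) (b : β) : sz (a, b) = sz a + sz b + 1 := rfl

theorem sz_nil : sz ([] : List α) = 1 := rfl

theorem sz_cons (a : α) (l : List α) : sz (a :: l) = sz a + sz l + 1 := rfl

theorem sz_bool_le (b : Bool) : sz b ≤ 3 := by cases b <;> decide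

theorem sz_nat (n : ℕ) : sz n = 2 * n + 1 := by
  change sz (List.replicate n ()) = _
  induction n with
  | zero => rfl
  | succ n ih =>
    rw [List.replicate_succ, sz_cons, ih]
    have : sz () = 1 := rfl
    omega

theorem sz_append (l l' : List α) : sz (l ++ l') + 1 = sz l + sz l' := by
  induction l with
  | nil => rw [List.nil_append, sz_nil]; omega
  | cons a l ih => rw [List.cons_append, sz_cons, sz_cons]; omega

theorem sz_reverse (l : List α) : sz l.reverse = sz l := by
  induction l with
  | nil => rfl
  | cons a l ih =>
    have := sz_append l.reverse [a]
    rw [List.reverse_cons, sz_cons]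
    rw [sz_cons, sz_nil] at this
    omega

theorem length_lt_sz (l : List α) : l.length < sz l := by
  induction l with
  | nil => simp [sz_nil]
  | cons a l ih => rw [sz_cons, List.length_cons]; have := sz_pos a; omega

theorem sz_lt_of_mem {a : α} {l : List α} (h : a ∈ l) : sz a < sz l := by
  induction l with
  | nil => simp at h
  | cons b l ih =>
    rw [sz_cons]
    rcases List.mem_cons.1 h with rfl | h
    · omega
    · have := ih h; omega

theorem sz_list_le {l : List α} {M : ℕ} (h : ∀ a ∈ l, sz a ≤ M) :
    sz l ≤ l.length * (M + 1) + 1 := by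
  induction l with
  | nil => simp [sz_nil]
  | cons a l ih =>
    have h1 := ih fun b hb => h b (List.mem_cons_of_mem _ hb)
    have h2 := h a List.mem_cons_self
    rw [sz_cons, List.length_cons, Nat.succ_mul]
    omega

theorem sz_sublist_le {l l' : List α} (h : l.Sublist l') : sz l ≤ sz l' := by
  induction h with
  | slnil => exact le_rfl
  | cons a _ ih => rw [sz_cons]; omega
  | cons_cons a _ ih => rw [sz_cons, sz_cons]; omega

end Size

/-! ### Polynomial bounds and running times -/

/-- On the set `s`, the function `T` is bounded by a polynomial in `B`. -/
def PolyBdd {α : Type} (s : α → Prop) (B T : α → ℕ) : Prop :=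
  ∃ c, ∀ x, s x → T x ≤ (B x + 2) ^ c

namespace PolyBdd

variable {α β : Type} {s : α → Prop} {B B' T T' : α → ℕ}

theorem self : PolyBdd s B B := ⟨1, fun x _ => by rw [pow_one]; omega⟩

theorem mono (h : PolyBdd s B T) (h' : ∀ x, s x → T' x ≤ T x) : PolyBdd s B T' :=
  let ⟨c, hc⟩ := h
  ⟨c, fun x hx => (h' x hx).trans (hc x hx)⟩

theorem of_le (h : ∀ x, s x → T x ≤ B x) : PolyBdd s B T := self.mono h

theorem const (k : ℕ) : PolyBdd s B fun _ => k :=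
  ⟨k, fun x _ => (Nat.lt_two_pow_self).le.trans (Nat.pow_le_pow_left (by omega) k)⟩

/-- Twice the larger power is absorbed by one more factor, because the base `B x + 2` is at least
`2`. -/
theorem add (h : PolyBdd s B T) (h' : PolyBdd s B T') : PolyBdd s B fun x => T x + T' x := by
  obtain ⟨c, hc⟩ := h
  obtain ⟨d, hd⟩ := h'
  refine ⟨max c d + 1, fun x hx => ?_⟩
  have h1 := (hc x hx).trans (Nat.pow_le_pow_right (by omega) (le_max_left c d))
  have h2 := (hd x hx).trans (Nat.pow_le_pow_right (by omega) (le_max_right c d))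
  calc T x + T' x ≤ (B x + 2) ^ max c d * 2 := by omega
    _ ≤ (B x + 2) ^ max c d * (B x + 2) := Nat.mul_le_mul_left _ (by omega)
    _ = _ := (pow_succ _ _).symm

theorem mul (h : PolyBdd s B T) (h' : PolyBdd s B T') : PolyBdd s B fun x => T x * T' x := by
  obtain ⟨c, hc⟩ := h
  obtain ⟨d, hd⟩ := h'
  exact ⟨c + d, fun x hx => pow_add (B x + 2) c d ▸ Nat.mul_le_mul (hc x hx) (hd x hx)⟩

theorem pow (h : PolyBdd s B T) (k : ℕ) : PolyBdd s B fun x => T x ^ k := by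
  obtain ⟨c, hc⟩ := h
  exact ⟨c * k, fun x hx => pow_mul (B x + 2) c k ▸ Nat.pow_le_pow_left (hc x hx) k⟩

theorem trans {s' : α → Prop} (h : PolyBdd s B B') (h' : PolyBdd s' B' T)
    (hs : ∀ x, s x → s' x) : PolyBdd s B T := by
  obtain ⟨c, hc⟩ := h'
  exact ((h.add (const 2)).pow c).mono fun x hx => hc x (hs x hx)

theorem comp {t : β → Prop} {C U : β → ℕ} (h : PolyBdd t C U) {f : α → β}
    (hst : ∀ x, s x → t (f x)) (hB : PolyBdd s B fun x => C (f x)) :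
    PolyBdd s B fun x => U (f x) := by
  obtain ⟨c, hc⟩ := h
  exact hB.trans (s' := s) ⟨c, fun x hx => hc _ (hst x hx)⟩ fun _ => id

theorem restrict {s' : α → Prop} (h : PolyBdd s B T) (hs : ∀ x, s' x → s x) : PolyBdd s' B T :=
  let ⟨c, hc⟩ := h
  ⟨c, fun x hx => hc x (hs x hx)⟩

end PolyBdd

/-- On the set `s`, the function `f` is computed by a program in time polynomial in `B`. -/
structure PTime {α β : Type} [Enc α] [Enc β] (s : α → Prop) (B : α → ℕ) (f : α → β) : Prop where
  -- The sizes belong to the notion because copying an argument or moving a value takes time linear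
  -- in its size, while `B` may be any function.
  size_in : PolyBdd s B fun x => sz x
  size_out : PolyBdd s B fun x => sz (f x)
  run : ∃ P T, PolyBdd s B T ∧ ∀ x, s x → Run P (enc x) (enc (f x)) (T x)

/-- The function `f` is computed by a program in polynomial time. -/
abbrev PolyTime {α β : Type} [Enc α] [Enc β] (f : α → β) : Prop :=
  PTime (fun _ => True) (fun x => sz x) f

/-! ### Composition, pairs, constants, cases and loops -/

section Basic

variable {α β γ δ : Type} [Enc α] [Enc β] [Enc γ] [Enc δ] {s : α → Prop} {B : α → ℕ}

theorem PTime.of_enc {f : α → β} (h : PolyBdd s B fun x => sz x)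
    (hf : ∀ x, s x → enc (f x) = enc x) : PTime s B f where
  size_in := h
  size_out := h.mono fun x hx => by simp only [sz, hf x hx]; exact le_rfl
  run := ⟨_, _, PolyBdd.const 1, fun x hx => by rw [hf x hx]; exact Run.id⟩

theorem PTime.id (h : PolyBdd s B fun x => sz x) : PTime s B fun x => x :=
  .of_enc h fun _ _ => rfl

theorem PolyTime.id : PolyTime fun x : α => x := PTime.id .self

theorem PTime.congr {f g : α → β} (h : PTime s B f) (hfg : ∀ x, s x → g x = f x) :
    PTime s B g where
  size_in := h.size_in
  size_out := h.size_out.mono fun x hx => by rw [hfg x hx]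
  run := by
    obtain ⟨P, T, hT, h⟩ := h.run
    exact ⟨P, T, hT, fun x hx => hfg x hx ▸ h x hx⟩

theorem PTime.restrict {s' : α → Prop} {f : α → β} (h : PTime s B f) (hs : ∀ x, s' x → s x) :
    PTime s' B f where
  size_in := h.size_in.restrict hs
  size_out := h.size_out.restrict hs
  run := by
    obtain ⟨P, T, hT, h⟩ := h.run
    exact ⟨P, T, hT.restrict hs, fun x hx => h x (hs x hx)⟩

theorem PTime.mono {B' : α → ℕ} {f : α → β} (h : PTime s B f) (hB : PolyBdd s B' B) :
    PTime s B' f where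
  size_in := hB.trans h.size_in fun _ => _root_.id
  size_out := hB.trans h.size_out fun _ => _root_.id
  run := by
    obtain ⟨P, T, hT, h⟩ := h.run
    exact ⟨P, T, hB.trans hT fun _ => _root_.id, h⟩

theorem PTime.comp {t : β → Prop} {C : β → ℕ} {g : β → γ} {f : α → β} (hg : PTime t C g)
    (hf : PTime s B f) (hst : ∀ x, s x → t (f x)) (hB : PolyBdd s B fun x => C (f x)) :
    PTime s B fun x => g (f x) where
  size_in := hf.size_in
  size_out := hg.size_out.comp hst hB
  run := by
    obtain ⟨P, T, hT, hP⟩ := hf.run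
    obtain ⟨Q, U, hU, hQ⟩ := hg.run
    exact ⟨_, _, hT.add (hU.comp hst hB), fun x hx => (hP x hx).comp (hQ _ (hst x hx))⟩

theorem PolyTime.comp {g : β → γ} {f : α → β} (hg : PolyTime g) (hf : PTime s B f) :
    PTime s B fun x => g (f x) :=
  PTime.comp hg hf (fun _ _ => trivial) hf.size_out

theorem PTime.pair {f : α → β} {g : α → γ} (hf : PTime s B f) (hg : PTime s B g) :
    PTime s B fun x => (f x, g x) where
  size_in := hf.size_in
  size_out := ((hf.size_out.add hg.size_out).add (.const 1)).mono fun _ _ => le_rfl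
  run := by
    obtain ⟨P, T, hT, hP⟩ := hf.run
    obtain ⟨Q, U, hU, hQ⟩ := hg.run
    exact ⟨_, _, (((hT.add hU).add ((PolyBdd.const 24).mul hf.size_in)).add
      ((PolyBdd.const 10).mul hg.size_out)).add (.const 11),
      fun x hx => (hP x hx).pair (hQ x hx)⟩

theorem PolyTime.comp₂ {h : β → γ → δ} {f : α → β} {g : α → γ}
    (hh : PolyTime fun p : β × γ => h p.1 p.2) (hf : PTime s B f) (hg : PTime s B g) :
    PTime s B fun x => h (f x) (g x) :=
  PolyTime.comp hh (hf.pair hg)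

theorem PTime.fst {f : α → β × γ} (hf : PTime s B f) : PTime s B fun x => (f x).1 where
  size_in := hf.size_in
  size_out := hf.size_out.mono fun x _ => Tree₀.size_fst_le (enc (f x))
  run := by
    obtain ⟨P, T, hT, hP⟩ := hf.run
    exact ⟨_, _, hT.add (((PolyBdd.const 16).mul hf.size_out).add (.const 10)),
      fun x hx => (hP x hx).comp Run.fst⟩

theorem PTime.snd {f : α → β × γ} (hf : PTime s B f) : PTime s B fun x => (f x).2 where
  size_in := hf.size_in
  size_out := hf.size_out.mono fun x _ => Tree₀.size_snd_le (enc (f x))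
  run := by
    obtain ⟨P, T, hT, hP⟩ := hf.run
    exact ⟨_, _, hT.add (((PolyBdd.const 16).mul hf.size_out).add (.const 10)),
      fun x hx => (hP x hx).comp Run.snd⟩

theorem PTime.proj₁ : PolyTime fun p : α × β => p.1 := PTime.fst PolyTime.id

theorem PTime.proj₂ : PolyTime fun p : α × β => p.2 := PTime.snd PolyTime.id

theorem PTime.proj₂₁ : PolyTime fun p : α × β × γ => p.2.1 := PTime.fst .proj₂

theorem PTime.proj₂₂ : PolyTime fun p : α × β × γ => p.2.2 := PTime.snd .proj₂

theorem PTime.const_nil (h : PolyBdd s B fun x => sz x) {b : β} (hb : enc b = .nil) :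
    PTime s B fun _ : α => b where
  size_in := h
  size_out := .const _
  run := ⟨_, _, ((PolyBdd.const 6).mul h).add (.const 3), fun _ _ => hb ▸ Run.nil⟩

theorem PTime.const_tree (h : PolyBdd s B fun x => sz x) (t : Tree₀) :
    PTime s B fun _ : α => t := by
  induction t with
  | nil => exact .const_nil h rfl
  | cons a b iha ihb =>
    obtain ⟨h1, h2, h3⟩ := iha.pair ihb
    -- `PTime` sees encodings only, and a pair of trees has the same encoding as the node built from
    -- them, so the three fields carry over by unfolding. The same device serves below for lists,
    -- unary numbers and symbols.
    exact ⟨h1, h2, h3⟩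

theorem PTime.const (h : PolyBdd s B fun x => sz x) (b : β) : PTime s B fun _ : α => b := by
  obtain ⟨h1, h2, h3⟩ := PTime.const_tree h (enc b)
  exact ⟨h1, h2, h3⟩

theorem PolyTime.const (b : β) : PolyTime fun _ : α => b := PTime.const .self b

theorem enc_bool_ne_nil {b : Bool} (hb : b = true) : enc b ≠ .nil := by
  subst hb; exact fun h => by cases h

/-- Each branch has to be fast only where it is taken. This is what allows a cheap test to guard an
expensive branch, as in `PTime.decideSat`. -/
theorem PTime.cond {c : α → Bool} {f g : α → β} (hc : PTime s B c)
    (hf : PTime (fun x => s x ∧ c x = true) B f) (hg : PTime (fun x => s x ∧ c x = false) B g) :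
    PTime s B fun x => bif c x then f x else g x := by
  have split : ∀ {T U : α → ℕ}, PolyBdd (fun x => s x ∧ c x = true) B T →
      PolyBdd (fun x => s x ∧ c x = false) B U →
      PolyBdd s B fun x => bif c x then T x else U x := by
    rintro T U ⟨k, hk⟩ ⟨l, hl⟩
    refine ⟨max k l, fun x hx => ?_⟩
    cases h : c x <;> simp only [h, cond_true, cond_false]
    · exact (hl x ⟨hx, h⟩).trans (Nat.pow_le_pow_right (by omega) (le_max_right k l))
    · exact (hk x ⟨hx, h⟩).trans (Nat.pow_le_pow_right (by omega) (le_max_left k l))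
  refine ⟨hc.size_in, (split hf.size_out hg.size_out).mono fun x _ => by
    cases c x <;> exact le_rfl, ?_⟩
  obtain ⟨P, T, hT, hP⟩ := hc.run
  obtain ⟨Q, U, hU, hQ⟩ := hf.run
  obtain ⟨R, V, hV, hR⟩ := hg.run
  -- The test value has size at most `3`, and `25 = 6 * 3 + 7` covers both branches of `iteCmd`.
  refine ⟨iteCmd P Q R, _, ((((PolyBdd.const 14).mul hc.size_in).add hT).add
    (split hU hV)).add (.const 25), fun x hx => ?_⟩
  cases h : c x
  · have := hP x hx
    rw [h] at this
    exact (Run.ite_false this (hR x ⟨hx, h⟩)).mono (by simp only [cond_false, sz]; omega)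
  · have := hP x hx
    have hs : (enc (c x)).size ≤ 3 := sz_bool_le _
    exact (Run.ite_true this (enc_bool_ne_nil h) (hQ x ⟨hx, h⟩)).mono
      (by simp only [cond_true, sz]; omega)

theorem PTime.cond' {c : α → Bool} {f g : α → β} (hc : PTime s B c) (hf : PTime s B f)
    (hg : PTime s B g) : PTime s B fun x => bif c x then f x else g x :=
  .cond hc (hf.restrict fun _ h => h.1) (hg.restrict fun _ h => h.1)

theorem PTime.not {c : α → Bool} (hc : PTime s B c) : PTime s B fun x => !c x :=
  (hc.cond' (.const hc.size_in false) (.const hc.size_in true)).congr fun x _ => by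
    cases c x <;> rfl

theorem PTime.and {c d : α → Bool} (hc : PTime s B c) (hd : PTime s B d) :
    PTime s B fun x => c x && d x :=
  (hc.cond' hd (.const hc.size_in false)).congr fun x _ => by cases c x <;> rfl

theorem PTime.or {c d : α → Bool} (hc : PTime s B c) (hd : PTime s B d) :
    PTime s B fun x => c x || d x :=
  (hc.cond' (.const hc.size_in true) hd).congr fun x _ => by cases c x <;> rfl

/-- Iteration as long as a test succeeds. -/
theorem PTime.loopWhile {t : γ → Prop} {C : γ → ℕ} {test : γ → Bool} {body : γ → γ}
    {init : α → γ} (htest : PolyTime test) (hbody : PTime t C body) (hinit : PTime s B init)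
    (N T : α → ℕ) (hN : PolyBdd s B N) (hT : PolyBdd s B T)
    (htrue : ∀ x, s x → ∀ i < N x, test (body^[i] (init x)) = true)
    (hfalse : ∀ x, s x → test (body^[N x] (init x)) = false)
    (hbd : ∀ x, s x → ∀ i < N x, t (body^[i] (init x)) ∧ C (body^[i] (init x)) ≤ T x) :
    PTime s B fun x => body^[N x] (init x) := by
  obtain ⟨c, hc⟩ := hbody.size_out
  -- Polynomial bounds do not pile up over the rounds: `hbd` bounds the cost of every iterate
  -- directly by `T x`, so the output of each round has size at most `(T x + 2) ^ c` with one fixed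
  -- exponent.
  set U : α → ℕ := fun x => sz (init x) + (T x + 2) ^ c with hU
  have hUB : PolyBdd s B U := hinit.size_out.add ((hT.add (.const 2)).pow c)
  have hsize : ∀ x, s x → ∀ i ≤ N x, sz (body^[i] (init x)) ≤ U x := by
    intro x hx i hi
    cases i with
    | zero => exact Nat.le_add_right _ _
    | succ i =>
      rw [Function.iterate_succ_apply']
      have := hbd x hx i hi
      exact ((hc _ this.1).trans (Nat.pow_le_pow_left (by omega) c)).trans (Nat.le_add_left _ _)
  refine ⟨hinit.size_in, hUB.mono fun x hx => hsize x hx _ le_rfl, ?_⟩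
  obtain ⟨P, V, ⟨d, hd⟩, hP⟩ := htest.run
  obtain ⟨Q, W, ⟨e, he⟩, hQ⟩ := hbody.run
  obtain ⟨R, X, hX, hR⟩ := hinit.run
  refine ⟨_, fun x => X x + (N x + 1) * (20 * (U x + 3) + 2 * ((U x + 2) ^ d + (T x + 2) ^ e) + 7),
    hX.add ((hN.add (.const 1)).mul ((((PolyBdd.const 20).mul (hUB.add (.const 3))).add
      ((PolyBdd.const 2).mul (((hUB.add (.const 2)).pow d).add
      ((hT.add (.const 2)).pow e)))).add (.const 7))),
    fun x hx => (hR x hx).comp (Run.loopWhile (P := P) (Q := Q) _ _ (N x)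
      (fun i => enc (body^[i] (init x))) (fun i => enc (test (body^[i] (init x))))
      ?_ ?_ ?_ ?_ ?_ ?_)⟩
  · exact fun i hi => (hP _ trivial).mono (((hd _ trivial).trans
      (Nat.pow_le_pow_left (Nat.add_le_add_right (hsize x hx i hi) 2) d)).trans
      (Nat.le_add_right _ _))
  · exact fun i hi => enc_bool_ne_nil (htrue x hx i hi)
  · rw [hfalse x hx]; rfl
  · intro i hi
    rw [Function.iterate_succ_apply']
    have := hbd x hx i hi
    exact (hQ _ this.1).mono (((he _ this.1).trans
      (Nat.pow_le_pow_left (by omega) e)).trans (Nat.le_add_left _ _))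
  · exact fun i hi => (hsize x hx i hi).trans (Nat.le_add_right _ _)
  · exact fun i hi => (sz_bool_le _).trans (Nat.le_add_left _ _)

end Basic

end TreeProgram

namespace TreeProgram

open StackProgram Enc

/-! ### Lists and folds -/

section Folds

variable {α β γ δ : Type} [Enc α] [Enc β] [Enc γ] [Enc δ] {s : α → Prop} {B : α → ℕ}

theorem PTime.test {f : α → β} {c : α → Bool} (hf : PTime s B f)
    (hc : ∀ x, s x → (c x = false ↔ enc (f x) = .nil)) : PTime s B c := by
  refine ⟨hf.size_in, (PolyBdd.const 3).mono fun x _ => sz_bool_le _, ?_⟩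
  obtain ⟨P, T, hT, hP⟩ := hf.run
  obtain ⟨Q, U, hU, hQ⟩ := (PTime.const hf.size_in true).run
  obtain ⟨R, V, hV, hR⟩ := (PTime.const hf.size_in false).run
  refine ⟨iteCmd P Q R, _, (((((PolyBdd.const 14).mul hf.size_in).add hT).add
    ((PolyBdd.const 6).mul hf.size_out)).add (hU.add hV)).add (.const 13), fun x hx => ?_⟩
  have h := hP x hx
  cases hcx : c x
  · rw [(hc x hx).1 hcx] at h
    exact (Run.ite_false h (hR x hx)).mono (by simp only [sz]; omega)
  · have hne : enc (f x) ≠ .nil := fun h => by simp [(hc x hx).2 h] at hcx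
    exact (Run.ite_true h hne (hQ x hx)).mono (by simp only [sz]; omega)

theorem PTime.cons {f : α → β} {l : α → List β} (hf : PTime s B f) (hl : PTime s B l) :
    PTime s B fun x => f x :: l x := by
  obtain ⟨h1, h2, h3⟩ := hf.pair hl
  exact ⟨h1, h2, h3⟩

theorem PTime.isEmpty {l : α → List β} (hl : PTime s B l) : PTime s B fun x => (l x).isEmpty := by
  refine (PTime.not (c := fun x => !(l x).isEmpty) (hl.test fun x _ => ?_)).congr
    fun x _ => by simp
  cases l x
  · simp [enc]
  · simp [enc]

theorem PTime.tail {l : α → List β} (hl : PTime s B l) : PTime s B fun x => (l x).tail := by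
  have key : ∀ l : List β, enc l.tail = (enc l).snd := fun l => by cases l <;> rfl
  refine ⟨hl.size_in, hl.size_out.mono fun x _ => ?_, ?_⟩
  · simp only [sz, key]; exact Tree₀.size_snd_le _
  · obtain ⟨P, T, hT, hP⟩ := hl.run
    refine ⟨P.seq sndCmd, _, hT.add (((PolyBdd.const 16).mul hl.size_out).add (.const 10)),
      fun x hx => ?_⟩
    rw [key]
    exact (hP x hx).comp Run.snd

theorem PTime.headI [Inhabited β] {l : α → List β} (hl : PTime s B l) :
    PTime s B fun x => (l x).headI := by
  have h : PTime (fun x => s x ∧ (l x).isEmpty = false) B fun x => (l x).headI := by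
    have key : ∀ l : List β, l.isEmpty = false → enc l.headI = (enc l).fst := fun l h => by
      cases l
      · simp at h
      · rfl
    have hl := hl.restrict (s' := fun x => s x ∧ (l x).isEmpty = false) fun _ h => h.1
    refine ⟨hl.size_in, hl.size_out.mono fun x hx => ?_, ?_⟩
    · simp only [sz, key _ hx.2]; exact Tree₀.size_fst_le _
    · obtain ⟨P, T, hT, hP⟩ := hl.run
      refine ⟨P.seq fstCmd, _, hT.add (((PolyBdd.const 16).mul hl.size_out).add (.const 10)),
        fun x hx => ?_⟩
      rw [key _ hx.2]
      exact (hP x hx).comp Run.fst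
  refine (PTime.cond hl.isEmpty (.const (hl.size_in.restrict fun _ h => h.1) default) h).congr
    fun x _ => ?_
  cases l x <;> rfl

omit [Enc α] [Enc β] [Enc γ] in
theorem iterate_fold_body [Inhabited β] (step : α → γ → β → γ) (x : α) (i : ℕ) :
    ∀ (l : List β) (a : γ), i ≤ l.length →
    (fun p : α × γ × List β => (p.1, step p.1 p.2.1 p.2.2.headI, p.2.2.tail))^[i] (x, a, l) =
      (x, (l.take i).foldl (step x) a, l.drop i) := by
  induction i with
  | zero => intro l a _; simp
  | succ i ih =>
    intro l a hi
    cases l with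
    | nil => simp at hi
    | cons b l =>
      rw [Function.iterate_succ_apply]
      simpa using ih l (step x a b) (by simpa using hi)

/-- A fold is a loop on triples of argument, accumulator and remaining list, which ends when that
list is empty. Bounds are required only for accumulators that arise from a prefix of the list, so
that invariants of the fold can enter the analysis. -/
theorem PTime.foldl [Inhabited β] {t : α × γ × β → Prop} {C : α × γ × β → ℕ}
    {step : α → γ → β → γ} {l : α → List β} {init : α → γ}
    (hstep : PTime t C fun p => step p.1 p.2.1 p.2.2) (hl : PTime s B l) (hi : PTime s B init)
    (T : α → ℕ) (hT : PolyBdd s B T)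
    (hbd : ∀ x, s x → ∀ l₁ b l₂, l x = l₁ ++ b :: l₂ →
      t (x, l₁.foldl (step x) (init x), b) ∧ C (x, l₁.foldl (step x) (init x), b) ≤ T x) :
    PTime s B fun x => (l x).foldl (step x) (init x) := by
  let g : α × γ × List β → α × γ × β := fun p => (p.1, p.2.1, p.2.2.headI)
  have hsize : PolyBdd (fun p => t (g p)) (fun p => C (g p) + sz p.2.2)
      fun p : α × γ × List β => sz p := by
    have h1 : PolyBdd (fun p => t (g p)) (fun p => C (g p) + sz p.2.2) fun p => sz (g p) :=
      hstep.size_in.comp (fun _ h => h) (.of_le fun _ _ => Nat.le_add_right _ _)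
    refine (h1.add (PolyBdd.of_le fun p _ => Nat.le_add_left (sz p.2.2) (C (g p)))).mono
      fun p _ => ?_
    obtain ⟨x, a, l⟩ := p
    simp only [sz_pair, g]
    omega
  have hbody : PTime (fun p => t (g p)) (fun p => C (g p) + sz p.2.2)
      fun p : α × γ × List β => (p.1, step p.1 p.2.1 p.2.2.headI, p.2.2.tail) := by
    have hid := PTime.id hsize
    have hg : PTime (fun p => t (g p)) (fun p => C (g p) + sz p.2.2) g :=
      hid.fst.pair (hid.snd.fst.pair hid.snd.snd.headI)
    exact hid.fst.pair ((hstep.comp hg (fun _ h => h)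
      (.of_le fun _ _ => Nat.le_add_right _ _)).pair hid.snd.snd.tail)
  have hinit : PTime s B fun x => (x, init x, l x) := (PTime.id hl.size_in).pair (hi.pair hl)
  have htest : PolyTime fun p : α × γ × List β => !p.2.2.isEmpty :=
    PTime.not (PTime.isEmpty .proj₂₂)
  have hiter : ∀ x, s x → ∀ i ≤ (l x).length, _ := fun x _ i hi =>
    iterate_fold_body step x i (l x) (init x) hi
  refine (PTime.loopWhile htest hbody hinit (fun x => (l x).length) (fun x => T x + sz (l x))
    (hl.size_out.mono fun x _ => (length_lt_sz _).le) (hT.add hl.size_out)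
    ?_ ?_ ?_).snd.fst.congr fun x hx => ?_
  · intro x hx i hi
    rw [hiter x hx i hi.le]
    simpa using hi
  · intro x hx
    rw [hiter x hx _ le_rfl]
    simp
  · intro x hx i hi
    rw [hiter x hx i hi.le]
    have h := hbd x hx ((l x).take i) (l x)[i] ((l x).drop (i + 1)) (by simp)
    have hd : ((l x).drop i).headI = (l x)[i] := by rw [List.drop_eq_getElem_cons hi]; rfl
    simp only [g, hd]
    exact ⟨h.1, Nat.add_le_add h.2 (sz_sublist_le (List.drop_sublist _ _))⟩
  · rw [hiter x hx _ le_rfl]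
    simp

theorem PolyTime.foldl [Inhabited β] {step : α → γ → β → γ} {l : α → List β} {init : α → γ}
    (hstep : PolyTime fun p : α × γ × β => step p.1 p.2.1 p.2.2) (hl : PTime s B l)
    (hi : PTime s B init) (T : α → ℕ) (hT : PolyBdd s B T)
    (hbd : ∀ x, s x → ∀ l₁ l₂, l x = l₁ ++ l₂ → sz (l₁.foldl (step x) (init x)) ≤ T x) :
    PTime s B fun x => (l x).foldl (step x) (init x) := by
  refine PTime.foldl hstep hl hi (fun x => sz x + T x + sz (l x) + 2)
    (((hl.size_in.add hT).add hl.size_out).add (.const 2)) fun x hx l₁ b l₂ h => ⟨trivial, ?_⟩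
  have h1 := hbd x hx l₁ _ h
  have h2 : sz b < sz (l x) := sz_lt_of_mem (by simp [h])
  simp only [sz_pair]
  omega

theorem PTime.reverse [Inhabited β] {l : α → List β} (hl : PTime s B l) :
    PTime s B fun x => (l x).reverse := by
  have hstep : PolyTime fun p : α × List β × β => p.2.2 :: p.2.1 :=
    PTime.cons .proj₂₂ .proj₂₁
  have key : ∀ l a : List β, l.foldl (fun a b => b :: a) a = l.reverse ++ a := fun l => by
    induction l with
    | nil => simp
    | cons b l ih => intro a; simp [ih]
  refine (PolyTime.foldl (step := fun _ a b => b :: a) hstep hl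
    (.const hl.size_in []) (fun x => sz (l x)) hl.size_out ?_).congr fun x _ => by simp [key]
  intro x _ l₁ l₂ h
  rw [key, List.append_nil, sz_reverse, h]
  exact sz_sublist_le (List.sublist_append_left _ _)

theorem PTime.foldr [Inhabited β] {t : α × γ × β → Prop} {C : α × γ × β → ℕ}
    {step : α → β → γ → γ} {l : α → List β} {init : α → γ}
    (hstep : PTime t C fun p => step p.1 p.2.2 p.2.1) (hl : PTime s B l) (hi : PTime s B init)
    (T : α → ℕ) (hT : PolyBdd s B T)
    (hbd : ∀ x, s x → ∀ l₁ b l₂, l x = l₁ ++ b :: l₂ →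
      t (x, l₂.foldr (step x) (init x), b) ∧ C (x, l₂.foldr (step x) (init x), b) ≤ T x) :
    PTime s B fun x => (l x).foldr (step x) (init x) := by
  refine (PTime.foldl (step := fun x a b => step x b a) hstep hl.reverse hi T hT ?_).congr
    fun x _ => by simp [List.foldl_reverse]
  intro x hx l₁ b l₂ h
  have := hbd x hx l₂.reverse b l₁.reverse (by rw [← List.reverse_reverse (l x), h]; simp)
  rwa [List.foldr_reverse] at this

theorem PolyTime.foldr [Inhabited β] {step : α → β → γ → γ} {l : α → List β} {init : α → γ}
    (hstep : PolyTime fun p : α × γ × β => step p.1 p.2.2 p.2.1) (hl : PTime s B l)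
    (hi : PTime s B init) (T : α → ℕ) (hT : PolyBdd s B T)
    (hbd : ∀ x, s x → ∀ l₁ l₂, l x = l₁ ++ l₂ → sz (l₂.foldr (step x) (init x)) ≤ T x) :
    PTime s B fun x => (l x).foldr (step x) (init x) := by
  refine PTime.foldr hstep hl hi (fun x => sz x + T x + sz (l x) + 2)
    (((hl.size_in.add hT).add hl.size_out).add (.const 2)) fun x hx l₁ b l₂ h => ⟨trivial, ?_⟩
  have h1 := hbd x hx (l₁ ++ [b]) l₂ (by simp [h])
  have h2 : sz b < sz (l x) := sz_lt_of_mem (by simp [h])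
  simp only [sz_pair]
  omega

theorem PTime.map [Inhabited β] {t : α × β → Prop} {C : α × β → ℕ}
    {f : α → β → δ} {l : α → List β} (hf : PTime t C fun p => f p.1 p.2) (hl : PTime s B l)
    (T : α → ℕ) (hT : PolyBdd s B T)
    (hbd : ∀ x, s x → ∀ b ∈ l x, t (x, b) ∧ C (x, b) ≤ T x) :
    PTime s B fun x => (l x).map (f x) := by
  obtain ⟨c, hc⟩ := hf.size_out
  have hsz : PolyBdd (fun p : α × List δ × β => t (p.1, p.2.2))
      (fun p => C (p.1, p.2.2) + sz p.2.1) fun p => sz p := by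
    refine ((hf.size_in.comp (f := fun p : α × List δ × β => (p.1, p.2.2)) (fun _ h => h)
      (PolyBdd.of_le fun p _ => Nat.le_add_right _ (sz p.2.1))).add
      (PolyBdd.of_le fun p _ => Nat.le_add_left (sz p.2.1) _)).add (.const 1) |>.mono
      fun p _ => ?_
    obtain ⟨x, a, b⟩ := p
    simp only [sz_pair]
    omega
  have hid := PTime.id hsz
  have hstep : PTime (fun p : α × List δ × β => t (p.1, p.2.2))
      (fun p => C (p.1, p.2.2) + sz p.2.1) fun p => f p.1 p.2.2 :: p.2.1 :=
    (hf.comp (hid.fst.pair hid.snd.snd) (fun _ h => h)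
      (PolyBdd.of_le fun p _ => Nat.le_add_right _ (sz p.2.1))).cons hid.snd.fst
  refine (PTime.foldr (step := fun x b a => f x b :: a) (init := fun _ => []) hstep hl
    -- Each value has size at most `(T x + 2) ^ c`, and there are fewer than `sz (l x)` of them;
    -- this bounds the list collected so far.
    (.const hl.size_in []) (fun x => T x + (sz (l x) * ((T x + 2) ^ c + 1) + 1))
    (hT.add ((hl.size_out.mul (((hT.add (.const 2)).pow c).add (.const 1))).add (.const 1)))
    ?_).congr fun x _ => ?_
  · intro x hx l₁ b l₂ h
    have hb := hbd x hx b (by simp [h])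
    refine ⟨hb.1, Nat.add_le_add hb.2 ?_⟩
    have key : l₂.foldr (fun b a => f x b :: a) [] = l₂.map (f x) := by
      induction l₂ generalizing l₁ b <;> simp
    rw [key]
    refine (sz_list_le (M := (T x + 2) ^ c) ?_).trans ?_
    · intro d hd
      obtain ⟨b', hb', rfl⟩ := List.mem_map.1 hd
      have hb' := hbd x hx b' (by simp [h, hb'])
      exact (hc _ hb'.1).trans (Nat.pow_le_pow_left (by omega) c)
    · rw [List.length_map]
      have : l₂.length ≤ sz (l x) := by
        have := length_lt_sz (l x)
        rw [h, List.length_append, List.length_cons] at this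
        rw [h]; omega
      exact Nat.add_le_add_right (Nat.mul_le_mul_right _ this) 1
  · induction l x <;> simp_all

theorem PolyTime.map [Inhabited β] {f : α → β → δ} {l : α → List β}
    (hf : PolyTime fun p : α × β => f p.1 p.2) (hl : PTime s B l) :
    PTime s B fun x => (l x).map (f x) := by
  refine PTime.map hf hl (fun x => sz x + sz (l x)) (hl.size_in.add hl.size_out)
    fun x _ b hb => ⟨trivial, ?_⟩
  have := sz_lt_of_mem hb
  simp only [sz_pair]
  omega

theorem PTime.all_id {l : α → List Bool} (hl : PTime s B l) :
    PTime s B fun x => (l x).all fun b => b := by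
  refine (PolyTime.foldr (step := fun _ b a => b && a) (init := fun _ => true)
    (PTime.and .proj₂₂ .proj₂₁) hl (.const hl.size_in true)
    (fun _ => 3) (.const 3) fun _ _ _ _ _ => sz_bool_le _).congr fun x _ => ?_
  induction l x <;> simp_all

theorem PolyTime.all [Inhabited β] {f : α → β → Bool} {l : α → List β}
    (hf : PolyTime fun p : α × β => f p.1 p.2) (hl : PTime s B l) :
    PTime s B fun x => (l x).all (f x) :=
  (PolyTime.map hf hl).all_id.congr fun x _ => by
    rw [List.all_map]; rfl

theorem PolyTime.any [Inhabited β] {f : α → β → Bool} {l : α → List β}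
    (hf : PolyTime fun p : α × β => f p.1 p.2) (hl : PTime s B l) :
    PTime s B fun x => (l x).any (f x) :=
  (PolyTime.all (f := fun x b => !f x b) (PTime.not hf) hl).not.congr fun x _ => by
    rw [List.not_all_eq_any_not]; simp

theorem PolyTime.filter [Inhabited β] {f : α → β → Bool} {l : α → List β}
    (hf : PolyTime fun p : α × β => f p.1 p.2) (hl : PTime s B l) :
    PTime s B fun x => (l x).filter (f x) := by
  have h1 : PolyTime fun p : α × List β × β => p.1 := .proj₁
  have h2 : PolyTime fun p : α × List β × β => p.2.1 := .proj₂₁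
  have h3 : PolyTime fun p : α × List β × β => p.2.2 := .proj₂₂
  have key : ∀ x (l : List β),
      l.foldr (fun b a => bif f x b then b :: a else a) [] = l.filter (f x) := fun x l => by
    induction l with
    | nil => rfl
    | cons b l ih => rw [List.foldr_cons, ih, List.filter_cons]; cases f x b <;> rfl
  refine (PolyTime.foldr (step := fun x b a => bif f x b then b :: a else a)
    (init := fun _ => []) ((hf.comp (h1.pair h3)).cond' (h3.cons h2) h2) hl
    (.const hl.size_in []) (fun x => sz (l x)) hl.size_out ?_).congr fun x _ => (key x (l x)).symm
  intro x _ l₁ l₂ h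
  rw [key, h]
  exact sz_sublist_le (List.filter_sublist.trans (List.sublist_append_right _ _))

theorem PTime.append [Inhabited β] {l l' : α → List β} (hl : PTime s B l) (hl' : PTime s B l') :
    PTime s B fun x => l x ++ l' x := by
  have key : ∀ l l' : List β, l.foldr (fun b a => b :: a) l' = l ++ l' := fun l l' => by
    induction l <;> simp_all
  refine (PolyTime.foldr (step := fun _ b a => b :: a) (PTime.cons .proj₂₂
    .proj₂₁) hl hl' (fun x => sz (l x) + sz (l' x)) (hl.size_out.add hl'.size_out)
    ?_).congr fun x _ => (key _ _).symm
  intro x _ l₁ l₂ h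
  have h1 := sz_append l₂ (l' x)
  have h2 := sz_sublist_le (List.sublist_append_right l₁ l₂)
  rw [key, h]
  omega

end Folds

/-! ### Arithmetic on unary numbers -/

section Nat

variable {α β γ δ : Type} [Enc α] [Enc β] [Enc γ] [Enc δ] {s : α → Prop} {B : α → ℕ}

theorem PTime.replicate_unit {f : α → ℕ} (hf : PTime s B f) :
    PTime s B fun x => List.replicate (f x) () := by
  obtain ⟨h1, h2, h3⟩ := hf
  exact ⟨h1, h2, h3⟩

theorem PTime.of_replicate_unit {f : α → ℕ} (hf : PTime s B fun x => List.replicate (f x) ()) :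
    PTime s B f := by
  obtain ⟨h1, h2, h3⟩ := hf
  exact ⟨h1, h2, h3⟩

theorem PTime.length [Inhabited β] {l : α → List β} (hl : PTime s B l) :
    PTime s B fun x => (l x).length :=
  .of_replicate_unit <| (PolyTime.map (f := fun _ _ => ()) (.const _) hl).congr fun x _ => by
    simp

theorem PTime.succ {f : α → ℕ} (hf : PTime s B f) : PTime s B fun x => f x + 1 :=
  .of_replicate_unit <| ((PTime.const hf.size_in ()).cons hf.replicate_unit).congr fun _ _ => rfl

theorem PTime.pred {f : α → ℕ} (hf : PTime s B f) : PTime s B fun x => f x - 1 :=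
  .of_replicate_unit <| hf.replicate_unit.tail.congr fun x _ => by simp

theorem PTime.eq_zero {f : α → ℕ} (hf : PTime s B f) : PTime s B fun x => decide (f x = 0) :=
  hf.replicate_unit.isEmpty.congr fun x _ => by cases f x <;> simp [List.replicate_succ]

theorem PTime.add {f g : α → ℕ} (hf : PTime s B f) (hg : PTime s B g) :
    PTime s B fun x => f x + g x :=
  .of_replicate_unit <| (hf.replicate_unit.append hg.replicate_unit).congr fun x _ => by
    rw [List.replicate_append_replicate]

omit [Enc γ] in
theorem foldl_replicate_unit (f : γ → γ) (n : ℕ) : ∀ a,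
    (List.replicate n ()).foldl (fun a _ => f a) a = f^[n] a := by
  induction n with
  | zero => exact fun _ => rfl
  | succ n ih => exact fun a => by rw [List.replicate_succ, List.foldl_cons, ih]; rfl

theorem PTime.iterate {t : α × γ → Prop} {C : α × γ → ℕ} {step : α → γ → γ} {n : α → ℕ}
    {init : α → γ} (hstep : PTime t C fun p => step p.1 p.2) (hn : PTime s B n)
    (hi : PTime s B init) (T : α → ℕ) (hT : PolyBdd s B T)
    (hbd : ∀ x, s x → ∀ i < n x,
      t (x, (step x)^[i] (init x)) ∧ C (x, (step x)^[i] (init x)) ≤ T x) :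
    PTime s B fun x => (step x)^[n x] (init x) := by
  have hsz : PolyBdd (fun p : α × γ × Unit => t (p.1, p.2.1)) (fun p => C (p.1, p.2.1))
      fun p => sz p :=
    ((hstep.size_in.comp (f := fun p : α × γ × Unit => (p.1, p.2.1)) (fun _ h => h)
      .self).add (.const 2)).mono fun p _ => by
        obtain ⟨x, a, u⟩ := p
        have : sz u = 1 := rfl
        simp only [sz_pair, this]
        omega
  have hid := PTime.id hsz
  refine (PTime.foldl (step := fun x a _ => step x a)
    (hstep.comp (hid.fst.pair hid.snd.fst) (fun _ h => h) .self) hn.replicate_unit hi T hT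
    ?_).congr fun x _ => (foldl_replicate_unit _ _ _).symm
  intro x hx l₁ b l₂ h
  have hl₁ : l₁ = List.replicate l₁.length () := List.eq_replicate_iff.2 ⟨rfl, fun _ _ => rfl⟩
  have hlen := congrArg List.length h
  simp only [List.length_replicate, List.length_append, List.length_cons] at hlen
  rw [hl₁, foldl_replicate_unit]
  exact hbd x hx _ (by omega)

theorem PolyTime.iterate {step : α → γ → γ} {n : α → ℕ} {init : α → γ}
    (hstep : PolyTime fun p : α × γ => step p.1 p.2) (hn : PTime s B n) (hi : PTime s B init)
    (T : α → ℕ) (hT : PolyBdd s B T)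
    (hbd : ∀ x, s x → ∀ i < n x, sz ((step x)^[i] (init x)) ≤ T x) :
    PTime s B fun x => (step x)^[n x] (init x) :=
  PTime.iterate hstep hn hi (fun x => sz x + T x + 1) ((hn.size_in.add hT).add (.const 1))
    fun x hx i h => ⟨trivial, by simp only [sz_pair]; have := hbd x hx i h; omega⟩

theorem PTime.mul {f g : α → ℕ} (hf : PTime s B f) (hg : PTime s B g) :
    PTime s B fun x => f x * g x := by
  have key : ∀ (x : α) (i : ℕ), (fun a => a + g x)^[i] 0 = i * g x := fun x i => by
    induction i with
    | zero => simp
    | succ i ih => rw [Function.iterate_succ_apply', ih, Nat.succ_mul]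
  have h := PolyTime.iterate (α := ℕ × ℕ) (s := fun _ => True) (B := fun p => sz p)
    (step := fun p a => a + p.2) (n := fun p => p.1) (init := fun _ => 0)
    (PTime.add .proj₂ (PTime.snd .proj₁)) .proj₁ (PTime.const .self 0)
    (fun p => 2 * (sz p * sz p) + 1)
    (((PolyBdd.const 2).mul (.mul .self .self)).add (.const 1)) ?_
  · refine (PolyTime.comp₂ (h := fun a b => (fun a => a + b)^[a] 0) h hf hg).congr fun x _ => ?_
    exact (key x _).symm
  · rintro ⟨a, b⟩ - i hi
    have : (fun a => a + b)^[i] 0 = i * b := by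
      clear hi
      induction i with
      | zero => simp
      | succ i ih => rw [Function.iterate_succ_apply', ih, Nat.succ_mul]
    simp only at hi ⊢
    rw [this, sz_nat, sz_pair, sz_nat, sz_nat]
    have := Nat.mul_le_mul (show i ≤ 2 * a + 1 + (2 * b + 1) + 1 by omega)
      (show b ≤ 2 * a + 1 + (2 * b + 1) + 1 by omega)
    omega

theorem iterate_pred (i : ℕ) : ∀ a : ℕ, (fun a => a - 1)^[i] a = a - i := by
  induction i with
  | zero => exact fun _ => rfl
  | succ i ih => intro a; rw [Function.iterate_succ_apply, ih]; omega

theorem PTime.sub {f g : α → ℕ} (hf : PTime s B f) (hg : PTime s B g) :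
    PTime s B fun x => f x - g x :=
  (PolyTime.iterate (step := fun _ a => a - 1) (PTime.pred .proj₂) hg hf (fun x => sz (f x))
    hf.size_out fun x _ i _ => by rw [iterate_pred, sz_nat, sz_nat]; omega).congr
    fun x _ => (iterate_pred _ _).symm

theorem PTime.le {f g : α → ℕ} (hf : PTime s B f) (hg : PTime s B g) :
    PTime s B fun x => decide (f x ≤ g x) :=
  (hf.sub hg).eq_zero.congr fun x _ => by simp only [Nat.sub_eq_zero_iff_le]

theorem PTime.lt {f g : α → ℕ} (hf : PTime s B f) (hg : PTime s B g) :
    PTime s B fun x => decide (f x < g x) := hf.succ.le hg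

theorem PTime.min {f g : α → ℕ} (hf : PTime s B f) (hg : PTime s B g) :
    PTime s B fun x => min (f x) (g x) :=
  ((hf.le hg).cond' hf hg).congr fun x _ => by
    rw [min_def]; by_cases h : f x ≤ g x <;> simp [h]

theorem PTime.max {f g : α → ℕ} (hf : PTime s B f) (hg : PTime s B g) :
    PTime s B fun x => max (f x) (g x) :=
  ((hf.le hg).cond' hg hf).congr fun x _ => by
    rw [max_def]; by_cases h : f x ≤ g x <;> simp [h]

theorem PTime.eq_nat {f g : α → ℕ} (hf : PTime s B f) (hg : PTime s B g) :
    PTime s B fun x => decide (f x = g x) :=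
  ((hf.le hg).and (hg.le hf)).congr fun x _ => by
    rw [Bool.eq_iff_iff]; simp only [decide_eq_true_eq, Bool.and_eq_true]; omega

theorem PTime.eq_bool {f g : α → Bool} (hf : PTime s B f) (hg : PTime s B g) :
    PTime s B fun x => decide (f x = g x) :=
  (hf.cond' hg hg.not).congr fun x _ => by cases f x <;> cases g x <;> rfl

theorem PTime.list_sum {l : α → List ℕ} (hl : PTime s B l) : PTime s B fun x => (l x).sum := by
  have key : ∀ l : List ℕ, sz l.sum ≤ 2 * sz l := fun l => by
    induction l with
    | nil => simp [sz_nil, sz_nat]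
    | cons a l ih => rw [List.sum_cons, sz_cons, sz_nat, sz_nat]; rw [sz_nat] at ih; omega
  refine (PolyTime.foldr (step := fun _ a b => a + b) (init := fun _ => 0)
    (PTime.add .proj₂₂ .proj₂₁) hl (.const hl.size_in 0)
    (fun x => 2 * sz (l x)) ((PolyBdd.const 2).mul hl.size_out) ?_).congr fun _ _ => rfl
  intro x _ l₁ l₂ h
  refine (key l₂).trans (Nat.mul_le_mul_left 2 ?_)
  rw [h]
  exact sz_sublist_le (List.sublist_append_right _ _)

theorem PTime.list_max {l : α → List ℕ} (hl : PTime s B l) :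
    PTime s B fun x => (l x).foldr Max.max 0 := by
  have key : ∀ l : List ℕ, sz (l.foldr Max.max 0) ≤ sz l := fun l => by
    induction l with
    | nil => simp [sz_nil, sz_nat]
    | cons a l ih =>
      rw [List.foldr_cons, sz_cons, sz_nat, sz_nat]; rw [sz_nat] at ih; omega
  refine PolyTime.foldr (step := fun _ a b => Max.max a b) (init := fun _ => 0)
    (PTime.max .proj₂₂ .proj₂₁) hl (.const hl.size_in 0)
    (fun x => sz (l x)) hl.size_out ?_
  intro x _ l₁ l₂ h
  refine (key l₂).trans ?_
  rw [h]
  exact sz_sublist_le (List.sublist_append_right _ _)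

/-- Equality of lists, the second list being consumed along the first one. -/
theorem PolyTime.list_eq [DecidableEq β] [Inhabited β]
    (hβ : PolyTime fun p : β × β => decide (p.1 = p.2)) :
    PolyTime fun p : List β × List β => decide (p.1 = p.2) := by
  -- The state records whether all entries so far agree, together with the unread part of the second
  -- list. The lists are equal if the flag survives and nothing remains unread.
  let step : List β × List β → Bool × List β → β → Bool × List β := fun _ a b =>
    (a.1 && (!a.2.isEmpty && decide (b = a.2.headI)), a.2.tail)
  have key : ∀ (x : List β × List β) (l : List β) (a : Bool × List β),
      ((l.foldl (step x) a).1 && (l.foldl (step x) a).2.isEmpty) = (a.1 && decide (l = a.2)) := by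
    intro x l
    induction l with
    | nil => rintro ⟨c, m⟩; cases m <;> simp
    | cons b l ih =>
      rintro ⟨c, m⟩
      rw [List.foldl_cons, ih]
      cases m with
      | nil => simp [step]
      | cons d m =>
        rw [Bool.eq_iff_iff]
        by_cases h : b = d
        · simp only [step, h, List.isEmpty_cons, Bool.not_false, List.headI_cons, List.tail_cons,
            Bool.and_eq_true, decide_eq_true_eq, List.cons.injEq, true_and, and_true]
          exact and_congr_right fun _ => ⟨of_decide_eq_true, fun h => decide_eq_true h⟩
        · simp [step, h]
  have key2 : ∀ (x : List β × List β) (l : List β) (a : Bool × List β),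
      (l.foldl (step x) a).2.Sublist a.2 := by
    intro x l
    induction l with
    | nil => exact fun _ => List.Sublist.refl _
    | cons b l ih => exact fun a => (ih _).trans (List.tail_sublist _)
  have h2 : PolyTime fun p : (List β × List β) × (Bool × List β) × β => p.2.1 := .proj₂₁
  have h3 : PolyTime fun p : (List β × List β) × (Bool × List β) × β => p.2.2 := .proj₂₂
  have hstep : PolyTime fun p : (List β × List β) × (Bool × List β) × β =>
      step p.1 p.2.1 p.2.2 :=
    (h2.fst.and (h2.snd.isEmpty.not.and (hβ.comp₂ (h := fun a b => decide (a = b)) h3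
      h2.snd.headI))).pair h2.snd.tail
  have h := PolyTime.foldl (s := fun _ => True) (B := fun p : List β × List β => sz p)
    (l := fun p => p.1) (init := fun p => (true, p.2)) hstep .proj₁
    ((PolyTime.const true).pair .proj₂) (fun p => sz p + 4) (.add .self (.const 4)) ?_
  · exact (h.fst.and h.snd.isEmpty).congr fun p _ => by rw [key p]; simp
  · intro p _ l₁ l₂ _
    have h1 := sz_sublist_le (key2 p l₁ (true, p.2))
    have h2 := sz_bool_le (l₁.foldl (step p) (true, p.2)).1
    have h3 : sz p = sz p.1 + sz p.2 + 1 := rfl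
    have h4 : ∀ q : Bool × List β, sz q = sz q.1 + sz q.2 + 1 := fun _ => rfl
    rw [h4]
    simp only at h1
    omega

end Nat

end TreeProgram

/-! ### Computable predicates -/

namespace TreeProgram

open StackProgram Enc

theorem PTime.natPair : PolyTime fun p : ℕ × ℕ => Nat.pair p.1 p.2 := by
  have h1 : PolyTime fun p : ℕ × ℕ => p.1 := .proj₁
  have h2 : PolyTime fun p : ℕ × ℕ => p.2 := .proj₂
  refine ((PTime.lt h1 h2).cond' ((PTime.mul h2 h2).add h1)
    (((PTime.mul h1 h1).add h1).add h2)).congr fun p _ => ?_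
  rw [Nat.pair]
  by_cases h : p.1 < p.2 <;> simp [h]

/-- The successor of a pair of numbers in the order of their codes. -/
def nextPair (p : ℕ × ℕ) : ℕ × ℕ :=
  bif decide (p.1 < p.2) then (bif decide (p.1 + 1 < p.2) then (p.1 + 1, p.2) else (p.2, 0))
  else (bif decide (p.2 < p.1) then (p.1, p.2 + 1) else (0, p.1 + 1))

theorem pair_nextPair (p : ℕ × ℕ) :
    Nat.pair (nextPair p).1 (nextPair p).2 = Nat.pair p.1 p.2 + 1 := by
  obtain ⟨a, b⟩ := p
  unfold nextPair Nat.pair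
  by_cases h : a < b
  · by_cases h' : a + 1 < b
    · simp [h, h']; omega
    · obtain rfl : b = a + 1 := by omega
      simp
      ring
  · by_cases h' : b < a
    · have : ¬ a < b + 1 := by omega
      simp [h, h', this]; omega
    · obtain rfl : a = b := by omega
      simp
      ring

theorem iterate_nextPair (n : ℕ) : nextPair^[n] (0, 0) = Nat.unpair n := by
  induction n with
  | zero => simp
  | succ n ih =>
    rw [Function.iterate_succ_apply', ih]
    have h := pair_nextPair (Nat.unpair n)
    rw [Nat.pair_unpair] at h
    rw [← h, Nat.unpair_pair]

/-- No square root is computed: starting at `(0, 0)`, the pairs are enumerated in the order of their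
codes, which is polynomial since the code is unary and bounds both entries. -/
theorem PTime.unpair {α : Type} [Enc α] {s : α → Prop} {B : α → ℕ} {f : α → ℕ}
    (hf : PTime s B f) : PTime s B fun x => Nat.unpair (f x) := by
  have h1 : PolyTime fun p : α × ℕ × ℕ => p.2.1 := .proj₂₁
  have h2 : PolyTime fun p : α × ℕ × ℕ => p.2.2 := .proj₂₂
  have hnext : PolyTime fun p : α × ℕ × ℕ => nextPair p.2 :=
    (h1.lt h2).cond' ((h1.succ.lt h2).cond' (h1.succ.pair h2) (h2.pair (.const .self 0)))
      ((h2.lt h1).cond' (h1.pair h2.succ) ((PTime.const .self 0).pair h1.succ))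
  refine (PolyTime.iterate (step := fun _ p => nextPair p) hnext hf (.const hf.size_in (0, 0))
    (fun x => 2 * sz (f x) + 3) (((PolyBdd.const 2).mul hf.size_out).add (.const 3)) ?_).congr
    fun x _ => (iterate_nextPair _).symm
  intro x _ i hi
  rw [iterate_nextPair, show ∀ p : ℕ × ℕ, sz p = sz p.1 + sz p.2 + 1 from fun _ => rfl,
    sz_nat, sz_nat, sz_nat]
  have := Nat.unpair_left_le i
  have := Nat.unpair_right_le i
  omega

theorem PTime.pairCode {α : Type} [Enc α] {s : α → Prop} {B : α → ℕ} {f g : α → ℕ}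
    (hf : PTime s B f) (hg : PTime s B g) : PTime s B fun x => Nat.pair (f x) (g x) :=
  PolyTime.comp₂ (h := Nat.pair) .natPair hf hg

theorem PTime.of_poly {f : ℕ → ℕ} (h : PolyTime f) : PTime (fun _ => True) (fun n => n) f :=
  h.mono (((PolyBdd.const 2).mul .self).add (.const 1) |>.mono fun n _ => (sz_nat n).le)

/-- The sum of the first `n` values. -/
def sumBelow (f : ℕ → ℕ) (n : ℕ) : ℕ := Nat.rec (motive := fun _ => ℕ) 0 (fun i a => a + f i) n

theorem primrec_sum {f : ℕ → ℕ → ℕ} (hf : Primrec₂ f) :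
    Primrec₂ fun z n => sumBelow (f z) n :=
  Primrec.nat_rec (Primrec.const 0) (Primrec.nat_add.comp (Primrec.snd.comp Primrec.snd)
    (hf.comp Primrec.fst (Primrec.fst.comp Primrec.snd))).to₂

theorem le_rec_sum (f : ℕ → ℕ) {i n : ℕ} (h : i < n) :
    f i ≤ sumBelow f n := by
  induction n with
  | zero => omega
  | succ n ih =>
    rcases Nat.lt_succ_iff_lt_or_eq.1 h with h | rfl
    · exact (ih h).trans (Nat.le_add_right _ _)
    · exact Nat.le_add_left _ _

/-- Primitive recursive functions are computed within a primitive recursive bound. -/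
theorem PTime.of_primrec {f : ℕ → ℕ} (hf : Nat.Primrec f) :
    ∃ B : ℕ → ℕ, Primrec B ∧ PTime (fun _ => True) B f := by
  induction hf with
  | zero => exact ⟨_, Primrec.id, .of_poly (.const 0)⟩
  | succ => exact ⟨_, Primrec.id, .of_poly (PTime.succ PolyTime.id)⟩
  | left => exact ⟨_, Primrec.id, .of_poly (PTime.fst (PTime.unpair PolyTime.id))⟩
  | right => exact ⟨_, Primrec.id, .of_poly (PTime.snd (PTime.unpair PolyTime.id))⟩
  | @pair f g hf hg ihf ihg =>
    obtain ⟨B, hB, hf'⟩ := ihf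
    obtain ⟨C, hC, hg'⟩ := ihg
    exact ⟨_, Primrec.nat_add.comp hB hC, .pairCode
      (hf'.mono (.of_le fun _ _ => Nat.le_add_right _ _))
      (hg'.mono (.of_le fun _ _ => Nat.le_add_left _ _))⟩
  | @comp f g hf hg ihf ihg =>
    obtain ⟨B, hB, hf'⟩ := ihf
    obtain ⟨C, hC, hg'⟩ := ihg
    exact ⟨fun n => B (g n) + C n,
      Primrec.nat_add.comp (hB.comp (Primrec.nat_iff.2 hg)) hC, hf'.comp
      (hg'.mono (.of_le fun _ _ => Nat.le_add_left _ _)) (fun _ _ => trivial)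
      (.of_le fun _ _ => Nat.le_add_right _ _)⟩
  | @prec f g hf hg ihf ihg =>
    obtain ⟨B, hB, hf'⟩ := ihf
    obtain ⟨C, hC, hg'⟩ := ihg
    have hf := Primrec.nat_iff.2 hf
    have hg := Primrec.nat_iff.2 hg
    let r : ℕ → ℕ → ℕ := fun z n => Nat.rec (f z) (fun y IH => g (Nat.pair z (Nat.pair y IH))) n
    -- The cost bound of round `i` plus the value reached before it. The sum `W` over all rounds
    -- dominates each of them and is again primitive recursive.
    let w : ℕ → ℕ → ℕ := fun z i => C (Nat.pair z (Nat.pair i (r z i))) + r z i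
    have hpair : Primrec fun p : ℕ × ℕ × ℕ => Nat.pair p.1 (Nat.pair p.2.1 p.2.2) :=
      Primrec₂.natPair.comp Primrec.fst (Primrec₂.natPair.comp
        (Primrec.fst.comp Primrec.snd) (Primrec.snd.comp Primrec.snd))
    have hr : Primrec₂ r := Primrec.nat_rec hf (hg.comp hpair).to₂
    have hw : Primrec₂ w := Primrec.nat_add.comp (hC.comp (hpair.comp
      (Primrec.fst.pair (Primrec.snd.pair hr)))) hr
    have hunp1 : Primrec fun x : ℕ => (Nat.unpair x).1 := Primrec.fst.comp Primrec.unpair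
    have hunp2 : Primrec fun x : ℕ => (Nat.unpair x).2 := Primrec.snd.comp Primrec.unpair
    let W : ℕ → ℕ := fun x => sumBelow (w (Nat.unpair x).1) (Nat.unpair x).2
    have hW : Primrec W := (primrec_sum hw).comp hunp1 hunp2
    refine ⟨fun x => x + B (Nat.unpair x).1 + W x,
      Primrec.nat_add.comp (Primrec.nat_add.comp Primrec.id (hB.comp hunp1)) hW, ?_⟩
    let step : ℕ → ℕ × ℕ → ℕ × ℕ := fun x p =>
      (p.1 + 1, g (Nat.pair (Nat.unpair x).1 (Nat.pair p.1 p.2)))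
    have hiter : ∀ x i, (step x)^[i] (0, f (Nat.unpair x).1) = (i, r (Nat.unpair x).1 i) := by
      intro x i
      induction i with
      | zero => rfl
      | succ i ih => rw [Function.iterate_succ_apply', ih]
    have hsz : PolyBdd (fun _ => True) (fun x => x + B (Nat.unpair x).1 + W x)
        fun x : ℕ => sz x :=
      ((PolyBdd.const 2).mul (.of_le (T := fun x => x) fun x _ => by omega)).add (.const 1)
        |>.mono fun x _ => (sz_nat x).le
    have hid := PTime.id hsz
    let D : ℕ × ℕ × ℕ → ℕ := fun p =>
      sz p + C (Nat.pair (Nat.unpair p.1).1 (Nat.pair p.2.1 p.2.2))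
    have hidD : PTime (fun _ => True) D fun p : ℕ × ℕ × ℕ => p :=
      .id (.of_le fun _ _ => Nat.le_add_right _ _)
    have hstep : PTime (fun _ => True) D fun p : ℕ × ℕ × ℕ => step p.1 p.2 :=
      hidD.snd.fst.succ.pair (hg'.comp (hidD.fst.unpair.fst.pairCode
        (hidD.snd.fst.pairCode hidD.snd.snd)) (fun _ _ => trivial)
        (.of_le fun _ _ => Nat.le_add_left _ _))
    have hinit : PTime (fun _ => True) (fun x => x + B (Nat.unpair x).1 + W x)
        fun x => ((0 : ℕ), f (Nat.unpair x).1) :=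
      (PTime.const hsz 0).pair (hf'.comp hid.unpair.fst (fun _ _ => trivial)
        (.of_le fun _ _ => by omega))
    refine (PTime.iterate hstep hid.unpair.snd hinit
      (fun x => 6 * (x + B (Nat.unpair x).1 + W x) + 5)
      (((PolyBdd.const 6).mul .self).add (.const 5)) ?_).snd.congr fun x _ => ?_
    · intro x _ i hi
      refine ⟨trivial, ?_⟩
      rw [hiter]
      have h1 : w (Nat.unpair x).1 i ≤ W x := le_rec_sum (w (Nat.unpair x).1) hi
      have h2 := Nat.unpair_right_le x
      simp only [D, sz_pair, sz_nat]
      simp only [w] at h1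
      omega
    · rw [hiter]

/-- Unbounded search for a nonzero value. -/
theorem PTime.search {h : ℕ → ℕ} (hh : Nat.Primrec h) (K : ℕ → ℕ) (hK : Computable K)
    (hlt : ∀ n, ∀ k < K n, h (Nat.pair n k) = 0) (hne : ∀ n, h (Nat.pair n (K n)) ≠ 0) :
    ∃ B : ℕ → ℕ, Computable B ∧
      PTime (fun _ => True) B fun n => h (Nat.pair n (K n)) := by
  obtain ⟨B, hB, hh'⟩ := PTime.of_primrec hh
  have hh := Primrec.nat_iff.2 hh
  let w : ℕ → ℕ → ℕ := fun n k => B (Nat.pair n k) + h (Nat.pair n k)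
  have hw : Primrec₂ w := Primrec.nat_add.comp (hB.comp Primrec₂.natPair) (hh.comp Primrec₂.natPair)
  -- The upper limit is `K n + 1` because `h` is also evaluated at `K n`, where the search succeeds.
  let W : ℕ → ℕ := fun n => sumBelow (w n) (K n + 1)
  have hW : Computable W :=
    (primrec_sum hw).to_comp.comp Computable.id (Computable.succ.comp hK)
  refine ⟨fun n => n + K n + W n, Primrec.nat_add.to_comp.comp
    (Primrec.nat_add.to_comp.comp Computable.id hK) hW, ?_⟩
  have hwW : ∀ n, ∀ k ≤ K n, w n k ≤ W n := fun n k hk =>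
    le_rec_sum (w n) (Nat.lt_succ_of_le hk)
  have hsz : PolyBdd (fun _ => True) (fun n => n + K n + W n) fun n : ℕ => sz n :=
    ((PolyBdd.const 2).mul (.of_le (T := fun x => x) fun x _ => by omega)).add (.const 1)
      |>.mono fun x _ => (sz_nat x).le
  have hid := PTime.id hsz
  let body : ℕ × ℕ × ℕ → ℕ × ℕ × ℕ := fun p => (p.1, p.2.1 + 1, h (Nat.pair p.1 (p.2.1 + 1)))
  let D : ℕ × ℕ × ℕ → ℕ := fun p => sz p + B (Nat.pair p.1 (p.2.1 + 1))
  have hidD : PTime (fun _ => True) D fun p : ℕ × ℕ × ℕ => p :=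
    .id (.of_le fun _ _ => Nat.le_add_right _ _)
  have hbody : PTime (fun _ => True) D body :=
    hidD.fst.pair (hidD.snd.fst.succ.pair (hh'.comp (hidD.fst.pairCode hidD.snd.fst.succ)
      (fun _ _ => trivial) (.of_le fun _ _ => Nat.le_add_left _ _)))
  have hinit : PTime (fun _ => True) (fun n => n + K n + W n)
      fun n => (n, (0 : ℕ), h (Nat.pair n 0)) :=
    hid.pair ((PTime.const hsz 0).pair (hh'.comp (hid.pairCode (.const hsz 0))
      (fun _ _ => trivial) (.of_le fun n _ => by
        have := hwW n 0 (Nat.zero_le _)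
        simp only [w] at this
        omega)))
  have hiter : ∀ n i, body^[i] (n, 0, h (Nat.pair n 0)) = (n, i, h (Nat.pair n i)) := by
    intro n i
    induction i with
    | zero => rfl
    | succ i ih => rw [Function.iterate_succ_apply', ih]
  have htest : PolyTime fun p : ℕ × ℕ × ℕ => decide (p.2.2 = 0) := PTime.eq_zero .proj₂₂
  refine (PTime.loopWhile htest hbody hinit K
    (fun n => 2 * n + 2 * K n + 3 * W n + 6) (.of_le fun n _ => by omega)
    (((((PolyBdd.const 6).mul .self).add (.const 6))).mono fun n _ => by omega)
    ?_ ?_ ?_).snd.snd.congr fun n _ => ?_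
  · intro n _ i hi
    rw [hiter]
    simpa using hlt n i hi
  · intro n _
    rw [hiter]
    simpa using hne n
  · intro n _ i hi
    refine ⟨trivial, ?_⟩
    rw [hiter]
    have h1 := hwW n i hi.le
    have h2 := hwW n (i + 1) hi
    simp only [w] at h1 h2
    simp only [D, sz_pair, sz_nat]
    omega
  · rw [hiter]

/-- Computable predicates are decided within a computable bound. -/
theorem PTime.of_computablePred {E : ℕ → Prop} (hE : ComputablePred E) :
    ∃ (χ : ℕ → Bool) (B : ℕ → ℕ), (∀ n, χ n = true ↔ E n) ∧ Computable B ∧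
      PTime (fun _ => True) B χ := by
  obtain ⟨χ, hχ, hχE⟩ := ComputablePred.computable_iff.1 hE
  obtain ⟨c, hc⟩ := Nat.Partrec.Code.exists_code.1 (hχ : Nat.Partrec _)
  have hc' : ∀ n, c.eval n = Part.some (Encodable.encode (χ n)) := fun n => by
    rw [hc]; simp
  -- Evaluation of a fixed code with a bounded amount of resources is primitive recursive. The
  -- encoding of options gives `0` for no result and the result plus one otherwise, so a successful
  -- evaluation is a nonzero value of `h`.
  let h : ℕ → ℕ := fun m =>
    Encodable.encode (Nat.Partrec.Code.evaln (Nat.unpair m).2 c (Nat.unpair m).1)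
  have hh : Primrec h := Primrec.encode.comp (Nat.Partrec.Code.primrec_evaln.comp
    (((Primrec.snd.comp Primrec.unpair).pair (Primrec.const c)).pair
      (Primrec.fst.comp Primrec.unpair)))
  have hval : ∀ n k, h (Nat.pair n k) ≠ 0 → h (Nat.pair n k) = Encodable.encode (χ n) + 1 := by
    intro n k hne
    simp only [h, Nat.unpair_pair] at hne ⊢
    cases hev : Nat.Partrec.Code.evaln k c n with
    | none => simp [hev] at hne
    | some v =>
      have := Nat.Partrec.Code.evaln_sound (Option.mem_def.2 hev)
      rw [hc', Part.mem_some_iff] at this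
      rw [this]; rfl
  have hex : ∀ n, ∃ k, h (Nat.pair n k) ≠ 0 := by
    intro n
    obtain ⟨k, hk⟩ := Nat.Partrec.Code.evaln_complete.1
      (show Encodable.encode (χ n) ∈ c.eval n by rw [hc']; exact Part.mem_some _)
    refine ⟨k, ?_⟩
    simp only [h, Nat.unpair_pair, Option.mem_def.1 hk]
    simp
  have hK : Computable fun n => Nat.find (hex n) := by
    have hp : Computable₂ fun n k : ℕ => !decide (h (Nat.pair n k) = 0) :=
      (Primrec.not.comp ((Primrec.eq.comp (hh.comp Primrec₂.natPair)
        (Primrec.const 0)).decide)).to_comp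
    have := Partrec.rfind (p := fun n k => Part.some (!decide (h (Nat.pair n k) = 0))) hp
    refine this.of_eq fun n => ?_
    refine Part.eq_some_iff.2 (Nat.mem_rfind.2 ⟨?_, fun {m} hm => ?_⟩)
    · simpa using Nat.find_spec (hex n)
    · simpa using Nat.find_min (hex n) hm
  obtain ⟨B, hB, hP⟩ := PTime.search (Primrec.nat_iff.1 hh) _ hK
    (fun n k hk => by simpa using Nat.find_min (hex n) hk) fun n => Nat.find_spec (hex n)
  -- The number `2` is the successor of the code `1` of `true`.
  refine ⟨χ, B, fun n => by rw [hχE], hB, (hP.eq_nat (.const hP.size_in 2)).congr fun n _ => ?_⟩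
  rw [hval n _ (Nat.find_spec (hex n))]
  cases χ n <;> rfl

end TreeProgram

/-! ### Input and output of the Turing machines -/

namespace TreeProgram

open StackProgram StackProgram.Cmd Enc

/-- Pushes the symbols of a list to `left`, the first one at first. -/
def pushAll : List Bool → Cmd Alph
  | [] => skip
  | b :: w => seq (push .left b) (pushAll w)

theorem exec_pushAll (i : List Γ') (o a r n w : List Bool) : ∀ l,
    Exec (pushAll w) (store i o a l r n) (store i o a (w.reverse ++ l) r n) (w.length + 1) := by
  induction w with
  | nil => exact fun l => Exec.skip _
  | cons b w ih =>
    intro l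
    exact exec_cast (Exec.seq (exec_push (by simp)) (ih (b :: l))) rfl (by simp)
      (by simp; omega)

/-- Executes the branch for the symbol on the top of the input. -/
def dispatch (c : Γ' → Cmd Alph) : List Γ' → Cmd Alph
  | [] => skip
  | s :: l => cond .inp (fun a => decide (a = some s)) (c s) (dispatch c l)

theorem exec_dispatch {c : Γ' → Cmd Alph} {s : Γ'} {l : List Γ'} (hs : s ∈ l)
    {S S' : ∀ k, List (Alph k)} (hS : (S .inp).head? = some s) {n : ℕ} (h : Exec (c s) S S' n) :
    ∃ m ≤ n + l.length, Exec (dispatch c l) S S' m := by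
  induction l with
  | nil => simp at hs
  | cons s' l ih =>
    by_cases hss : s = s'
    · subst hss
      exact ⟨n + 1, by simp, Exec.cond_true (by simp [hS]) h⟩
    · obtain ⟨m, hm, h⟩ := ih (by simpa [hss] using hs)
      exact ⟨m + 1, by simp; omega, Exec.cond_false (by simp [hS, hss]) h⟩

/-- The symbols of the input alphabet. -/
def symbols : List Γ' := [.blank, .bit false, .bit true, .bra, .ket, .comma]

theorem mem_symbols (s : Γ') : s ∈ symbols := by
  rcases s with _ | (_ | _) | _ | _ | _ <;> decide

theorem sz_symbol_le (s : Γ') : sz s ≤ 11 := by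
  rcases s with _ | (_ | _) | _ | _ | _ <;> decide

theorem sz_string_le (x : List Γ') : sz x ≤ 12 * x.length + 1 := by
  have := sz_list_le (l := x) fun s _ => sz_symbol_le s
  omega

/-- Translates the input into a tree. -/
def loadLoop : Cmd Alph := loop .inp Option.isSome
  (dispatch (fun s => seq (pop .inp) (pushAll (true :: (enc s).code))) symbols)

/-- Translates the input into a tree, and moves it to `main`. -/
def loadCmd : Cmd Alph := seq loadLoop (seq (push .left false) dumpLeft)

/-- The code of a list is the concatenation of `true :: code` over its entries, closed by one
`false`. So symbols are translated one by one as they are read, and the closing `false`, dropped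
here, is left to `loadCmd`. Per symbol there are at most `12` pushes, and `21` covers these together
with the tests. -/
theorem exec_loadLoop (x : List Γ') : ∀ l, ∃ m ≤ 21 * x.length + 1,
    Exec loadLoop (store x [] [] l [] [])
      (store [] [] [] ((enc x).code.dropLast.reverse ++ l) [] []) m := by
  induction x with
  | nil => exact fun l => ⟨1, by simp, Exec.loop_false (by simp)⟩
  | cons s x ih =>
    intro l
    have h := exec_pushAll x [] [] [] [] (true :: (enc s).code) l
    obtain ⟨m, hm, hd⟩ := exec_dispatch
      (c := fun s => seq (pop .inp) (pushAll (true :: (enc s).code))) (mem_symbols s)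
      (S := store (s :: x) [] [] l [] []) rfl (Exec.seq (exec_pop (by simp)) h)
    obtain ⟨m', hm', hr⟩ := ih ((true :: (enc s).code).reverse ++ l)
    have hlen : (true :: (enc s).code).length ≤ 12 := by
      have : (enc s).size ≤ 11 := sz_symbol_le s
      simp [Tree₀.length_code]; omega
    refine ⟨m + m' + 1, ?_, ?_⟩
    · simp only [symbols, List.length_cons, List.length_nil] at hm hlen ⊢
      omega
    · refine exec_cast (Exec.loop_true rfl hd hr) rfl ?_ rfl
      have hne : (enc x).code ≠ [] := fun h => by
        have := Tree₀.length_code (enc x)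
        rw [h] at this
        exact (Tree₀.size_pos (enc x)).ne this
      have hcode : (enc (s :: x)).code = true :: ((enc s).code ++ (enc x).code) := rfl
      congr 1
      rw [hcode, ← List.cons_append, List.dropLast_append_of_ne_nil hne]
      simp

theorem code_list_dropLast {α : Type} [Enc α] (x : List α) :
    (enc x).code.dropLast ++ [false] = (enc x).code := by
  induction x with
  | nil => rfl
  | cons s x ih =>
    have hcode : (enc (s :: x)).code = true :: ((enc s).code ++ (enc x).code) := rfl
    rw [hcode, ← ih, ← List.append_assoc, ← List.cons_append, List.dropLast_concat]

theorem exec_loadCmd (x : List Γ') : ∃ m ≤ 21 * x.length + 4 * sz x + 3,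
    Exec loadCmd (store x [] [] [] [] []) (store [] [] (enc x).code [] [] []) m := by
  obtain ⟨m, hm, h⟩ := exec_loadLoop x []
  refine ⟨_, ?_, exec_cast (Exec.seq h (Exec.seq (exec_push (by simp))
    (exec_dumpLeft [] [] [] [] (false :: ((enc x).code.dropLast.reverse ++ [])) [])))
    rfl ?_ rfl⟩
  · have h1 := congrArg List.length (code_list_dropLast x)
    have h2 : (enc x).code.length = sz x := Tree₀.length_code _
    simp only [List.length_append, List.length_cons, List.length_nil, List.length_reverse] at h1 ⊢
    omega
  · simp [code_list_dropLast]

/-- Moves the truth values in a list to `left`. -/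
def storeLoop : Cmd Alph := loop .main isTrue (seq (pop .main) (cond .main isTrue
  (seq (pop .main) (seq (pop .main) (seq (pop .main) (push .left true))))
  (seq (pop .main) (push .left false))))

/-- Moves `left` symbol by symbol to the output. -/
def outLoop : Cmd Alph := loop .left Option.isSome (cond .left isTrue
  (seq (pop .left) (push .out true)) (seq (pop .left) (push .out false)))

/-- Writes a list of truth values to the output. -/
def storeCmd : Cmd Alph := seq storeLoop (seq (pop .main) outLoop)

/-- After the `true` that announces an entry, the next symbol is already the truth value: `false`
has code `[false]` and `true` has code `[true, false, false]`, of which the two leaves are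
discarded. -/
theorem exec_storeLoop (y : List Bool) : ∀ l, ∃ m ≤ 7 * y.length + 1,
    Exec storeLoop (store [] [] (enc y).code l [] []) (store [] [] [false] (y.reverse ++ l) [] [])
      m := by
  induction y with
  | nil => exact fun l => ⟨1, by simp, Exec.loop_false rfl⟩
  | cons b y ih =>
    intro l
    obtain ⟨m, hm, h⟩ := ih (b :: l)
    cases b
    · refine ⟨_, ?_, exec_cast (Exec.loop_true rfl (Exec.seq (exec_pop rfl) (Exec.cond_false rfl
        (Exec.seq (exec_pop rfl) (exec_push (by simp; rfl))))) h) rfl (by simp) rfl⟩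
      simp; omega
    · refine ⟨_, ?_, exec_cast (Exec.loop_true rfl (Exec.seq (exec_pop rfl) (Exec.cond_true rfl
        (Exec.seq (exec_pop rfl) (Exec.seq (exec_pop rfl) (Exec.seq (exec_pop rfl)
        (exec_push (by simp; rfl))))))) h) rfl (by simp) rfl⟩
      simp; omega

theorem exec_outLoop (l : List Bool) : ∀ o,
    Exec outLoop (store [] o [] l [] []) (store [] (l.reverse ++ o) [] [] [] [])
      (4 * l.length + 1) := by
  induction l with
  | nil => exact fun a => Exec.loop_false (by simp)
  | cons s l ih =>
    intro a
    refine exec_cast (Exec.loop_true (m := 3) (by simp) ?_ (ih (s :: a))) rfl (by simp)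
      (by simp; omega)
    cases s
    · exact Exec.cond_false (by simp [isTrue]) (Exec.seq (exec_pop rfl) (exec_push (by simp)))
    · exact Exec.cond_true (by simp [isTrue]) (Exec.seq (exec_pop rfl) (exec_push (by simp)))

theorem exec_storeCmd (y : List Bool) : ∃ m ≤ 11 * y.length + 3,
    Exec storeCmd (store [] [] (enc y).code [] [] []) (store [] y [] [] [] []) m := by
  obtain ⟨m, hm, h⟩ := exec_storeLoop y []
  refine ⟨_, ?_, exec_cast (Exec.seq h (Exec.seq (exec_pop (by simp))
    (exec_outLoop y.reverse []))) (by simp) (by simp) rfl⟩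
  simp only [List.length_reverse]
  omega

/-- A function on strings that is computed within a bound is computed by a Turing machine within
this bound. -/
theorem PTime.exists_machine {B : List Γ' → ℕ} {F : List Γ' → List Bool}
    (hF : PTime (fun _ => True) B F) :
    ∃ (M : TM2ComputableAux Γ' Bool) (T : List Γ' → ℕ), PolyBdd (fun _ => True) B T ∧
      ∀ x m, T x ≤ m → Nonempty (TM2OutputsInTime M.tm (x.map M.inputAlphabet.invFun)
        (some ((F x).map M.outputAlphabet.invFun)) m) := by
  obtain ⟨P, T, hT, hP⟩ := hF.run
  let Q : Cmd Alph := seq loadCmd (seq P storeCmd)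
  refine ⟨⟨@Cmd.machine Stk Alph _ _ Q .inp .out (inferInstanceAs (Fintype Γ')),
    Equiv.refl _, Equiv.refl _⟩, fun x => 25 * sz x + T x + 11 * sz (F x) + 7,
    ((((PolyBdd.const 25).mul hF.size_in).add hT).add
      ((PolyBdd.const 11).mul hF.size_out)).add (.const 7), fun x m hm => ?_⟩
  obtain ⟨m₁, hm₁, h₁⟩ := exec_loadCmd x
  obtain ⟨m₂, hm₂, h₂⟩ := hP x trivial [] [] []
  obtain ⟨m₃, hm₃, h₃⟩ := exec_storeCmd (F x)
  rw [List.append_nil, List.append_nil] at h₂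
  have hx := length_lt_sz x
  have hy := length_lt_sz (F x)
  have h := Exec.seq h₁ (Exec.seq h₂ h₃)
  -- Both alphabets are identified by `Equiv.refl`, so the mapped words equal the original ones.
  -- Stating the claim for arbitrary words equal to `x` and `F x` avoids rewriting inside the
  -- machine.
  have key : ∀ a b, a = x → b = F x → Nonempty (TM2OutputsInTime
      (@Cmd.machine Stk Alph _ _ Q .inp .out (inferInstanceAs (Fintype Γ'))) a (some b) m) := by
    rintro a b rfl rfl
    refine Cmd.machine_outputs Q .inp .out (n := m₁ + (m₂ + m₃)) (exec_cast h ?_ ?_ rfl)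
      (by simp only at hm; omega)
    · funext k; cases k <;> rfl
    · funext k; cases k <;> rfl
  exact key _ _ (List.map_id x) (List.map_id (F x))

end TreeProgram

/-! ### Binary numerals -/

namespace TreeProgram

open StackProgram Enc

/-- Binary numerals, with the least significant bit first. -/
abbrev Numeral : Type := List Bool

theorem encodeNat_posNum (p : PosNum) : encodeNat (p : ℕ) = encodePosNum p := by
  have h : (((p : ℕ) : ℕ) : Num) = Num.pos p := Num.of_to_nat (Num.pos p)
  rw [encodeNat, h]
  rfl

theorem exists_posNum {n : ℕ} (hn : n ≠ 0) : ∃ p : PosNum, (p : ℕ) = n := by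
  have h := Num.to_of_nat n
  cases hc : (n : Num) with
  | zero => rw [hc] at h; exact absurd h.symm hn
  | pos p => rw [hc] at h; exact ⟨p, h⟩

theorem encodeNat_zero : encodeNat 0 = [] := rfl

theorem encodeNat_bit0 {n : ℕ} (hn : n ≠ 0) : encodeNat (2 * n) = false :: encodeNat n := by
  obtain ⟨p, rfl⟩ := exists_posNum hn
  have h : 2 * (p : ℕ) = ((PosNum.bit0 p : PosNum) : ℕ) := by rw [PosNum.cast_bit0]; omega
  rw [h, encodeNat_posNum, encodeNat_posNum]
  rfl

theorem encodeNat_bit1 (n : ℕ) : encodeNat (2 * n + 1) = true :: encodeNat n := by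
  by_cases hn : n = 0
  · subst hn; rfl
  obtain ⟨p, rfl⟩ := exists_posNum hn
  have h : 2 * (p : ℕ) + 1 = ((PosNum.bit1 p : PosNum) : ℕ) := by rw [PosNum.cast_bit1]; omega
  rw [h, encodeNat_posNum, encodeNat_posNum]
  rfl

theorem encodeNat_injective : Function.Injective encodeNat := fun m n h => by
  rw [← decode_encodeNat m, h, decode_encodeNat]

/-- The successor of a numeral. -/
def inc : Numeral → Numeral
  | [] => [true]
  | false :: l => true :: l
  | true :: l => false :: inc l

theorem inc_encodeNat (n : ℕ) : inc (encodeNat n) = encodeNat (n + 1) := by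
  induction n using Nat.strong_induction_on with
  | _ n ih =>
    rcases Nat.even_or_odd' n with ⟨m, rfl | rfl⟩
    · rw [encodeNat_bit1]
      by_cases hm : m = 0
      · subst hm; rfl
      · rw [encodeNat_bit0 hm]; rfl
    · rw [encodeNat_bit1, inc, ih m (by omega), show 2 * m + 1 + 1 = 2 * (m + 1) by ring,
        encodeNat_bit0 (by omega)]

theorem iterate_inc (i n : ℕ) : inc^[i] (encodeNat n) = encodeNat (n + i) := by
  induction i with
  | zero => rfl
  | succ i ih => rw [Function.iterate_succ_apply', ih, inc_encodeNat]; rfl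

theorem length_inc_le (l : Numeral) : (inc l).length ≤ l.length + 1 := by
  induction l with
  | nil => simp [inc]
  | cons b l ih => cases b <;> simp [inc, ih]

theorem length_iterate_inc_le (i : ℕ) (l : Numeral) : (inc^[i] l).length ≤ l.length + i := by
  induction i with
  | zero => simp
  | succ i ih =>
    rw [Function.iterate_succ_apply']
    have := length_inc_le (inc^[i] l)
    omega

theorem sz_numeral_le (l : Numeral) : sz l ≤ 4 * l.length + 1 := by
  have := sz_list_le (l := l) fun b _ => sz_bool_le b
  omega

/-- The value of a numeral. -/
def bitsVal (l : Numeral) : ℕ := l.foldr (fun b n => bif b then n + n + 1 else n + n) 0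

theorem bitsVal_encodeNat (n : ℕ) : bitsVal (encodeNat n) = n := by
  induction n using Nat.strong_induction_on with
  | _ n ih =>
    rcases Nat.even_or_odd' n with ⟨m, rfl | rfl⟩
    · by_cases hm : m = 0
      · subst hm; rfl
      · rw [encodeNat_bit0 hm]
        have := ih m (by omega)
        simp only [bitsVal, List.foldr_cons, cond_false] at this ⊢
        rw [this]; omega
    · rw [encodeNat_bit1]
      have := ih m (by omega)
      simp only [bitsVal, List.foldr_cons, cond_true] at this ⊢
      rw [this]; omega

/-- A numeral is canonical if it is empty or ends with `true`. -/
def canonical (l : Numeral) : Bool := l.foldl (fun _ b => b) true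

theorem encodeNat_bitsVal {l : Numeral} (h : canonical l = true) : encodeNat (bitsVal l) = l := by
  -- The first half says that a nonempty numeral of value `0` ends with `false`. It excludes the
  -- value `0` for the tail of a canonical numeral, for which the rule `encodeNat_bit0` would fail.
  have key : ∀ l : Numeral, (l ≠ [] → bitsVal l = 0 → l.foldl (fun _ b => b) true = false) ∧
      (canonical l = true → encodeNat (bitsVal l) = l) := by
    intro l
    induction l with
    | nil => exact ⟨fun h => absurd rfl h, fun _ => rfl⟩
    | cons b l ih =>
      have hb : bitsVal (b :: l) = bif b then bitsVal l + bitsVal l + 1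
          else bitsVal l + bitsVal l := rfl
      cases l with
      | nil => cases b <;> simp [bitsVal, canonical, encodeNat_zero]; rfl
      | cons c l =>
        refine ⟨fun _ h => ?_, fun h => ?_⟩
        · refine ih.1 (by simp) ?_
          cases b <;> simp only [hb, cond_true, cond_false] at h <;> omega
        · have hl : canonical (c :: l) = true := h
          have hv : bitsVal (c :: l) ≠ 0 := fun h0 => by
            have := ih.1 (by simp) h0
            rw [canonical] at hl
            rw [hl] at this
            cases this
          rw [hb]
          cases b
          · rw [cond_false, ← two_mul, encodeNat_bit0 hv, ih.2 hl]
          · rw [cond_true, ← two_mul, encodeNat_bit1, ih.2 hl]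
  exact (key l).2 h

theorem canonical_encodeNat (n : ℕ) : canonical (encodeNat n) = true := by
  induction n using Nat.strong_induction_on with
  | _ n ih =>
    rcases Nat.even_or_odd' n with ⟨m, rfl | rfl⟩
    · by_cases hm : m = 0
      · subst hm; rfl
      · rw [encodeNat_bit0 hm]
        have hne : encodeNat m ≠ [] := fun h =>
          hm (encodeNat_injective (h.trans encodeNat_zero.symm))
        have := ih m (by omega)
        cases hc : encodeNat m with
        | nil => exact absurd hc hne
        | cons b l => rw [hc] at this; exact this
    · rw [encodeNat_bit1]
      exact ih m (by omega)

/-- The value of a numeral, or `M` if the value is larger. -/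
def cappedVal (M : ℕ) (l : Numeral) : ℕ :=
  l.foldr (fun b n => min (bif b then n + n + 1 else n + n) M) 0

/-- Cutting off after every digit gives the same as cutting off once at the end, since doubling is
monotone and does not decrease. Thus the unary intermediate values never exceed `M`, although the
full value may be exponential in the length. -/
theorem cappedVal_eq (M : ℕ) (l : Numeral) : cappedVal M l = min (bitsVal l) M := by
  induction l with
  | nil => simp [cappedVal, bitsVal]
  | cons b l ih =>
    have h1 : cappedVal M (b :: l) =
      min (bif b then cappedVal M l + cappedVal M l + 1 else cappedVal M l + cappedVal M l) M := rfl
    have h2 : bitsVal (b :: l) = bif b then bitsVal l + bitsVal l + 1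
      else bitsVal l + bitsVal l := rfl
    rw [h1, h2, ih]
    cases b <;> simp only [cond_true, cond_false] <;> omega

/-! ### Polynomial time operations on numerals -/

section PTime

variable {α : Type} [Enc α] {s : α → Prop} {B : α → ℕ}

theorem PTime.eq_numeral {f g : α → Numeral} (hf : PTime s B f) (hg : PTime s B g) :
    PTime s B fun x => decide (f x = g x) :=
  PolyTime.comp₂ (h := fun a b : Numeral => decide (a = b))
    (PolyTime.list_eq (PTime.eq_bool .proj₁ .proj₂)) hf hg

theorem PTime.inc {f : α → Numeral} (hf : PTime s B f) : PTime s B fun x => inc (f x) := by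
  -- The fold carries the successor of a suffix along with the suffix itself, because a low digit
  -- `false` leaves the higher digits unchanged.
  let step : Bool → Numeral × Numeral → Numeral × Numeral := fun b p =>
    (bif b then false :: p.1 else true :: p.2, b :: p.2)
  have key : ∀ l : Numeral, l.foldr step ([true], []) = (TreeProgram.inc l, l) := by
    intro l
    induction l with
    | nil => rfl
    | cons b l ih => rw [List.foldr_cons, ih]; cases b <;> rfl
  have h1 : PolyTime fun p : α × (Numeral × Numeral) × Bool => p.2.1 := .proj₂₁
  have h2 : PolyTime fun p : α × (Numeral × Numeral) × Bool => p.2.2 := .proj₂₂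
  refine (PolyTime.foldr (step := fun _ => step) ((h2.cond' ((PTime.const .self false).cons
    (PTime.fst h1)) ((PTime.const .self true).cons (PTime.snd h1))).pair (h2.cons (PTime.snd h1)))
    hf (.const hf.size_in ([true], [])) (fun x => 8 * sz (f x) + 10)
    (((PolyBdd.const 8).mul hf.size_out).add (.const 10)) ?_).fst.congr fun x _ => by rw [key]
  intro x _ l₁ l₂ h
  rw [key, sz_pair]
  have h3 := sz_numeral_le (TreeProgram.inc l₂)
  have h4 := length_inc_le l₂
  have h5 := sz_numeral_le l₂
  have h6 : l₂.length ≤ (f x).length := by rw [h]; simp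
  have h7 := length_lt_sz (f x)
  omega

theorem PTime.iterate_inc {f : α → Numeral} {n : α → ℕ} (hf : PTime s B f) (hn : PTime s B n) :
    PTime s B fun x => TreeProgram.inc^[n x] (f x) := by
  refine PolyTime.iterate (step := fun _ l => TreeProgram.inc l) (PTime.inc .proj₂) hn hf
    (fun x => 4 * sz (f x) + 4 * sz (n x) + 1) ((((PolyBdd.const 4).mul hf.size_out).add
    ((PolyBdd.const 4).mul hn.size_out)).add (.const 1)) fun x _ i hi => ?_
  have h3 := sz_numeral_le (TreeProgram.inc^[i] (f x))
  have h4 := length_iterate_inc_le i (f x)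
  have h7 := length_lt_sz (f x)
  have h8 := sz_nat (n x)
  change sz (TreeProgram.inc^[i] (f x)) ≤ _
  omega

theorem PTime.encodeNat {n : α → ℕ} (hn : PTime s B n) : PTime s B fun x => encodeNat (n x) :=
  (PTime.iterate_inc (.const hn.size_in []) hn).congr fun x _ => by
    rw [← encodeNat_zero, TreeProgram.iterate_inc, Nat.zero_add]

theorem PTime.canonical {f : α → Numeral} (hf : PTime s B f) :
    PTime s B fun x => canonical (f x) :=
  PolyTime.foldl (step := fun _ _ b => b) .proj₂₂ hf (.const hf.size_in true) (fun _ => 3)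
    (.const 3) fun _ _ _ _ _ => sz_bool_le _

theorem PTime.cappedVal {f : α → Numeral} {M : α → ℕ} (hf : PTime s B f) (hM : PTime s B M) :
    PTime s B fun x => cappedVal (M x) (f x) := by
  have h : PolyTime fun p : ℕ × Numeral => TreeProgram.cappedVal p.1 p.2 := by
    have h1 : PolyTime fun p : (ℕ × Numeral) × ℕ × Bool => p.2.1 := .proj₂₁
    have h2 : PolyTime fun p : (ℕ × Numeral) × ℕ × Bool => p.2.2 := .proj₂₂
    have h3 : PolyTime fun p : (ℕ × Numeral) × ℕ × Bool => p.1.1 := PTime.fst .proj₁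
    refine PolyTime.foldr
      (step := fun p b n => Min.min (bif b then n + n + 1 else n + n) p.1)
      ((h2.cond' (h1.add h1).succ (h1.add h1)).min h3) .proj₂ (PTime.const .self 0)
      (fun p => sz p) .self fun p _ l₁ l₂ _ => ?_
    have h4 := cappedVal_eq p.1 l₂
    have h5 : sz p.1 ≤ sz p := by
      obtain ⟨M, l⟩ := p
      rw [sz_pair]
      change sz M ≤ _
      omega
    simp only [TreeProgram.cappedVal] at h4
    simp only [h4, sz_nat] at h5 ⊢
    omega
  exact PolyTime.comp₂ (h := TreeProgram.cappedVal) h hM hf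

theorem PTime.count {f : α → Numeral} {l : α → List Numeral} (hf : PTime s B f)
    (hl : PTime s B l) : PTime s B fun x => (l x).count (f x) := by
  have h : PolyTime fun p : Numeral × List Numeral =>
      (p.2.filter fun u => decide (u = p.1)).length :=
    PTime.length (PolyTime.filter (f := fun p u => decide (u = p.1))
      (PTime.eq_numeral .proj₂ (PTime.fst .proj₁)) .proj₂)
  refine (PolyTime.comp₂ (h := fun (a : Numeral) (l : List Numeral) =>
    (l.filter fun u => decide (u = a)).length) h hf hl).congr fun x _ => ?_
  rw [List.count, List.countP_eq_length_filter]
  congr 2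
  funext u
  rw [Bool.eq_iff_iff, beq_iff_eq, decide_eq_true_iff]

theorem PTime.mem {f : α → Numeral} {l : α → List Numeral} (hf : PTime s B f)
    (hl : PTime s B l) : PTime s B fun x => decide (f x ∈ l x) := by
  have h : PolyTime fun p : Numeral × List Numeral => p.2.any fun u => decide (u = p.1) :=
    PolyTime.any (f := fun p u => decide (u = p.1))
      (PTime.eq_numeral .proj₂ (PTime.fst .proj₁)) .proj₂
  refine (PolyTime.comp₂ (h := fun (a : Numeral) (l : List Numeral) =>
    l.any fun u => decide (u = a)) h hf hl).congr fun x _ => ?_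
  rw [Bool.eq_iff_iff]
  simp

end PTime

end TreeProgram

/-! ### Parsing of instances -/

namespace TreeProgram

open StackProgram Enc ParamCSP

/-- The string for a list of lists of numerals. -/
def unparse (L : List (List Numeral)) : List Γ' :=
  encodeSeq (encodeSeq (List.map Γ'.bit) Γ'.comma) Γ'.ket L

theorem encodeLists_eq (N : List (List ℕ)) :
    encodeLists N = unparse (N.map (List.map encodeNat)) := by
  simp only [encodeLists, unparse, encodeSeq, List.flatMap_map]
  rfl

/-- Reads one symbol. Strings are read from right to left; the truth value is `false` after an
error. -/
def parseStep (a : Γ') (p : Bool × List (List Numeral)) : Bool × List (List Numeral) :=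
  bif decide ((symbolData a).1 = 0) then
    bif p.2.isEmpty || p.2.headI.isEmpty then (false, p.2)
    else (p.1, (((symbolData a).2 :: p.2.headI.headI) :: p.2.headI.tail) :: p.2.tail)
  else bif decide ((symbolData a).1 = 1) then
    bif p.2.isEmpty then (false, p.2) else (p.1, ([] :: p.2.headI) :: p.2.tail)
  else bif decide ((symbolData a).1 = 2) then (p.1, [] :: p.2)
  else (false, p.2)

/-- Reads a string. -/
def parse (x : List Γ') : Bool × List (List Numeral) := x.foldr parseStep (true, [])

/-- Reading from right to left, each accepted symbol puts exactly that symbol in front of the string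
for the lists read so far. With `parse_unparse`, the strings read without error are exactly those of
the form `unparse L`. -/
theorem unparse_parse (x : List Γ') (h : (parse x).1 = true) : unparse (parse x).2 = x := by
  induction x with
  | nil => rfl
  | cons a x ih =>
    have hp : parse (a :: x) = parseStep a (parse x) := rfl
    rw [hp] at h ⊢
    generalize parse x = p at *
    obtain ⟨c, L⟩ := p
    rcases a with _ | b | _ | _ | _
    · simp [parseStep, symbolData] at h
    · rcases L with _ | ⟨_ | ⟨n, l⟩, L⟩
      · simp [parseStep, symbolData] at h
      · simp [parseStep, symbolData] at h
      · simp only [parseStep, symbolData, decide_true, List.isEmpty_cons, List.headI_cons,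
          Bool.or_self, cond_true, cond_false, List.tail_cons] at h ⊢
        rw [← ih h]
        simp [unparse, encodeSeq]
    · simp [parseStep, symbolData] at h
    · simp only [parseStep, symbolData, decide_true, cond_true, OfNat.ofNat_ne_zero, decide_false,
        cond_false, OfNat.ofNat_ne_one] at h ⊢
      rw [← ih h]
      simp [unparse, encodeSeq]
    · rcases L with _ | ⟨l, L⟩
      · simp [parseStep, symbolData] at h
      · simp only [parseStep, symbolData, decide_true, cond_true, one_ne_zero, decide_false,
          cond_false, List.isEmpty_cons, List.headI_cons, List.tail_cons] at h ⊢
        rw [← ih h]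
        simp [unparse, encodeSeq]

theorem parse_unparse (L : List (List Numeral)) : parse (unparse L) = (true, L) := by
  have hbits : ∀ (n m : Numeral) (l : List Numeral) (L : List (List Numeral)),
      (n.map Γ'.bit).foldr parseStep (true, (m :: l) :: L) = (true, ((n ++ m) :: l) :: L) := by
    intro n m l L
    induction n with
    | nil => rfl
    | cons b n ih => rw [List.map_cons, List.foldr_cons, ih]; rfl
  have hlist : ∀ (l l' : List Numeral) (L : List (List Numeral)),
      (encodeSeq (List.map Γ'.bit) Γ'.comma l).foldr parseStep (true, l' :: L) =
        (true, (l ++ l') :: L) := by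
    intro l l' L
    induction l with
    | nil => rfl
    | cons n l ih =>
      have : encodeSeq (List.map Γ'.bit) Γ'.comma (n :: l) =
        n.map Γ'.bit ++ (Γ'.comma :: encodeSeq (List.map Γ'.bit) Γ'.comma l) := by
          simp [encodeSeq]
      rw [this, List.foldr_append, List.foldr_cons, ih]
      have : parseStep Γ'.comma (true, (l ++ l') :: L) = (true, ([] :: (l ++ l')) :: L) := rfl
      rw [this, hbits]
      simp
  induction L with
  | nil => rfl
  | cons l L ih =>
    have : unparse (l :: L) =
      encodeSeq (List.map Γ'.bit) Γ'.comma l ++ (Γ'.ket :: unparse L) := by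
        simp [unparse, encodeSeq]
    rw [parse] at ih ⊢
    rw [this, List.foldr_append, List.foldr_cons, ih]
    have : parseStep Γ'.ket (true, L) = (true, [] :: L) := rfl
    rw [this, hlist, List.append_nil]

theorem sz_parse_le (x : List Γ') : sz (parse x) ≤ 8 * x.length + 5 := by
  have hpair : ∀ p : Bool × List (List Numeral), sz p = sz p.1 + sz p.2 + 1 := fun _ => rfl
  suffices h : sz (parse x).2 ≤ 8 * x.length + 1 by
    have := sz_bool_le (parse x).1
    rw [hpair]; omega
  induction x with
  | nil => simp [parse, sz_nil]
  | cons a x ih =>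
    have hp : parse (a :: x) = parseStep a (parse x) := rfl
    rw [hp, List.length_cons]
    generalize parse x = p at *
    obtain ⟨c, L⟩ := p
    rcases a with _ | b | _ | _ | _
    · simp only [parseStep, symbolData] at ih ⊢
      simp; omega
    · rcases L with _ | ⟨_ | ⟨n, l⟩, L⟩
      · simp [parseStep, symbolData] at ih ⊢; omega
      · simp [parseStep, symbolData] at ih ⊢; omega
      · have := sz_bool_le b
        simp only [parseStep, symbolData, decide_true, List.isEmpty_cons, List.headI_cons,
          Bool.or_self, cond_true, cond_false, List.tail_cons, sz_cons] at ih ⊢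
        omega
    · simp only [parseStep, symbolData] at ih ⊢
      simp; omega
    · simp only [parseStep, symbolData, decide_true, cond_true, OfNat.ofNat_ne_zero, decide_false,
        cond_false, OfNat.ofNat_ne_one, sz_cons, sz_nil] at ih ⊢
      omega
    · rcases L with _ | ⟨l, L⟩
      · simp [parseStep, symbolData] at ih ⊢; omega
      · simp only [parseStep, symbolData, decide_true, cond_true, one_ne_zero, decide_false,
          cond_false, List.isEmpty_cons, List.headI_cons, List.tail_cons, sz_cons, sz_nil] at ih ⊢
        omega

theorem PTime.symbolData {α : Type} [Enc α] {s : α → Prop} {B : α → ℕ} {f : α → Γ'}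
    (hf : PTime s B f) : PTime s B fun x => symbolData (f x) := by
  obtain ⟨h1, h2, h3⟩ := hf
  exact ⟨h1, h2, h3⟩

theorem PolyTime.parse : PolyTime parse := by
  have ha : PolyTime fun p : List Γ' × (Bool × List (List Numeral)) × Γ' => symbolData p.2.2 :=
    PTime.symbolData .proj₂₂
  have hc : PolyTime fun p : List Γ' × (Bool × List (List Numeral)) × Γ' => p.2.1.1 :=
    PTime.fst .proj₂₁
  have hL : PolyTime fun p : List Γ' × (Bool × List (List Numeral)) × Γ' => p.2.1.2 :=
    PTime.snd .proj₂₁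
  have hh := PTime.headI hL
  have ht := PTime.tail hL
  have he : PolyTime fun p : List Γ' × (Bool × List (List Numeral)) × Γ' => (false, p.2.1.2) :=
    (PTime.const .self false).pair hL
  have hn : PolyTime fun _ : List Γ' × (Bool × List (List Numeral)) × Γ' => ([] : Numeral) :=
    .const []
  have hl : PolyTime fun _ : List Γ' × (Bool × List (List Numeral)) × Γ' =>
    ([] : List Numeral) := .const []
  have hstep : PolyTime fun p : List Γ' × (Bool × List (List Numeral)) × Γ' =>
      parseStep p.2.2 p.2.1 :=
    ((PTime.fst ha).eq_nat (.const .self 0)).cond'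
      (((PTime.isEmpty hL).or (PTime.isEmpty hh)).cond' he
        (hc.pair ((((PTime.snd ha).cons (PTime.headI hh)).cons (PTime.tail hh)).cons ht)))
      (((PTime.fst ha).eq_nat (.const .self 1)).cond'
        ((PTime.isEmpty hL).cond' he (hc.pair ((hn.cons hh).cons ht)))
        (((PTime.fst ha).eq_nat (.const .self 2)).cond' (hc.pair (hl.cons hL)) he))
  refine PolyTime.foldr (step := fun _ => parseStep) (l := fun x => x) hstep PolyTime.id
    (PTime.const .self (true, [])) (fun x => 8 * sz x + 5)
    (((PolyBdd.const 8).mul .self).add (.const 5)) fun x _ l₁ l₂ h => ?_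
  have h1 := sz_parse_le l₂
  have h2 := length_lt_sz x
  have h3 : l₂.length ≤ x.length := by
    have := congrArg List.length h
    rw [List.length_append] at this
    omega
  rw [TreeProgram.parse] at h1
  omega

/-- The numeral for the weight. -/
def weightBits (L : List (List Numeral)) : Numeral := L.headI.headI

/-- The variables. -/
def varsOf (L : List (List Numeral)) : List Numeral := L.headI.tail.tail

/-- The scopes of the constraints other than the first one. -/
def scopesOf (L : List (List Numeral)) : List (List Numeral) := L.tail.map List.tail

/-- Whether the lists describe an instance. -/
def isInstance (L : List (List Numeral)) : Bool :=
  L.all (fun l => l.all canonical) && (!(varsOf L).isEmpty &&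
    (decide (L.headI.tail.headI = encodeNat (varsOf L).length) &&
    ((varsOf L).all (fun v => decide ((varsOf L).count v ≤ 1)) &&
    L.tail.all (fun c => !c.tail.isEmpty && (decide (c.headI = encodeNat c.tail.length) &&
      c.tail.all (fun v => decide (v ∈ varsOf L)))))))

/-- For every list, the number of occurrences of `v`. -/
def occList (L : List (List Numeral)) (v : Numeral) : List ℕ :=
  (varsOf L :: scopesOf L).map fun c => c.count v

/-- The maximum number of occurrences of a variable. -/
def maxOcc (L : List (List Numeral)) : ℕ :=
  ((varsOf L).map fun v => (occList L v).sum).foldr max 0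

/-- The maximum number of occurrences of a variable in a single list. -/
def maxMult (L : List (List Numeral)) : ℕ :=
  ((varsOf L).map fun v => (occList L v).foldr max 0).foldr max 0

/-! ### Polynomial time for the recognition of instances and for the parameters -/

section PTime

variable {α : Type} [Enc α] {s : α → Prop} {B : α → ℕ} {f : α → List (List Numeral)}

theorem PTime.varsOf (hf : PTime s B f) : PTime s B fun x => varsOf (f x) := hf.headI.tail.tail

theorem PTime.scopesOf (hf : PTime s B f) : PTime s B fun x => scopesOf (f x) :=
  PolyTime.map (f := fun _ c => List.tail c) (PTime.tail .proj₂) hf.tail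

theorem PTime.isInstance (hf : PTime s B f) : PTime s B fun x => isInstance (f x) := by
  have h : PolyTime TreeProgram.isInstance := by
    have hid : PolyTime fun L : List (List Numeral) => L := PolyTime.id
    have hvars := PTime.varsOf hid
    have hcan : PolyTime fun p : List (List Numeral) × List Numeral =>
        p.2.all TreeProgram.canonical :=
      PolyTime.all (f := fun _ v => TreeProgram.canonical v) (PTime.canonical .proj₂) .proj₂
    have hmem : PolyTime fun p : List (List Numeral) × List Numeral =>
        p.2.tail.all fun v => decide (v ∈ TreeProgram.varsOf p.1) :=
      PolyTime.all (f := fun p v => decide (v ∈ TreeProgram.varsOf p.1))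
        (PTime.mem .proj₂ (PTime.varsOf (PTime.fst .proj₁))) (PTime.tail .proj₂)
    exact (PolyTime.all (f := fun _ l => l.all TreeProgram.canonical) hcan hid).and
      (hvars.isEmpty.not.and ((PTime.eq_numeral (PTime.headI (PTime.tail (PTime.headI hid)))
        hvars.length.encodeNat).and ((PolyTime.all
        (f := fun L v => decide ((TreeProgram.varsOf L).count v ≤ 1))
        (PTime.le (PTime.count .proj₂ (PTime.varsOf .proj₁)) (.const .self 1)) hvars).and
        (PolyTime.all (f := fun L c => !c.tail.isEmpty && (decide (c.headI =
          Computability.encodeNat c.tail.length) &&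
          c.tail.all (fun v => decide (v ∈ TreeProgram.varsOf L))))
        ((PTime.not (PTime.isEmpty (PTime.tail .proj₂))).and ((PTime.eq_numeral
          (PTime.headI .proj₂) (PTime.encodeNat (PTime.length (PTime.tail .proj₂)))).and hmem))
        (PTime.tail hid)))))
  exact PolyTime.comp h hf

theorem PolyTime.occList :
    PolyTime fun p : List (List Numeral) × Numeral => occList p.1 p.2 :=
  PolyTime.map (f := fun p c => List.count p.2 c)
    (PTime.count (PTime.snd .proj₁) .proj₂) ((PTime.varsOf .proj₁).cons (PTime.scopesOf .proj₁))

theorem PTime.maxOcc (hf : PTime s B f) : PTime s B fun x => maxOcc (f x) :=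
  PolyTime.comp (PTime.list_max (PolyTime.map (PTime.list_sum PolyTime.occList)
    (PTime.varsOf PolyTime.id))) hf

theorem PTime.maxMult (hf : PTime s B f) : PTime s B fun x => maxMult (f x) :=
  PolyTime.comp (PTime.list_max (PolyTime.map (PTime.list_max PolyTime.occList)
    (PTime.varsOf PolyTime.id))) hf

end PTime

/-- Whether the string encodes an instance. -/
def isCode (x : List Γ') : Bool := (parse x).1 && isInstance (parse x).2

theorem PolyTime.isCode : PolyTime isCode :=
  (PTime.fst PolyTime.parse).and (PTime.isInstance (PTime.snd PolyTime.parse))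

/-- The numeral for the sum of the weight and of the number `p L`. -/
def paramBits (p : List (List Numeral) → ℕ) (x : List Γ') : Numeral :=
  bif isCode x then inc^[p (parse x).2] (weightBits (parse x).2) else [true]

/-- The weight may be exponential in the input length and is never made unary. Only `p L` is unary,
and it is added by that many increments of the binary weight; `[true]` is the numeral for the
default parameter `1`. -/
theorem PolyTime.paramBits {p : List (List Numeral) → ℕ} (hp : PolyTime p) :
    PolyTime (paramBits p) :=
  PTime.cond' PolyTime.isCode (PTime.iterate_inc (PTime.headI (PTime.headI
    (PTime.snd PolyTime.parse))) (PolyTime.comp hp (PTime.snd PolyTime.parse)))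
    (.const .self [true])

end TreeProgram

/-! ### Instances as lists of numerals -/

namespace TreeProgram

open ParamCSP

theorem card_filter_eq_countP_ofFn {n : ℕ} {β : Type} (f : Fin n → β) (p : β → Prop)
    [DecidablePred p] :
    (Finset.univ.filter fun i => p (f i)).card = (List.ofFn f).countP fun b => decide (p b) := by
  rw [List.ofFn_eq_map, List.countP_map, List.countP_eq_length_filter]
  rfl

theorem sup_toFinset (l : List ℕ) (f : ℕ → ℕ) :
    l.toFinset.sup f = (l.map f).foldr max 0 := by
  induction l with
  | nil => rfl
  | cons a l ih => rw [List.toFinset_cons, Finset.sup_insert, ih]; rfl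

theorem countP_mem_eq_card {l : List ℕ} (hl : l.Nodup) {D : Finset ℕ} (hD : ∀ v ∈ D, v ∈ l) :
    l.countP (fun v => decide (v ∈ D)) = D.card := by
  rw [List.countP_eq_length_filter, ← List.toFinset_card_of_nodup (hl.filter _)]
  congr 1
  ext v
  simp only [List.mem_toFinset, List.mem_filter, decide_eq_true_eq]
  exact ⟨fun h => h.2, fun h => ⟨hD v h, h⟩⟩

/-- The assignment with the list `D` of variables satisfies all constraints. -/
def ListSat (E : Set ℕ) (L : List (List Numeral)) : Prop :=
  ∃ D : List Numeral, D.Nodup ∧ (∀ v ∈ D, v ∈ varsOf L) ∧ D.length = bitsVal (weightBits L) ∧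
    ∀ c ∈ scopesOf L, c.countP (fun v => decide (v ∈ D)) ∈ E

/-! ### Correspondence between instances and lists of numerals -/

section Instance

variable {E : Set ℕ}

/-- The lists of numerals in the code of an instance. -/
def lists (I : Instance (W E)) : List (List Numeral) :=
  ((I.k₀ :: I.first.code) :: I.rest.map Constraint.code).map (List.map encodeNat)

/-- The variables of an instance. -/
def vars (I : Instance (W E)) : List ℕ := List.ofFn I.first.scope

theorem encode_eq_unparse (I : Instance (W E)) : I.encode = unparse (lists I) :=
  encodeLists_eq _

theorem lists_eq (I : Instance (W E)) :
    lists I = (encodeNat I.k₀ :: encodeNat I.first.index :: (vars I).map encodeNat) ::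
      I.rest.map fun c => encodeNat c.index :: (List.ofFn c.scope).map encodeNat := by
  simp [lists, vars, Constraint.code, Function.comp_def]

theorem varsOf_lists (I : Instance (W E)) : varsOf (lists I) = (vars I).map encodeNat := by
  rw [lists_eq]; rfl

theorem weightBits_lists (I : Instance (W E)) : weightBits (lists I) = encodeNat I.k₀ := rfl

theorem scopesOf_lists (I : Instance (W E)) :
    scopesOf (lists I) = I.rest.map fun c => (List.ofFn c.scope).map encodeNat := by
  rw [lists_eq, scopesOf, List.tail_cons, List.map_map]
  rfl

theorem length_vars (I : Instance (W E)) : (vars I).length = I.first.index := List.length_ofFn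

theorem mem_vars {I : Instance (W E)} {v : ℕ} : v ∈ vars I ↔ v ∈ I.V := by
  rw [vars, List.mem_ofFn, ← Finset.mem_coe, ← I.first_range]
  rfl

theorem toFinset_vars (I : Instance (W E)) : (vars I).toFinset = I.V := by
  ext v
  rw [List.mem_toFinset, mem_vars]

/-- The first scope has length `|V|` and its entries exhaust `V`, which leaves no room for
repetitions. -/
theorem nodup_vars (I : Instance (W E)) : (vars I).Nodup := by
  rw [← Multiset.coe_nodup, ← Multiset.toFinset_card_eq_card_iff_nodup]
  have h : (vars I).toFinset.card = (vars I).length := by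
    rw [toFinset_vars, length_vars, I.first_index]
  exact h

theorem isInstance_lists (I : Instance (W E)) : isInstance (lists I) = true := by
  have h1 : (lists I).all (fun l => l.all canonical) = true := by
    simp only [lists, List.all_map, List.all_eq_true, Function.comp]
    intro l _ n _
    exact canonical_encodeNat n
  have h2 : (!(varsOf (lists I)).isEmpty) = true := by
    have hlen := length_vars I
    have := I.first.index.pos
    rw [varsOf_lists]
    cases h : vars I with
    | nil => rw [h] at hlen; simp at hlen; omega
    | cons => rfl
  have h3 : (lists I).headI.tail.headI = encodeNat (varsOf (lists I)).length := by
    rw [varsOf_lists, List.length_map, length_vars, lists_eq]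
    rfl
  have h4 : (varsOf (lists I)).all (fun v => decide ((varsOf (lists I)).count v ≤ 1)) = true := by
    rw [List.all_eq_true]
    intro v _
    rw [decide_eq_true_eq, varsOf_lists]
    exact List.nodup_iff_count_le_one.1 ((nodup_vars I).map encodeNat_injective) v
  have h5 : (lists I).tail.all (fun c => !c.tail.isEmpty &&
      (decide (c.headI = encodeNat c.tail.length) &&
      c.tail.all (fun v => decide (v ∈ varsOf (lists I))))) = true := by
    rw [List.all_eq_true]
    intro l hl
    rw [lists_eq, List.tail_cons, List.mem_map] at hl
    obtain ⟨c, hc, rfl⟩ := hl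
    have hlen : (List.ofFn c.scope).length = c.index := List.length_ofFn
    rw [Bool.and_eq_true, Bool.and_eq_true, List.tail_cons, List.headI_cons, List.length_map, hlen,
      List.all_eq_true, varsOf_lists]
    refine ⟨?_, by simp, ?_⟩
    · have := c.index.pos
      cases h : List.ofFn c.scope with
      | nil => rw [h] at hlen; simp at hlen; omega
      | cons => rfl
    · intro v hv
      obtain ⟨n, hn, rfl⟩ := List.mem_map.1 hv
      obtain ⟨i, rfl⟩ := List.mem_ofFn.1 hn
      rw [decide_eq_true_eq]
      exact List.mem_map_of_mem (mem_vars.2 (I.rest_mem c hc i))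
  rw [isInstance, h1, h2, h4, h5, decide_eq_true h3]
  rfl

/-- The constraint of the language `W^A` with a given nonempty list of variables. -/
def constraintOf (A : Set ℕ) (l : List ℕ) (hl : l ≠ []) : Constraint (W A) where
  index := ⟨l.length, List.length_pos_iff.2 hl⟩
  scope := l.get

theorem code_constraintOf (A : Set ℕ) (l : List ℕ) (hl : l ≠ []) :
    (constraintOf A l hl).code = l.length :: l := by
  change l.length :: List.ofFn l.get = _
  rw [List.ofFn_get]

theorem exists_instance {k : ℕ} {vs : List ℕ} {cs : List (List ℕ)} (hne : vs ≠ [])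
    (hvs : vs.Nodup) (hcs : ∀ c ∈ cs, c ≠ [] ∧ ∀ v ∈ c, v ∈ vs) :
    ∃ I : Instance (W E), I.k₀ = k ∧ I.first.code = vs.length :: vs ∧
      I.rest.map Constraint.code = cs.map fun c => c.length :: c := by
  refine ⟨⟨vs.toFinset, k, constraintOf {k} vs hne, (List.toFinset_card_of_nodup hvs).symm, ?_,
    cs.attach.map fun c => constraintOf E c.1 (hcs c.1 c.2).1, ?_⟩, rfl,
    code_constraintOf _ vs hne, ?_⟩
  · ext v
    change v ∈ Set.range vs.get ↔ _
    rw [Set.range_list_get]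
    simp
  · intro c hc i
    obtain ⟨⟨l, hl⟩, -, rfl⟩ := List.mem_map.1 hc
    rw [List.mem_toFinset]
    exact (hcs l hl).2 _ (List.get_mem l i)
  · rw [List.map_map]
    have : (Constraint.code ∘ fun c : {x // x ∈ cs} => constraintOf E c.1 (hcs c.1 c.2).1) =
        (fun c : List ℕ => c.length :: c) ∘ Subtype.val := by
      funext c
      exact code_constraintOf _ _ _
    rw [this, ← List.map_map, List.attach_map_subtype_val]

/-- On canonical numerals `bitsVal` is inverse to `encodeNat`, hence injective; so distinct numerals
denote distinct variables, and decoding followed by encoding returns the given lists. -/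
theorem exists_lists_eq {L : List (List Numeral)} (hL : isInstance L = true) :
    ∃ I : Instance (W E), lists I = L := by
  simp only [isInstance, Bool.and_eq_true, List.all_eq_true, decide_eq_true_eq,
    Bool.not_eq_true', List.isEmpty_eq_false_iff] at hL
  obtain ⟨hcan, hne, hlen, hnd, hrest⟩ := hL
  have hmap : ∀ l ∈ L, (l.map bitsVal).map encodeNat = l := by
    intro l hl
    rw [List.map_map]
    conv_rhs => rw [← List.map_id l]
    exact List.map_congr_left fun v hv => encodeNat_bitsVal (hcan l hl v hv)
  obtain _ | ⟨_ | ⟨k, _ | ⟨m, vs⟩⟩, rest⟩ := L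
  · exact absurd rfl hne
  · exact absurd rfl hne
  · exact absurd rfl hne
  simp only [varsOf, List.headI_cons, List.tail_cons] at hne hlen hnd hrest
  have hinj : ∀ v ∈ vs, ∀ w ∈ vs, bitsVal v = bitsVal w → v = w := by
    intro v hv w hw h
    have h1 := encodeNat_bitsVal (hcan _ List.mem_cons_self v (by simp [hv]))
    have h2 := encodeNat_bitsVal (hcan _ List.mem_cons_self w (by simp [hw]))
    rw [← h1, h, h2]
  have hvs : vs.Nodup := by
    rw [List.nodup_iff_count_le_one]
    intro v
    by_cases hv : v ∈ vs
    · exact hnd v hv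
    · rw [List.count_eq_zero_of_not_mem hv]; omega
  obtain ⟨I, hk, hfirst, hcode⟩ := exists_instance (E := E) (k := bitsVal k)
    (vs := vs.map bitsVal) (cs := rest.map fun c => c.tail.map bitsVal)
    (by simpa using hne) (hvs.map_on fun v hv w hw h => hinj v hv w hw h) (by
      intro c hc
      obtain ⟨c', hc', rfl⟩ := List.mem_map.1 hc
      obtain ⟨h1, -, h3⟩ := hrest c' hc'
      refine ⟨by rwa [Ne, List.map_eq_nil_iff], fun v hv => ?_⟩
      obtain ⟨w, hw, rfl⟩ := List.mem_map.1 hv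
      exact List.mem_map_of_mem (h3 w hw))
  refine ⟨I, ?_⟩
  rw [lists, hfirst, hcode, List.length_map, List.map_cons, List.map_map, List.map_map]
  have h0 := hmap _ List.mem_cons_self
  simp only [List.map_cons, List.cons.injEq] at h0
  refine List.cons_eq_cons.2 ⟨?_, ?_⟩
  · rw [List.map_cons, List.map_cons, hk, h0.1, h0.2.2, hlen]
  · conv_rhs => rw [← List.map_id rest]
    refine List.map_congr_left fun c hc => ?_
    obtain ⟨h1, h2, -⟩ := hrest c hc
    have h3 := hmap c (List.mem_cons_of_mem _ hc)
    obtain _ | ⟨i, c⟩ := c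
    · exact absurd rfl h1
    simp only [List.map_cons, List.cons.injEq, List.headI_cons, List.tail_cons] at h2 h3
    simp only [Function.comp, List.tail_cons, List.length_map, List.map_cons, h3.2, id, ← h2]

theorem occ_eq_count {A : Set ℕ} (c : Constraint (W A)) (v : ℕ) :
    c.occ v = ((List.ofFn c.scope).map encodeNat).count (encodeNat v) := by
  rw [List.count_map_of_injective _ _ encodeNat_injective, Constraint.occ,
    card_filter_eq_countP_ofFn c.scope (fun u => u = v), List.count]
  congr 1

theorem occs_eq (I : Instance (W E)) (v : ℕ) : I.occs v = occList (lists I) (encodeNat v) := by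
  rw [Instance.occs, occList, varsOf_lists, scopesOf_lists, List.map_cons, List.map_map,
    occ_eq_count]
  congr 1
  exact List.map_congr_left fun c _ => occ_eq_count c v

theorem t_eq_maxOcc (I : Instance (W E)) : I.t = maxOcc (lists I) := by
  rw [Instance.t, maxOcc, varsOf_lists, ← toFinset_vars, sup_toFinset, List.map_map]
  congr 1
  exact List.map_congr_left fun v _ => by rw [occs_eq]; rfl

theorem e_eq_maxMult (I : Instance (W E)) : I.e = maxMult (lists I) := by
  rw [Instance.e, maxMult, varsOf_lists, ← toFinset_vars, sup_toFinset, List.map_map]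
  congr 1
  exact List.map_congr_left fun v _ => by rw [occs_eq]; rfl

theorem satisfiedBy_iff {A : Set ℕ} (c : Constraint (W A)) (D : Finset ℕ) :
    c.SatisfiedBy D ↔ (List.ofFn c.scope).countP (fun v => decide (v ∈ D)) ∈ A := by
  rw [← card_filter_eq_countP_ofFn c.scope (fun v => v ∈ D)]
  rfl

/-- Every variable occurs exactly once in the first scope, so the weight constraint says `D.card =
I.k₀`. Sets of variables and duplicate-free lists of numerals correspond to each other through
`encodeNat` and `bitsVal`. -/
theorem satisfiable_iff (I : Instance (W E)) : I.Satisfiable ↔ ListSat E (lists I) := by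
  have hfirst : ∀ D ⊆ I.V, (I.first.SatisfiedBy D ↔ D.card = I.k₀) := by
    intro D hD
    have h : (List.ofFn I.first.scope).countP (fun v => decide (v ∈ D)) = D.card :=
      countP_mem_eq_card (nodup_vars I) fun v hv => mem_vars.2 (hD hv)
    rw [satisfiedBy_iff, Set.mem_singleton_iff, h]
  have hrest : ∀ (D : Finset ℕ) (D' : List Numeral), (∀ v, encodeNat v ∈ D' ↔ v ∈ D) →
      ((∀ c ∈ I.rest, c.SatisfiedBy D) ↔
        ∀ c ∈ scopesOf (lists I), c.countP (fun v => decide (v ∈ D')) ∈ E) := by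
    intro D D' hDD
    rw [scopesOf_lists, List.forall_mem_map]
    refine forall₂_congr fun c _ => ?_
    rw [satisfiedBy_iff, List.countP_map]
    simp only [Function.comp_def, hDD]
  rw [ListSat, weightBits_lists, bitsVal_encodeNat]
  constructor
  · rintro ⟨D, hD, hf, hr⟩
    have hDD : ∀ v, encodeNat v ∈ D.toList.map encodeNat ↔ v ∈ D := fun v => by
      rw [List.mem_map_of_injective encodeNat_injective, Finset.mem_toList]
    refine ⟨D.toList.map encodeNat, D.nodup_toList.map encodeNat_injective, ?_, ?_,
      (hrest D _ hDD).1 hr⟩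
    · intro v hv
      obtain ⟨n, hn, rfl⟩ := List.mem_map.1 hv
      rw [varsOf_lists]
      exact List.mem_map_of_mem (mem_vars.2 (hD (Finset.mem_toList.1 hn)))
    · rw [List.length_map, Finset.length_toList]
      exact (hfirst D hD).1 hf
  · rintro ⟨D', hnd, hsub, hlen, hr⟩
    rw [varsOf_lists] at hsub
    have hinv : ∀ v ∈ D', bitsVal v ∈ vars I ∧ encodeNat (bitsVal v) = v := by
      intro v hv
      obtain ⟨n, hn, rfl⟩ := List.mem_map.1 (hsub v hv)
      rw [bitsVal_encodeNat]
      exact ⟨hn, rfl⟩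
    have hDD : ∀ v, encodeNat v ∈ D' ↔ v ∈ (D'.map bitsVal).toFinset := by
      intro v
      rw [List.mem_toFinset, List.mem_map]
      constructor
      · exact fun h => ⟨_, h, bitsVal_encodeNat v⟩
      · rintro ⟨w, hw, rfl⟩
        rw [(hinv w hw).2]
        exact hw
    have hD : (D'.map bitsVal).toFinset ⊆ I.V := by
      intro v hv
      rw [List.mem_toFinset, List.mem_map] at hv
      obtain ⟨w, hw, rfl⟩ := hv
      exact mem_vars.1 (hinv w hw).1
    refine ⟨_, hD, (hfirst _ hD).2 ?_, (hrest _ D' hDD).2 hr⟩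
    rw [List.toFinset_card_of_nodup, List.length_map, hlen]
    exact hnd.map_on fun v hv w hw h => by rw [← (hinv v hv).2, h, (hinv w hw).2]

theorem isCode_encode (I : Instance (W E)) :
    isCode I.encode = true ∧ (parse I.encode).2 = lists I := by
  rw [isCode, encode_eq_unparse, parse_unparse]
  exact ⟨isInstance_lists I, rfl⟩

theorem exists_encode_eq {x : List Γ'} (hx : isCode x = true) :
    ∃ I : Instance (W E), I.encode = x ∧ (parse x).2 = lists I := by
  rw [isCode, Bool.and_eq_true] at hx
  obtain ⟨I, hI⟩ := exists_lists_eq (E := E) hx.2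
  exact ⟨I, by rw [encode_eq_unparse, hI, unparse_parse x hx.1], hI.symm⟩

theorem mem_yes_iff (param : Instance (W E) → ℕ) (x : List Γ') :
    x ∈ (CSP (W E) param).yes ↔ isCode x = true ∧ ListSat E (parse x).2 := by
  constructor
  · rintro ⟨I, rfl, hI⟩
    obtain ⟨h1, h2⟩ := isCode_encode I
    exact ⟨h1, h2 ▸ (satisfiable_iff I).1 hI⟩
  · rintro ⟨h1, h2⟩
    obtain ⟨I, hI, hL⟩ := exists_encode_eq (E := E) h1
    exact ⟨I, hI, (satisfiable_iff I).2 (hL ▸ h2)⟩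

/-- The parameter of a string, in terms of its lists of numerals. -/
theorem κ_eq (param : Instance (W E) → ℕ) (p : List (List Numeral) → ℕ)
    (hp : ∀ I, param I = I.k₀ + p (lists I)) (x : List Γ') :
    (CSP (W E) param).κ x =
      if isCode x = true then bitsVal (weightBits (parse x).2) + p (parse x).2 else 1 := by
  split_ifs with hx
  · obtain ⟨I, rfl, hL⟩ := exists_encode_eq (E := E) hx
    rw [CSP_κ_encode, hp, hL, weightBits_lists, bitsVal_encodeNat]
  · refine Function.extend_apply' (f := Instance.encode) param (fun _ => 1) x ?_
    rintro ⟨I, rfl⟩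
    exact hx (isCode_encode I).1

theorem paramBits_eq (param : Instance (W E) → ℕ) (p : List (List Numeral) → ℕ)
    (hp : ∀ I, param I = I.k₀ + p (lists I)) (x : List Γ') :
    paramBits p x = encodeNat ((CSP (W E) param).κ x) := by
  rw [κ_eq param p hp]
  split_ifs with hx
  · obtain ⟨I, rfl, hL⟩ := exists_encode_eq (E := E) hx
    rw [paramBits, hx, cond_true, hL, weightBits_lists, iterate_inc, bitsVal_encodeNat]
  · rw [paramBits, Bool.eq_false_iff.2 hx]
    rfl

end Instance

end TreeProgram

/-! ### Representative assignments -/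

namespace TreeProgram

open ParamCSP

/-- A weight, the variables and the scopes of the constraints. -/
abbrev Problem : Type := ℕ × List Numeral × List (List Numeral)

/-- The number of positions of the scope `c` whose variables belong to `D`. -/
def hits (c D : List Numeral) : ℕ := (c.filter fun v => decide (v ∈ D)).length

/-- For every scope, the number of positions whose variables belong to `D`. -/
def profile (q : Problem) (D : List Numeral) : List ℕ := (q.2.1 :: q.2.2).map fun c => hits c D

/-- Adds the assignment `D` if it is small enough and its profile is new. -/
def addSet (q : Problem) (R : List (List Numeral)) (D : List Numeral) : List (List Numeral) :=
  bif decide (D.length ≤ q.1) && !(R.any fun D' => decide (profile q D' = profile q D)) then D :: R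
  else R

/-- Adds the assignments with the additional variable `v`. -/
def extend (q : Problem) (R : List (List Numeral)) (v : Numeral) : List (List Numeral) :=
  R.foldl (fun R' D => addSet q R' (v :: D)) R

/-- Representatives for the profiles of all small assignments to the variables in `l`. -/
def reps (q : Problem) (l : List Numeral) : List (List Numeral) := l.foldl (extend q) [[]]

/-- The maximum number of occurrences of a variable. -/
def Problem.maxOcc (q : Problem) : ℕ :=
  (q.2.1.map fun v => ((q.2.1 :: q.2.2).map fun c => c.count v).sum).foldr max 0

/-- Distinct profiles, of small assignments to the variables in `l`. -/
structure Good (q : Problem) (l : List Numeral) (R : List (List Numeral)) : Prop where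
  nodup : ∀ D ∈ R, D.Nodup
  subset : ∀ D ∈ R, D ⊆ l
  length_le : ∀ D ∈ R, D.length ≤ q.1
  profiles : (R.map (profile q)).Nodup

theorem hits_nil (c : List Numeral) : hits c [] = 0 := by simp [hits]

/-- The increment depends on `v` and `c` but not on `D`. Hence the profile after adding a new
variable is determined by the profile before, which makes the dynamic program work. -/
theorem hits_cons {v : Numeral} {D : List Numeral} (h : v ∉ D) (c : List Numeral) :
    hits c (v :: D) = hits c D + c.count v := by
  induction c with
  | nil => rfl
  | cons u c ih =>
    simp only [hits, List.filter_cons, List.count_cons] at ih ⊢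
    by_cases hu : u = v
    · subst hu
      simp [h] at ih ⊢
      omega
    · by_cases huD : u ∈ D
      · simp [hu, huD] at ih ⊢
        omega
      · simp [hu, huD] at ih ⊢
        omega

theorem hits_congr {D D' : List Numeral} (h : ∀ v, v ∈ D ↔ v ∈ D') (c : List Numeral) :
    hits c D = hits c D' := by
  simp only [hits, h]

/-- The entry of a profile for the list of all variables is the weight, so equal profiles imply
equal weights. -/
theorem hits_eq_length {vs D : List Numeral} (hvs : vs.Nodup) (hD : D.Nodup) (h : D ⊆ vs) :
    hits vs D = D.length := by
  refine List.Perm.length_eq ((List.perm_ext_iff_of_nodup (hvs.filter _) hD).2 fun v => ?_)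
  rw [List.mem_filter, decide_eq_true_iff]
  exact ⟨fun h => h.2, fun hv => ⟨h hv, hv⟩⟩

theorem Good.mono {q : Problem} {l l' : List Numeral} {R : List (List Numeral)}
    (h : Good q l R) (hl : l ⊆ l') : Good q l' R :=
  ⟨h.nodup, fun D hD => List.Subset.trans (h.subset D hD) hl, h.length_le, h.profiles⟩

theorem subset_addSet (q : Problem) (R : List (List Numeral)) (D : List Numeral) :
    R ⊆ addSet q R D := by
  rw [addSet]
  cases decide (D.length ≤ q.1) && !(R.any fun D' => decide (profile q D' = profile q D))
  · exact List.Subset.refl _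
  · exact List.subset_cons_self _ _

theorem Good.addSet {q : Problem} {l D : List Numeral} {R : List (List Numeral)}
    (h : Good q l R) (hD : D.Nodup) (hl : D ⊆ l) : Good q l (addSet q R D) := by
  rw [TreeProgram.addSet]
  cases hc : decide (D.length ≤ q.1) && !(R.any fun D' => decide (profile q D' = profile q D))
  · exact h
  · rw [Bool.and_eq_true, decide_eq_true_iff, Bool.not_eq_true', List.any_eq_false] at hc
    obtain ⟨hlen, hnew⟩ := hc
    refine ⟨List.forall_mem_cons.2 ⟨hD, h.nodup⟩, List.forall_mem_cons.2 ⟨hl, h.subset⟩,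
      List.forall_mem_cons.2 ⟨hlen, h.length_le⟩, ?_⟩
    rw [cond_true, List.map_cons, List.nodup_cons]
    refine ⟨fun hmem => ?_, h.profiles⟩
    obtain ⟨D', hD', he⟩ := List.mem_map.1 hmem
    exact hnew D' hD' (decide_eq_true he)

theorem exists_mem_addSet {q : Problem} {R : List (List Numeral)} {D : List Numeral}
    (hD : D.length ≤ q.1) : ∃ D' ∈ addSet q R D, profile q D' = profile q D := by
  rw [addSet, decide_eq_true hD, Bool.true_and]
  cases hc : R.any fun D' => decide (profile q D' = profile q D)
  · exact ⟨D, List.mem_cons_self, rfl⟩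
  · obtain ⟨D', hD', he⟩ := List.any_eq_true.1 hc
    exact ⟨D', hD', of_decide_eq_true he⟩

theorem Good.foldl {q : Problem} {l : List Numeral} {v : Numeral} (R' : List (List Numeral)) :
    ∀ {R}, Good q l R → (∀ D ∈ R', (v :: D).Nodup ∧ v :: D ⊆ l) →
      Good q l (R'.foldl (fun R D => TreeProgram.addSet q R (v :: D)) R) ∧
      R ⊆ R'.foldl (fun R D => TreeProgram.addSet q R (v :: D)) R ∧
      ∀ D ∈ R', (v :: D).length ≤ q.1 →
        ∃ D' ∈ R'.foldl (fun R D => TreeProgram.addSet q R (v :: D)) R, profile q D' = profile q (v :: D) := by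
  induction R' with
  | nil => exact fun h _ => ⟨h, List.Subset.refl _, fun _ hD => by simp at hD⟩
  | cons D₀ R' ih =>
    intro R h hR'
    obtain ⟨h0, hR'⟩ := List.forall_mem_cons.1 hR'
    obtain ⟨h1, h2, h3⟩ := ih (h.addSet h0.1 h0.2) hR'
    refine ⟨h1, List.Subset.trans (subset_addSet q R _) h2, ?_⟩
    intro D hD hlen
    rcases List.mem_cons.1 hD with rfl | hD
    · obtain ⟨D', hD', he⟩ := exists_mem_addSet (R := R) hlen
      exact ⟨D', h2 hD', he⟩
    · exact h3 D hD hlen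

theorem Good.cons_mem {q : Problem} {l : List Numeral} {v : Numeral} {R : List (List Numeral)}
    (h : Good q l R) (hv : v ∉ l) : ∀ D ∈ R, (v :: D).Nodup ∧ v :: D ⊆ l ++ [v] := fun D hD => by
  refine ⟨List.nodup_cons.2 ⟨fun hvD => hv (h.subset D hD hvD), h.nodup D hD⟩, ?_⟩
  refine List.cons_subset.2 ⟨by simp, ?_⟩
  exact List.Subset.trans (h.subset D hD) (List.subset_append_left _ _)

/-- Induction on the prefix of variables processed. If `v ∉ D`, the old representative is still
present. If `v ∈ D`, take the representative `D'` of `D.erase v`: adding `v` changes both profiles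
by the same vector, so `v :: D'`, or an assignment kept in its place, represents `D`. -/
theorem reps_spec {q : Problem} (hq : q.2.1.Nodup) (l : List Numeral) : l <+: q.2.1 →
    Good q l (reps q l) ∧ ∀ D : List Numeral, D.Nodup → D ⊆ l → D.length ≤ q.1 →
      ∃ D' ∈ reps q l, profile q D' = profile q D := by
  induction l using List.reverseRecOn with
  | nil =>
    refine fun _ => ⟨⟨?_, ?_, ?_, ?_⟩, ?_⟩
    · simp [reps]
    · simp [reps]
    · simp [reps]
    · simp [reps]
    · intro D _ hD _
      rw [List.subset_nil.1 hD]
      exact ⟨[], by simp [reps], rfl⟩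
  | append_singleton l v ih =>
    intro hpre
    obtain ⟨hgood, hcomplete⟩ := ih ((List.prefix_append l [v]).trans hpre)
    have hnd : (l ++ [v]).Nodup := hq.sublist hpre.sublist
    have hv : v ∉ l := fun h => by
      rw [List.nodup_append] at hnd
      exact hnd.2.2 v h v (by simp) rfl
    have hlsub : l ⊆ q.2.1 := ((List.prefix_append l [v]).trans hpre).subset
    have hreps : reps q (l ++ [v]) = extend q (reps q l) v := by simp [reps]
    obtain ⟨h1, h2, h3⟩ := (hgood.mono (List.subset_append_left l [v])).foldl (reps q l)
      (hgood.cons_mem hv)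
    rw [hreps]
    refine ⟨h1, fun D hD hDl hlen => ?_⟩
    by_cases hvD : v ∈ D
    · have hperm := List.perm_cons_erase hvD
      have hDe : (D.erase v).Nodup := hD.erase v
      have hsub : D.erase v ⊆ l := fun u hu => by
        have hu' := (hD.mem_erase_iff).1 hu
        have := hDl hu'.2
        simp only [List.mem_append, List.mem_singleton] at this
        exact this.resolve_right hu'.1
      have hlen' := hperm.length_eq
      rw [List.length_cons] at hlen'
      obtain ⟨D', hD', he⟩ := hcomplete _ hDe hsub (by omega)
      rw [profile, profile, List.map_inj_left] at he
      have hvD' : v ∉ D' := fun h => hv (hgood.subset D' hD' h)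
      have hvE : v ∉ D.erase v := fun h => ((hD.mem_erase_iff).1 h).1 rfl
      -- Comparing the first entries of the profiles gives equal weights, so `v :: D'` is not
      -- rejected for its length.
      have hlenD' : D'.length = (D.erase v).length := by
        have := he q.2.1 List.mem_cons_self
        rwa [hits_eq_length hq (hgood.nodup D' hD') (List.Subset.trans (hgood.subset D' hD') hlsub),
          hits_eq_length hq hDe (List.Subset.trans hsub hlsub)] at this
      obtain ⟨D'', hD'', he'⟩ := h3 D' hD' (by rw [List.length_cons]; omega)
      refine ⟨D'', hD'', he'.trans ?_⟩
      rw [profile, profile, List.map_inj_left]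
      intro c hc
      rw [hits_cons hvD', he c hc, ← hits_cons hvE]
      exact hits_congr (fun u => hperm.mem_iff.symm) c
    · obtain ⟨D', hD', he⟩ := hcomplete D hD (fun u hu => by
        have := hDl hu
        simp only [List.mem_append, List.mem_singleton] at this
        exact this.resolve_right fun h => hvD (h ▸ hu)) hlen
      exact ⟨D', h2 hD', he⟩

/-! ### Counting positions and profiles -/

theorem sum_hits {D : List Numeral} (hD : D.Nodup) (C : List (List Numeral)) :
    (C.map fun c => hits c D).sum = (D.map fun v => (C.map fun c => c.count v).sum).sum := by
  induction D with
  | nil => simp [hits_nil]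
  | cons v D ih =>
    rw [List.nodup_cons] at hD
    simp only [hits_cons hD.1, List.sum_map_add, ih hD.2, List.map_cons, List.sum_cons]
    exact Nat.add_comm _ _

theorem le_foldr_max {l : List ℕ} {a : ℕ} (h : a ∈ l) : a ≤ l.foldr max 0 := by
  induction l with
  | nil => simp at h
  | cons b l ih =>
    rw [List.foldr_cons]
    rcases List.mem_cons.1 h with rfl | h
    · exact le_max_left _ _
    · exact (ih h).trans (le_max_right _ _)

/-- Double counting: the occupied positions, summed over the constraints, are the occurrences summed
over the variables in `D`, and each variable has at most `q.maxOcc` of them. -/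
theorem sum_hits_le {q : Problem} {D : List Numeral} (hD : D.Nodup) (hsub : D ⊆ q.2.1) :
    ((q.2.1 :: q.2.2).map fun c => hits c D).sum ≤ D.length * q.maxOcc := by
  rw [sum_hits hD, ← smul_eq_mul, ← List.length_map (f := fun v =>
    ((q.2.1 :: q.2.2).map fun c => c.count v).sum)]
  refine List.sum_le_card_nsmul _ _ fun n hn => ?_
  obtain ⟨v, hv, rfl⟩ := List.mem_map.1 hn
  exact le_foldr_max (List.mem_map_of_mem (f := fun v =>
    ((q.2.1 :: q.2.2).map fun c => c.count v).sum) (hsub hv))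

theorem hits_le {q : Problem} {D c : List Numeral} (hD : D.Nodup) (hsub : D ⊆ q.2.1)
    (hc : c ∈ q.2.1 :: q.2.2) (hlen : D.length ≤ q.1) : hits c D ≤ q.1 * q.maxOcc :=
  (List.single_le_sum (fun _ _ => Nat.zero_le _) _ (List.mem_map_of_mem hc)).trans
    ((sum_hits_le hD hsub).trans (Nat.mul_le_mul_right _ hlen))

theorem length_le_pow {b n : ℕ} {P : List (List ℕ)} (hP : P.Nodup)
    (hlen : ∀ p ∈ P, p.length = n) (hb : ∀ p ∈ P, ∀ a ∈ p, a < b) : P.length ≤ b ^ n := by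
  have hsub : P ⊆ (List.replicate n (List.range b)).sections := by
    intro p hp
    rw [List.mem_sections, List.forall₂_iff_get]
    refine ⟨by rw [hlen p hp, List.length_replicate], fun i h1 h2 => ?_⟩
    simp only [List.get_eq_getElem, List.getElem_replicate, List.mem_range]
    exact hb p hp _ (List.getElem_mem _)
  have h := (hP.subperm hsub).length_le
  have hcard : ∀ n, (List.replicate n (List.range b)).sections.length = b ^ n := by
    intro n
    induction n with
    | zero => rfl
    | succ n ih =>
      rw [List.replicate_succ, List.sections, List.length_flatMap]
      simp [ih, pow_succ]
  rwa [hcard] at h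

/-- The bound for the number of profiles. -/
def Problem.numProfiles (q : Problem) : ℕ := (q.1 * q.maxOcc + 1) ^ (q.1 * q.maxOcc + 1)

/-- The profiles are distinct vectors with entries at most `q.1 * q.maxOcc`. Their length is the
number of scopes plus one for the weight, so base and exponent are both bounded by `q.1 * q.maxOcc +
1`. -/
theorem Good.card_le {q : Problem} {R : List (List Numeral)} (h : Good q q.2.1 R)
    (hq : q.2.2.length ≤ q.1 * q.maxOcc) : R.length ≤ q.numProfiles := by
  rw [← List.length_map (f := profile q)]
  refine (length_le_pow (b := q.1 * q.maxOcc + 1) (n := q.2.2.length + 1) h.profiles ?_ ?_).trans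
    (Nat.pow_le_pow_right (by omega) (by omega))
  · intro p hp
    obtain ⟨D, -, rfl⟩ := List.mem_map.1 hp
    simp [profile]
  · intro p hp a ha
    obtain ⟨D, hD, rfl⟩ := List.mem_map.1 hp
    obtain ⟨c, hc, rfl⟩ := List.mem_map.1 ha
    exact Nat.lt_succ_of_le (hits_le (h.nodup D hD) (h.subset D hD) hc (h.length_le D hD))

/-- Whether some assignment of weight `q.1` satisfies all the constraints. -/
def accepts (χ : ℕ → Bool) (q : Problem) : Bool :=
  !((reps q q.2.1).map fun D => !(decide (D.length = q.1) &&
    (q.2.2.map fun c => χ (hits c D)).all fun b => b)).all fun b => b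

/-- A solution may be replaced by its representative: the equal profile guarantees the same weight
and the same number of occupied positions in every scope, and nothing else is tested. -/
theorem accepts_iff (χ : ℕ → Bool) {q : Problem} (hq : q.2.1.Nodup) :
    accepts χ q = true ↔ ∃ D : List Numeral, D.Nodup ∧ D ⊆ q.2.1 ∧ D.length = q.1 ∧
      ∀ c ∈ q.2.2, χ (hits c D) = true := by
  obtain ⟨hgood, hcomplete⟩ := reps_spec hq q.2.1 List.prefix_rfl
  have hacc : accepts χ q = true ↔ ∃ D ∈ reps q q.2.1, D.length = q.1 ∧
      ∀ c ∈ q.2.2, χ (hits c D) = true := by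
    rw [accepts, List.all_map, List.not_all_eq_any_not, List.any_eq_true]
    simp [Function.comp_def, List.all_map]
  rw [hacc]
  constructor
  · rintro ⟨D, hD, hlen, hc⟩
    exact ⟨D, hgood.nodup D hD, hgood.subset D hD, hlen, hc⟩
  · rintro ⟨D, hD, hsub, hlen, hc⟩
    obtain ⟨D', hD', he⟩ := hcomplete D hD hsub hlen.le
    rw [profile, profile, List.map_inj_left] at he
    refine ⟨D', hD', ?_, fun c hcq => ?_⟩
    · have := he q.2.1 List.mem_cons_self
      rwa [hits_eq_length hq (hgood.nodup D' hD') (hgood.subset D' hD'),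
        hits_eq_length hq hD hsub, hlen] at this
    · rw [he c (List.mem_cons_of_mem _ hcq)]
      exact hc c hcq

/-! ### The time bound for the search -/

/-- The variables are distinct, and there are not too many constraints. -/
def Problem.Small (q : Problem) : Prop := q.2.1.Nodup ∧ q.2.2.length ≤ q.1 * q.maxOcc

theorem sz_problem (q : Problem) : sz q = sz q.1 + (sz q.2.1 + sz q.2.2 + 1) + 1 := rfl

/-- This bounds the accumulator at every moment of the search: few profiles, and each assignment is
a duplicate-free list of variables of the problem. -/
theorem Good.sz_le {q : Problem} {l : List Numeral} {R : List (List Numeral)} (h : Good q l R)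
    (hl : l ⊆ q.2.1) (hq : q.Small) :
    sz R ≤ q.numProfiles * (sz q * (sz q + 1) + 2) + 1 := by
  have h := h.mono hl
  have hvs : sz q.2.1 ≤ sz q := by rw [sz_problem]; omega
  refine (sz_list_le (M := sz q * (sz q + 1) + 1) fun D hD => ?_).trans
    (Nat.add_le_add_right (Nat.mul_le_mul_right _ (h.card_le hq.2)) 1)
  refine (sz_list_le (M := sz q) fun v hv => ?_).trans
    (Nat.add_le_add_right (Nat.mul_le_mul_right _ ?_) 1)
  · exact (sz_lt_of_mem (h.subset D hD hv)).le.trans hvs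
  · exact (((h.nodup D hD).subperm (h.subset D hD)).length_le.trans
      (length_lt_sz _).le).trans hvs

theorem PTime.hits {α : Type} [Enc α] {s : α → Prop} {B : α → ℕ} {c D : α → List Numeral}
    (hc : PTime s B c) (hD : PTime s B D) : PTime s B fun x => hits (c x) (D x) := by
  have h : PolyTime fun p : List Numeral × List Numeral => TreeProgram.hits p.1 p.2 :=
    PTime.length (PolyTime.filter (f := fun p v => decide (v ∈ p.2))
      (PTime.mem .proj₂ (PTime.snd .proj₁)) .proj₁)
  exact PolyTime.comp₂ h hc hD

theorem PTime.profile {α : Type} [Enc α] {s : α → Prop} {B : α → ℕ} {q : α → Problem}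
    {D : α → List Numeral} (hq : PTime s B q) (hD : PTime s B D) :
    PTime s B fun x => profile (q x) (D x) := by
  have h : PolyTime fun p : Problem × List Numeral => TreeProgram.profile p.1 p.2 :=
    PolyTime.map (f := fun p c => TreeProgram.hits c p.2) (PTime.hits .proj₂ (PTime.snd .proj₁))
      (PTime.cons (PTime.fst (PTime.snd .proj₁)) (PTime.snd (PTime.snd .proj₁)))
  exact PolyTime.comp₂ h hq hD

theorem PTime.addSet {α : Type} [Enc α] {s : α → Prop} {B : α → ℕ} {q : α → Problem}
    {R : α → List (List Numeral)} {D : α → List Numeral} (hq : PTime s B q) (hR : PTime s B R)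
    (hD : PTime s B D) : PTime s B fun x => addSet (q x) (R x) (D x) := by
  have h : PolyTime fun p : (Problem × List Numeral) × List (List Numeral) =>
      p.2.any fun D' => decide (TreeProgram.profile p.1.1 D' = TreeProgram.profile p.1.1 p.1.2) :=
    PolyTime.any (f := fun (p : (Problem × List Numeral) × List (List Numeral)) D' =>
      decide (TreeProgram.profile p.1.1 D' = TreeProgram.profile p.1.1 p.1.2)) (PolyTime.comp₂ (h := fun a b : List ℕ => decide (a = b))
      (PolyTime.list_eq (PTime.eq_nat .proj₁ .proj₂))
      (PTime.profile (PTime.fst (PTime.fst .proj₁)) .proj₂)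
      (PTime.profile (PTime.fst (PTime.fst .proj₁)) (PTime.snd (PTime.fst .proj₁)))) .proj₂
  exact PTime.cond' ((hD.length.le hq.fst).and (PTime.not (PolyTime.comp h
    ((hq.pair hD).pair hR)))) (hD.cons hR) hR

/-- The bound for the search. -/
def Problem.bound (q : Problem) : ℕ := sz q + q.numProfiles

/-- The domain contains the invariant of the search, since without it the list `R` could exceed the
bound. The existential `l` stands for the variables processed before the current one. -/
theorem PTime.extend : PTime
    (fun p : Problem × List (List Numeral) × Numeral => p.1.Small ∧
      ∃ l, Good p.1 l p.2.1 ∧ p.2.2 ∉ l ∧ l ++ [p.2.2] ⊆ p.1.2.1)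
    (fun p => sz p + p.1.bound) fun p => extend p.1 p.2.1 p.2.2 := by
  have hsz : PolyBdd (fun p : Problem × List (List Numeral) × Numeral => p.1.Small ∧
      ∃ l, Good p.1 l p.2.1 ∧ p.2.2 ∉ l ∧ l ++ [p.2.2] ⊆ p.1.2.1)
      (fun p => sz p + p.1.bound) fun p => sz p := .of_le fun _ _ => Nat.le_add_right _ _
  have hid := PTime.id hsz
  have hq : PolyBdd (fun p : Problem × List (List Numeral) × Numeral => p.1.Small ∧
      ∃ l, Good p.1 l p.2.1 ∧ p.2.2 ∉ l ∧ l ++ [p.2.2] ⊆ p.1.2.1)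
      (fun p => sz p + p.1.bound) fun p => sz p.1 := .of_le fun p _ => by
    simp only [Problem.bound]; omega
  refine PolyTime.foldl (step := fun (p : Problem × List (List Numeral) × Numeral) R D =>
    TreeProgram.addSet p.1 R (p.2.2 :: D)) (PTime.addSet (PTime.fst .proj₁) .proj₂₁
    (PTime.cons (PTime.snd (PTime.snd .proj₁)) .proj₂₂)) hid.snd.fst hid.snd.fst
    (fun p => p.1.numProfiles * (sz p.1 * (sz p.1 + 1) + 2) + 1)
    (((PolyBdd.of_le fun p _ => by simp only [Problem.bound]; omega).mul
      ((hq.mul (hq.add (.const 1))).add (.const 2))).add (.const 1)) ?_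
  rintro ⟨q, R, v⟩ ⟨hq, l, hgood, hv, hsub⟩ R₁ R₂ hR
  simp only at hq hgood hv hsub hR ⊢
  have h := ((hgood.mono (List.subset_append_left l [v])).foldl R₁
    fun D hD => hgood.cons_mem hv D (by rw [hR]; exact List.mem_append_left _ hD)).1
  exact h.sz_le hsub hq

/-- The invariant needed by `PTime.extend` at each prefix of the variables is supplied by
`reps_spec`. -/
theorem PTime.reps : PTime Problem.Small Problem.bound fun q => reps q q.2.1 := by
  have hsz : PolyBdd Problem.Small Problem.bound fun q => sz q :=
    .of_le fun _ _ => Nat.le_add_right _ _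
  have hid := PTime.id hsz
  refine PTime.foldl PTime.extend hid.snd.fst (.const hsz [[]])
    (fun q => (sz q + (q.numProfiles * (sz q * (sz q + 1) + 2) + 1) + sz q + 2) + q.bound)
    ((((hsz.add (((PolyBdd.of_le fun q _ => Nat.le_add_left _ _).mul
      ((hsz.mul (hsz.add (.const 1))).add (.const 2))).add (.const 1))).add hsz).add
      (.const 2)).add .self) ?_
  intro q hq l₁ v l₂ h
  have hpre : l₁ <+: q.2.1 := ⟨_, h.symm⟩
  have hgood := (reps_spec hq.1 l₁ hpre).1
  have hnd := hq.1
  rw [h] at hnd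
  refine ⟨⟨hq, l₁, hgood, fun hv => ?_, ?_⟩, ?_⟩
  · rw [List.nodup_append] at hnd
    exact hnd.2.2 v hv v List.mem_cons_self rfl
  · rw [h]
    intro u hu
    simp only [List.mem_append, List.mem_cons] at hu ⊢
    tauto
  · have h1 := hgood.sz_le hpre.subset hq
    have h2 : sz v < sz q.2.1 := sz_lt_of_mem (by rw [h]; simp)
    have h3 := sz_problem q
    simp only [TreeProgram.reps] at h1
    simp only [sz_pair]
    omega

theorem sumBelow_mono (f : ℕ → ℕ) {m n : ℕ} (h : m ≤ n) : sumBelow f m ≤ sumBelow f n := by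
  induction h with
  | refl => exact le_rfl
  | step _ ih => exact ih.trans (Nat.le_add_right _ _)

/-- By `hits_le`, the predicate is evaluated only at numbers up to `q.1 * q.maxOcc`, so one sum of
the values of `Bχ` in this range dominates the cost of every membership test. -/
theorem PTime.accepts {χ : ℕ → Bool} {Bχ : ℕ → ℕ} (hχ : PTime (fun _ => True) Bχ χ) :
    PTime Problem.Small (fun q => q.bound + sumBelow Bχ (q.1 * q.maxOcc + 1))
      fun q => accepts χ q := by
  have hinner : PTime (fun p : Problem × List Numeral =>
      p.1.Small ∧ p.2 ∈ TreeProgram.reps p.1 p.1.2.1)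
      (fun p => sz p + sumBelow Bχ (p.1.1 * p.1.maxOcc + 1)) fun p =>
      !(decide (p.2.length = p.1.1) &&
        (p.1.2.2.map fun c => χ (TreeProgram.hits c p.2)).all fun b => b) := by
    have hid := PTime.id (s := fun p : Problem × List Numeral =>
      p.1.Small ∧ p.2 ∈ TreeProgram.reps p.1 p.1.2.1)
      (B := fun p => sz p + sumBelow Bχ (p.1.1 * p.1.maxOcc + 1))
      (.of_le fun _ _ => Nat.le_add_right _ _)
    let C : (Problem × List Numeral) × List Numeral → ℕ := fun p =>
      sz p + Bχ (TreeProgram.hits p.2 p.1.2)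
    have hidC : PTime (fun _ => True) C fun p => p := .id (.of_le fun _ _ => Nat.le_add_right _ _)
    have hf : PTime (fun _ => True) C fun p : (Problem × List Numeral) × List Numeral =>
        χ (TreeProgram.hits p.2 p.1.2) :=
      hχ.comp (hidC.snd.hits hidC.fst.snd) (fun _ _ => trivial)
        (.of_le fun _ _ => Nat.le_add_left _ _)
    refine ((hid.snd.length.eq_nat hid.fst.fst).and (PTime.all_id (PTime.map
      (f := fun (p : Problem × List Numeral) c => χ (TreeProgram.hits c p.2)) hf hid.fst.snd.snd
      (fun p => 2 * sz p + 1 + sumBelow Bχ (p.1.1 * p.1.maxOcc + 1))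
      ((((PolyBdd.const 2).mul .self).add (.const 1)).mono fun p _ => by omega) ?_))).not
    rintro ⟨q, D⟩ ⟨hq, hD⟩ c hc
    simp only at hq hD hc
    refine ⟨trivial, ?_⟩
    have hgood := (reps_spec hq.1 q.2.1 List.prefix_rfl).1
    have h1 : Bχ (TreeProgram.hits c D) ≤ sumBelow Bχ (q.1 * q.maxOcc + 1) :=
      le_rec_sum Bχ (Nat.lt_succ_of_le (hits_le (hgood.nodup D hD) (hgood.subset D hD)
        (List.mem_cons_of_mem _ hc) (hgood.length_le D hD)))
    have h2 := sz_lt_of_mem hc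
    have h3 := sz_problem q
    simp only [C, sz_pair]
    omega
  have hreps := PTime.reps.mono (B' := fun q => q.bound + sumBelow Bχ (q.1 * q.maxOcc + 1))
    (.of_le fun _ _ => Nat.le_add_right _ _)
  refine (PTime.all_id (PTime.map hinner hreps (fun q => sz q + sz (TreeProgram.reps q q.2.1) + 1 +
    sumBelow Bχ (q.1 * q.maxOcc + 1)) (((hreps.size_in.add hreps.size_out).add (.const 1)).add
    (.of_le fun _ _ => Nat.le_add_left _ _)) ?_)).not
  intro q hq D hD
  refine ⟨⟨hq, hD⟩, ?_⟩
  have h2 := sz_lt_of_mem hD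
  simp only [sz_pair]
  omega

end TreeProgram

/-! ### Fixed-parameter tractability -/

namespace TreeProgram

open ParamCSP

/-- The weight, the variables and the scopes. A weight that exceeds the number `n` of variables is
replaced by `n + 1`. -/
def problemOf (L : List (List Numeral)) : Problem :=
  (cappedVal ((varsOf L).length + 1) (weightBits L), varsOf L, scopesOf L)

theorem maxOcc_problemOf (L : List (List Numeral)) : (problemOf L).maxOcc = maxOcc L := rfl

theorem nodup_varsOf {L : List (List Numeral)} (h : isInstance L = true) : (varsOf L).Nodup := by
  simp only [isInstance, Bool.and_eq_true, List.all_eq_true, decide_eq_true_eq] at h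
  refine List.nodup_iff_count_le_one.2 fun v => ?_
  by_cases hv : v ∈ varsOf L
  · exact h.2.2.2.1 v hv
  · rw [List.count_eq_zero_of_not_mem hv]
    exact Nat.zero_le _

/-- If there is a solution, its weight is at most the number of variables, and each scope contains
one of the at most `k * t` occupied positions because `0 ∉ E`; so both guards hold. Conversely, the
first guard says that the cut-off was not active, so the weight of `problemOf L` is the true one. -/
theorem listSat_iff {χ : ℕ → Bool} {E : Set ℕ} (hχ : ∀ n, χ n = true ↔ n ∈ E) (h0 : 0 ∉ E)
    {L : List (List Numeral)} (hvs : (varsOf L).Nodup) :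
    ListSat E L ↔ ((problemOf L).1 ≤ (varsOf L).length ∧
      (scopesOf L).length ≤ (problemOf L).1 * maxOcc L) ∧ accepts χ (problemOf L) = true := by
  have hcap : (problemOf L).1 = min (bitsVal (weightBits L)) ((varsOf L).length + 1) :=
    cappedVal_eq _ _
  rw [accepts_iff χ (q := problemOf L) hvs]
  have hhits : ∀ D c : List Numeral, c.countP (fun v => decide (v ∈ D)) = hits c D :=
    fun D c => List.countP_eq_length_filter
  simp only [ListSat, hhits]
  constructor
  · rintro ⟨D, hD, hsub, hlen, hsat⟩
    have hle : D.length ≤ (varsOf L).length := (hD.subperm hsub).length_le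
    have hk : (problemOf L).1 = D.length := by omega
    refine ⟨⟨hk ▸ hle, ?_⟩, D, hD, hsub, hk.symm, fun c hc => (hχ _).2 (hsat c hc)⟩
    have h1 := sum_hits_le (q := problemOf L) hD hsub
    rw [List.map_cons, List.sum_cons, maxOcc_problemOf] at h1
    -- This is where `0 ∉ E` enters: every scope contributes at least one to the sum.
    have h2 := List.length_le_sum_of_one_le ((problemOf L).2.2.map fun c => hits c D)
      fun i hi => by
        obtain ⟨c, hc, rfl⟩ := List.mem_map.1 hi
        exact Nat.one_le_iff_ne_zero.2 fun h => h0 (h ▸ hsat c hc)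
    rw [List.length_map] at h2
    rw [hk]
    exact (h2.trans (Nat.le_add_left _ _)).trans h1
  · rintro ⟨⟨hk, -⟩, D, hD, hsub, hlen, hsat⟩
    exact ⟨D, hD, hsub, by omega, fun c hc => (hχ _).1 (hsat c hc)⟩

/-- Decides whether the string encodes a satisfiable instance. -/
def decideSat (χ : ℕ → Bool) (x : List Γ') : Bool :=
  bif isCode x && (decide ((problemOf (parse x).2).1 ≤ (varsOf (parse x).2).length) &&
    decide ((scopesOf (parse x).2).length ≤ (problemOf (parse x).2).1 * maxOcc (parse x).2))
  then accepts χ (problemOf (parse x).2) else false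

theorem decideSat_iff {χ : ℕ → Bool} {E : Set ℕ} (hχ : ∀ n, χ n = true ↔ n ∈ E) (h0 : 0 ∉ E)
    (param : Instance (W E) → ℕ) (x : List Γ') :
    decideSat χ x = true ↔ x ∈ (CSP (W E) param).yes := by
  rw [mem_yes_iff, decideSat, Bool.cond_false_right, Bool.and_eq_true, Bool.and_eq_true,
    Bool.and_eq_true, decide_eq_true_iff, decide_eq_true_iff, and_assoc]
  refine and_congr_right fun hx => ?_
  rw [isCode, Bool.and_eq_true] at hx
  exact (listSat_iff hχ h0 (nodup_varsOf hx.2)).symm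

/-- The time bound in terms of the parameter, where `B` bounds the time for membership tests. -/
def growth (B : ℕ → ℕ) (n : ℕ) : ℕ := (n * n + 1) ^ (n * n + 1) + sumBelow B (n * n + 1)

theorem computable_pow : Computable₂ fun m n : ℕ => m ^ n :=
  (Primrec.nat_rec (f := fun _ : ℕ => 1) (g := fun m p => p.2 * m) (Primrec.const 1)
    (Primrec.nat_mul.comp (Primrec.snd.comp Primrec.snd) Primrec.fst).to₂).to_comp.of_eq
    fun ⟨m, n⟩ => by
      induction n with
      | zero => rfl
      | succ n ih => exact (congrArg (· * m) ih).trans (pow_succ m n).symm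

theorem computable_growth {B : ℕ → ℕ} (hB : Computable B) : Computable (growth B) := by
  have hn : Computable fun n : ℕ => n * n + 1 :=
    (Primrec.succ.comp (Primrec.nat_mul.comp Primrec.id Primrec.id)).to_comp
  have hsum : Computable (sumBelow B) :=
    Computable.nat_rec Computable.id (Computable.const 0) (Primrec.nat_add.to_comp.comp
      (Computable.snd.comp Computable.snd) (hB.comp (Computable.fst.comp Computable.snd))).to₂
  exact Primrec.nat_add.to_comp.comp (computable_pow.comp hn hn) (hsum.comp hn)

/-- The guards ensure that the search starts only on problems that are `Small`. The capped weight
and the number of occurrences are both at most `κ x`, so the bounds of the search are at most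
`growth B (κ x)` plus the size of the problem. -/
theorem PTime.decideSat {χ : ℕ → Bool} {B : ℕ → ℕ} {κ : List Γ' → ℕ}
    (hχ : PTime (fun _ => True) B χ) (hκ : ∀ x, isCode x = true →
      bitsVal (weightBits (parse x).2) ≤ κ x ∧ TreeProgram.maxOcc (parse x).2 ≤ κ x) :
    PTime (fun _ => True) (fun x => sz x + growth B (κ x)) (decideSat χ) := by
  have hsz : PolyBdd (fun _ => True) (fun x => sz x + growth B (κ x)) fun x : List Γ' => sz x :=
    .of_le fun _ _ => Nat.le_add_right _ _
  have hL := (PTime.snd PolyTime.parse).mono hsz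
  have hq : PTime (fun _ => True) (fun x => sz x + growth B (κ x))
      fun x => problemOf (parse x).2 :=
    (PTime.cappedVal hL.headI.headI hL.varsOf.length.succ).pair (hL.varsOf.pair hL.scopesOf)
  refine PTime.cond ((PolyTime.isCode.mono hsz).and ((hq.fst.le hL.varsOf.length).and
    (hL.scopesOf.length.le (hq.fst.mul hL.maxOcc)))) ?_ (.const (hsz.restrict fun _ h => h.1) false)
  have key : ∀ x, isCode x = true →
      (problemOf (parse x).2).1 * (problemOf (parse x).2).maxOcc ≤ κ x * κ x := fun x hx =>
    Nat.mul_le_mul ((cappedVal_eq _ _).le.trans ((min_le_left _ _).trans (hκ x hx).1)) (hκ x hx).2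
  refine (PTime.accepts hχ).comp (hq.restrict fun _ h => h.1) ?_ ?_
  · rintro x ⟨-, hx⟩
    simp only [Bool.and_eq_true, decide_eq_true_eq, isCode] at hx
    exact ⟨nodup_varsOf hx.1.2, hx.2.2⟩
  · refine ((hq.size_out.restrict fun _ h => h.1).add (PolyBdd.of_le
      (T := fun x => growth B (κ x)) fun _ _ => Nat.le_add_left _ _)).mono ?_
    rintro x ⟨-, hx⟩
    rw [Bool.and_eq_true] at hx
    have hk := Nat.succ_le_succ (key x hx.1)
    have h1 := sumBelow_mono B hk
    have h2 := (Nat.pow_le_pow_left hk _).trans (Nat.pow_le_pow_right (Nat.succ_pos _) hk)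
    simp only [Problem.bound, Problem.numProfiles, growth]
    simp only [Nat.succ_eq_add_one] at h1 h2
    omega

theorem PolyTime.isParameterization {κ : List Γ' → ℕ} {F : List Γ' → Numeral} (hF : PolyTime F)
    (h : ∀ x, F x = encodeNat (κ x)) : IsParameterization κ := by
  obtain ⟨M, T, ⟨c, hT⟩, hM⟩ := PTime.exists_machine hF
  have hrun : ∀ x : List Γ', Nonempty (TM2OutputsInTime M.tm (x.map M.inputAlphabet.invFun)
      (some ((encodeNat (κ x)).map M.outputAlphabet.invFun))
      (((Polynomial.C 12 * Polynomial.X + Polynomial.C 3) ^ c : Polynomial ℕ).eval x.length)) := by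
    intro x
    rw [← h]
    -- A string of length `n` has size at most `12 * n + 1`, and the polynomial bounds have base
    -- size plus `2`; hence the polynomial `(12 * X + 3) ^ c`.
    refine hM x _ ((hT x trivial).trans ?_)
    simp only [Polynomial.eval_pow, Polynomial.eval_add, Polynomial.eval_mul, Polynomial.eval_C,
      Polynomial.eval_X]
    have := sz_string_le x
    exact Nat.pow_le_pow_left (by omega) c
  exact ⟨⟨M, _, fun x => (hrun x).some⟩⟩

/-- The search needs only the weight and the number of occurrences to be bounded by the parameter,
so every polynomial time `p` above `maxOcc` is admissible. This covers `k + t` and `k + t + e` at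
once. -/
theorem isFPT_CSP {E : Set ℕ} (h0 : 0 ∉ E) (hE : ComputablePred fun n => n ∈ E)
    {param : Instance (W E) → ℕ} {p : List (List Numeral) → ℕ}
    (hparam : ∀ I, param I = I.k₀ + p (lists I)) (hp : PolyTime p) (hocc : ∀ L, maxOcc L ≤ p L) :
    (CSP (W E) param).IsFPT := by
  refine ⟨(PolyTime.paramBits hp).isParameterization (paramBits_eq param p hparam), ?_⟩
  obtain ⟨χ, B, hχ, hB, hχB⟩ := PTime.of_computablePred hE
  have hκ : ∀ x, isCode x = true → bitsVal (weightBits (parse x).2) ≤ (CSP (W E) param).κ x ∧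
      maxOcc (parse x).2 ≤ (CSP (W E) param).κ x := fun x hx => by
    rw [κ_eq param p hparam, if_pos hx]
    exact ⟨Nat.le_add_right _ _, (hocc _).trans (Nat.le_add_left _ _)⟩
  have hdec := PTime.decideSat hχB hκ
  obtain ⟨M, T, ⟨c, hT⟩, hM⟩ := PTime.exists_machine
    (hdec.cons (PTime.const hdec.size_in ([] : List Bool)))
  -- The bound is a power of a sum of input size and `growth`; the inequality `a + g ≤ (g + 1) * a`
  -- for `a ≥ 1` splits it into a function of the parameter times a polynomial.
  refine ⟨fun n => (growth B n + 1) ^ c, computable_pow.comp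
    (Computable.succ.comp (computable_growth hB)) (Computable.const c),
    (Polynomial.C 12 * Polynomial.X + Polynomial.C 3) ^ c, M, fun x => ?_⟩
  have hx : encodeBool (@decide (x ∈ (CSP (W E) param).yes) (Classical.propDecidable _)) =
      [TreeProgram.decideSat χ x] := by
    rw [encodeBool, List.pure_def]
    congr 1
    rw [Bool.eq_iff_iff, decideSat_iff hχ h0 param,
      @decide_eq_true_iff _ (Classical.propDecidable _)]
  rw [hx]
  refine hM x _ ((hT x trivial).trans ?_)
  simp only [Polynomial.eval_pow, Polynomial.eval_add, Polynomial.eval_mul, Polynomial.eval_C,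
    Polynomial.eval_X]
  rw [← mul_pow]
  have := sz_string_le x
  refine Nat.pow_le_pow_left ?_ c
  nlinarith

theorem isFPT_CSP_kt {E : Set ℕ} (h0 : 0 ∉ E) (hE : ComputablePred fun n => n ∈ E) :
    (CSP_kt (W E)).IsFPT :=
  isFPT_CSP h0 hE (p := maxOcc) (fun I => by rw [← t_eq_maxOcc]; rfl) (PTime.maxOcc PolyTime.id)
    fun _ => le_rfl

theorem isFPT_CSP_kte {E : Set ℕ} (h0 : 0 ∉ E) (hE : ComputablePred fun n => n ∈ E) :
    (CSP_kte (W E)).IsFPT :=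
  isFPT_CSP h0 hE (p := fun L => maxOcc L + maxMult L)
    (fun I => by rw [← t_eq_maxOcc, ← e_eq_maxMult, ← add_assoc]; rfl)
    ((PTime.maxOcc PolyTime.id).add (PTime.maxMult PolyTime.id)) fun _ => Nat.le_add_right _ _

theorem primrecPred_mem_of_finite {E : Set ℕ} (hE : E.Finite) : PrimrecPred fun n => n ∈ E :=
  ((Primrec.eq (α := ℕ)).exists_mem_list.comp (Primrec.const hE.toFinset.toList)
    Primrec.id).of_eq fun n => by simp

theorem primrecPred_mem_of_cofinite {E : Set ℕ} (h0 : 0 ∉ E)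
    (hE : ({n : ℕ | 0 < n} \ E).Finite) : PrimrecPred fun n => n ∈ E := by
  -- The complement of `E` in `ℕ` consists of the finitely many missing positive numbers and `0`.
  refine (primrecPred_mem_of_finite (hE.union (Set.finite_singleton 0))).not.of_eq fun n => ?_
  by_cases hn : n = 0
  · simp [hn, h0]
  · simp [hn, Nat.pos_of_ne_zero hn]

theorem primrecPred_odd : PrimrecPred fun n : ℕ => Odd n :=
  (Primrec.eq.comp (Primrec.nat_mod.comp Primrec.id (Primrec.const 2))
    (Primrec.const 1)).of_eq fun _ => Nat.odd_iff.symm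

end TreeProgram

theorem mainTheorem6 :
    (∀ E : Set ℕ, 0 ∉ E → ComputablePred (fun n : ℕ => n ∈ E) →
      (ParamCSP.CSP_kte (ParamCSP.W E)).IsFPT) ∧
    (∀ E : Set ℕ, 0 ∉ E → (E.Finite ∨ ({n : ℕ | 0 < n} \ E).Finite) →
      (ParamCSP.CSP_kt (ParamCSP.W E)).IsFPT) ∧
    (ParamCSP.CSP_kt (ParamCSP.W {n : ℕ | 0 < n})).IsFPT ∧
    (ParamCSP.CSP_kt (ParamCSP.W {1})).IsFPT ∧
    (ParamCSP.CSP_kt (ParamCSP.W {n : ℕ | Odd n})).IsFPT := by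
  refine ⟨fun E h0 hE => TreeProgram.isFPT_CSP_kte h0 hE, fun E h0 hE => ?_, ?_, ?_, ?_⟩
  · refine TreeProgram.isFPT_CSP_kt h0 (PrimrecPred.computablePred ?_)
    exact hE.elim TreeProgram.primrecPred_mem_of_finite
      (TreeProgram.primrecPred_mem_of_cofinite h0)
  · exact TreeProgram.isFPT_CSP_kt (by simp) (PrimrecPred.computablePred
      (TreeProgram.primrecPred_mem_of_cofinite (by simp) (by simp)))
  · exact TreeProgram.isFPT_CSP_kt (by simp) (PrimrecPred.computablePred
      (TreeProgram.primrecPred_mem_of_finite (Set.finite_singleton 1)))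
  · exact TreeProgram.isFPT_CSP_kt (by simp) TreeProgram.primrecPred_odd.computablePred
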